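/- Let $K$ be a field of characteristic $0$, $\bar K$ an algebraic closure, and $G_K=\operatorname{Gal}(\bar K/K)$. A \emph{variety over $K$} is a separated $K$-scheme $X$ of finite type such that $X_{\bar K}=X\times_K\bar K$ is integral. Let $V$ be a variety over $K$ in which every finite set of points is contained in an affine open subset (for example, $V$ quasi-projective), and let $f:V_{\bar K}\to V_{\bar K}$ be a $\bar K$-morphism. For an isomorphism $\varphi:W\to V_{\bar K}$ put $f^{\varphi}=\varphi^{-1}\circ f\circ\varphi$, and let $\mathcal A_f=\{\alpha\in\operatorname{Aut}(V_{\bar K}): f^\alpha=f\}$, with normalizer $\mathcal N_f$ in $\operatorname{Aut}(V_{\bar K})$. A superscript $\sigma\in G_K$ on a $\bar K$-morphism or $\bar K$-point denotes its Galois conjugate. Assume that (i) the field of moduli of $f$, i.e. the fixed field of $\{\sigma\in G_K:\ f^\sigma=f^{\varphi}\text{ for some }\varphi\in\operatorname{Aut}(V_{\bar K})\}$, is $K$; (ii) $\mathcal A_f$ is finite; (iii) $\mathcal A_f$ is defined over $K$, i.e. $\alpha^\sigma\in\mathcal A_f$ for all $\alpha\in\mathcal A_f$, $\sigma\in G_K$.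 Then the following hold. (a) The quotient variety $\bar V_f=V/\!/\mathcal A_f$ exists and is defined over $K$: there are a variety $Q$ over $K$ and a $K$-morphism $q:V\to Q$ whose base change $q_{\bar K}:V_{\bar K}\to Q_{\bar K}$ is the geometric quotient of $V_{\bar K}$ by $\mathcal A_f$ (its fibres are the $\mathcal A_f$-orbits, $Q_{\bar K}$ has the quotient topology, and functions on open sets of $Q_{\bar K}$ are the $\mathcal A_f$-invariant functions on their preimages). For every such $(Q,q)$, writing $\bar V_f$ for $Q$, there is a unique $\bar K$-morphism $\bar f:\bar V_{f,\bar K}\to\bar V_{f,\bar K}$ with $\bar f\circ q_{\bar K}=q_{\bar K}\circ f$. (b) For each $\sigma\in G_K$ the set $\varphi_\sigma$ of all $\psi\in\operatorname{Aut}(V_{\bar K})$ with $f^\sigma=f^{\psi}$ is an element of the group $\mathcal A_f\backslash\mathcal N_f$. There is an injective homomorphism $\mathcal A_f\backslash\mathcal N_f\hookrightarrow\operatorname{Aut}(\bar V_{f,\bar K})$ that sends the class of $\psi$ to the automorphism $\bar\psi$ with $\bar\psi\circ q_{\bar K}=q_{\bar K}\circ\psi$, and its composition with $\sigma\mapsto\varphi_\sigma$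 is a continuous $1$-cocycle $\hat\varphi:G_K\to\operatorname{Aut}(\bar V_{f,\bar K})$. The $\bar K/K$-twist of $\bar V_f$ by $\hat\varphi$ exists: there are a variety $T$ over $K$ and a $\bar K$-isomorphism $F:T_{\bar K}\to\bar V_{f,\bar K}$ with $\hat\varphi_\sigma\circ F^\sigma=F$ for all $\sigma\in G_K$. For every such $(T,F)$ the map $\bar f^F=F^{-1}\circ\bar f\circ F:T_{\bar K}\to T_{\bar K}$ is defined over $K$, i.e. it is the base change of a $K$-morphism $T\to T$. (c) For every such $(T,F)$ and every $P\in V(\bar K)$ with image $\bar P=q_{\bar K}(P)$ such that $F^{-1}(\bar P)\in T(K)$, we have for all $\sigma\in G_K$ \[ \varphi_\sigma^{-1}(P):=\{\psi^{-1}(P):\psi\in\varphi_\sigma\}=\mathcal A_f\cdot P^\sigma . \] -/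

import Mathlib

open CategoryTheory CategoryTheory.Limits AlgebraicGeometry

universe u v w

namespace FieldOfModuli

section Conjugation

variable {C : Type v} [Category.{w} C]

/-- The conjugate `f^φ = φ⁻¹ ∘ f ∘ φ` of an endomorphism `f` of `X` by an isomorphism `φ : Y ≅ X`
(in particular, by an automorphism of `X`). -/
def conj {X Y : C} (f : X ⟶ X) (φ : Y ≅ X) : Y ⟶ Y :=
  φ.hom ≫ f ≫ φ.inv

theorem conj_eq_iff {X Y : C} (f : X ⟶ X) (φ : Y ≅ X) (g : Y ⟶ Y) :
    conj f φ = g ↔ φ.hom ≫ f = g ≫ φ.hom := by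
  rw [conj, ← Category.assoc, Iso.comp_inv_eq]

theorem hom_comp_symm {X Y : C} (φ : Y ≅ X) (f : X ⟶ X) (g : Y ⟶ Y)
    (h : φ.hom ≫ f = g ≫ φ.hom) : φ.symm.hom ≫ g = f ≫ φ.symm.hom := by
  rw [Iso.symm_hom, Iso.inv_comp_eq, ← Category.assoc, h, Category.assoc, Iso.hom_inv_id,
    Category.comp_id]

/-- The automorphism group `Aut(f) = {α ∈ Aut(X) : f^α = f}` of an endomorphism `f` of `X`.
Multiplication in `Aut X` is composition of maps, `(α * β)(x) = α (β x)`. -/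
def autGroup {X : C} (f : X ⟶ X) : Subgroup (Aut X) where
  carrier := {α | conj f α = f}
  one_mem' := by
    change conj f (Iso.refl X) = f
    simp [conj]
  mul_mem' := by
    intro a b ha hb
    have ha' := (conj_eq_iff f a f).1 ha
    have hb' := (conj_eq_iff f b f).1 hb
    refine (conj_eq_iff f (a * b) f).2 ?_
    change (b.hom ≫ a.hom) ≫ f = f ≫ b.hom ≫ a.hom
    rw [Category.assoc, ha', reassoc_of% hb']
  inv_mem' := by
    intro a ha
    have ha' := (conj_eq_iff f a f).1 ha
    exact (conj_eq_iff f (Iso.symm a) f).2 (hom_comp_symm a f f ha')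

/-- The normalizer of `Aut(f)` in `Aut(X)`. -/
abbrev autNormalizer {X : C} (f : X ⟶ X) : Subgroup (Aut X) :=
  Subgroup.normalizer (autGroup f : Set (Aut X))

/-- The quotient group `Aut(f) \ N`, where `N` is the normalizer of `Aut(f)` in `Aut(X)`. -/
abbrev NormalizerQuotient {X : C} (f : X ⟶ X) : Type w :=
  autNormalizer f ⧸ (autGroup f).subgroupOf (autNormalizer f)

end Conjugation

section Quotient

variable {S : Scheme.{u}} {X Y : Over S}

theorem preimage_le_of_invariant {a : X ⟶ X} {π : X ⟶ Y} (h : a ≫ π = π) (U : Y.left.Opens) :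
    π.left ⁻¹ᵁ U ≤ a.left ⁻¹ᵁ π.left ⁻¹ᵁ U := by
  rw [← Scheme.Hom.comp_preimage, ← Over.comp_left, h]

/-- `π : X ⟶ Y` is the (geometric) quotient of the `S`-scheme `X` by the group `G` of
`S`-automorphisms of `X`: `π` is `G`-invariant, its fibres are the `G`-orbits, `Y` carries the
quotient topology, and the functions on an open `U ⊆ Y` are the `G`-invariant functions
on `π⁻¹(U)`. -/
structure IsQuotientBy (G : Subgroup (Aut X)) (π : X ⟶ Y) : Prop where
  invariant : ∀ a ∈ G, a.hom ≫ π = π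
  orbit : ∀ x y : X.left, π.left x = π.left y → ∃ a ∈ G, a.hom.left x = y
  isQuotientMap : Topology.IsQuotientMap π.left
  injective : ∀ U : Y.left.Opens, Function.Injective (π.left.app U)
  mem_range_iff : ∀ (U : Y.left.Opens) (s : Γ(X.left, π.left ⁻¹ᵁ U)),
    s ∈ Set.range (π.left.app U) ↔
      ∀ (a : Aut X) (ha : a ∈ G),
        a.hom.left.appLE (π.left ⁻¹ᵁ U) (π.left ⁻¹ᵁ U)
          (preimage_le_of_invariant (invariant a ha) U) s = s

end Quotient

/-- Every finite set of points of `X` is contained in an affine open subset. -/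
def FiniteSetsInAffineOpens (X : Scheme.{u}) : Prop :=
  ∀ s : Finset X, ∃ U : X.Opens, IsAffineOpen U ∧ ∀ x ∈ s, x ∈ U

section Galois

variable {K : Type u} [Field K] (Kbar : Type u) [Field Kbar] [Algebra K Kbar]

variable (K) in
/-- The morphism `Spec Kbar ⟶ Spec K`. -/
noncomputable abbrev specMap : Spec (.of Kbar) ⟶ Spec (.of K) :=
  Spec.map (CommRingCat.ofHom (algebraMap K Kbar))

/-- The base change `X ×_K Kbar` of a `K`-scheme `X`, as a scheme over `Kbar`. -/
noncomputable abbrev baseChange (X : Over (Spec (.of K))) : Over (Spec (.of Kbar)) :=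
  (Over.pullback (specMap K Kbar)).obj X

/-- The base change to `Kbar` of a morphism of `K`-schemes. -/
noncomputable abbrev baseChangeMap {X Y : Over (Spec (.of K))} (g : X ⟶ Y) :
    baseChange Kbar X ⟶ baseChange Kbar Y :=
  (Over.pullback (specMap K Kbar)).map g

/-- An algebraic variety defined over `K`: a separated `K`-scheme of finite type which is integral
over the algebraic closure `Kbar` of `K`. -/
structure IsVariety (X : Over (Spec (.of K))) : Prop where
  isSeparated : IsSeparated X.hom
  locallyOfFiniteType : LocallyOfFiniteType X.hom
  quasiCompact : QuasiCompact X.hom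
  isIntegral : IsIntegral (baseChange Kbar X).left

variable {Kbar}

/-- The morphism `Spec σ : Spec Kbar ⟶ Spec Kbar`. -/
noncomputable def specGal (σ : Gal(Kbar/K)) : Spec (.of Kbar) ⟶ Spec (.of Kbar) :=
  Spec.map (CommRingCat.ofHom (σ : Kbar →+* Kbar))

theorem specGal_comp_specMap (σ : Gal(Kbar/K)) : specGal σ ≫ specMap K Kbar = specMap K Kbar := by
  rw [specGal, ← Spec.map_comp, ← CommRingCat.ofHom_comp]
  congr 2
  ext x
  simp

theorem specGal_one : specGal (1 : Gal(Kbar/K)) = 𝟙 _ :=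
  Spec.map_id _

theorem specGal_mul (σ τ : Gal(Kbar/K)) : specGal (σ * τ) = specGal σ ≫ specGal τ := by
  rw [specGal, specGal, specGal, ← Spec.map_comp, ← CommRingCat.ofHom_comp]
  rfl

/-- The morphism `id × Spec σ` of the scheme `X ×_K Kbar`. It is `K`-linear, not `Kbar`-linear; on
an affine `X = Spec A` it is given by the ring map `id ⊗ σ` of `A ⊗ Kbar`. -/
noncomputable def galMap (σ : Gal(Kbar/K)) (X : Over (Spec (.of K))) :
    (baseChange Kbar X).left ⟶ (baseChange Kbar X).left :=
  pullback.lift (pullback.fst X.hom (specMap K Kbar))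
    (pullback.snd X.hom (specMap K Kbar) ≫ specGal σ)
    (by rw [Category.assoc, specGal_comp_specMap, pullback.condition])

@[simp]
theorem galMap_fst (σ : Gal(Kbar/K)) (X : Over (Spec (.of K))) :
    galMap σ X ≫ pullback.fst X.hom (specMap K Kbar) = pullback.fst X.hom (specMap K Kbar) :=
  pullback.lift_fst _ _ _

theorem galMap_snd (σ : Gal(Kbar/K)) (X : Over (Spec (.of K))) :
    galMap σ X ≫ (baseChange Kbar X).hom = (baseChange Kbar X).hom ≫ specGal σ :=
  pullback.lift_snd _ _ _

theorem galMap_one (X : Over (Spec (.of K))) : galMap (1 : Gal(Kbar/K)) X = 𝟙 _ := by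
  apply pullback.hom_ext
  · rw [galMap_fst, Category.id_comp]
  · refine (galMap_snd 1 X).trans ?_
    rw [specGal_one, Category.comp_id, Category.id_comp]
    rfl

theorem galMap_mul (σ τ : Gal(Kbar/K)) (X : Over (Spec (.of K))) :
    galMap (σ * τ) X = galMap σ X ≫ galMap τ X := by
  apply pullback.hom_ext
  · rw [galMap_fst, Category.assoc, galMap_fst, galMap_fst]
  · refine (galMap_snd (σ * τ) X).trans ?_
    change _ = (_ ≫ _) ≫ (baseChange Kbar X).hom
    rw [Category.assoc, galMap_snd, ← Category.assoc, galMap_snd, specGal_mul, Category.assoc]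

theorem galMap_comp_inv (σ : Gal(Kbar/K)) (X : Over (Spec (.of K))) :
    galMap σ X ≫ galMap σ⁻¹ X = 𝟙 _ := by
  rw [← galMap_mul, mul_inv_cancel, galMap_one]

theorem galMap_inv_comp (σ : Gal(Kbar/K)) (X : Over (Spec (.of K))) :
    galMap σ⁻¹ X ≫ galMap σ X = 𝟙 _ := by
  rw [← galMap_mul, inv_mul_cancel, galMap_one]

/-- The Galois conjugate `f^σ` of a `Kbar`-morphism `f : X ⟶ Y` of varieties defined over `K`
(apply `σ` to the coefficients of `f`). It is a left action of the group `Gal(Kbar/K)`: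
`f^(τ * σ) = (f^σ)^τ`. -/
noncomputable def galConj (σ : Gal(Kbar/K)) {X Y : Over (Spec (.of K))}
    (f : baseChange Kbar X ⟶ baseChange Kbar Y) : baseChange Kbar X ⟶ baseChange Kbar Y :=
  Over.homMk (galMap σ X ≫ f.left ≫ galMap σ⁻¹ Y) (by
    rw [Category.assoc, Category.assoc, galMap_snd, Over.w_assoc, ← Category.assoc, galMap_snd,
      Category.assoc, ← specGal_mul, mul_inv_cancel, specGal_one, Category.comp_id])

theorem galConj_left (σ : Gal(Kbar/K)) {X Y : Over (Spec (.of K))}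
    (f : baseChange Kbar X ⟶ baseChange Kbar Y) :
    (galConj σ f).left = galMap σ X ≫ f.left ≫ galMap σ⁻¹ Y := rfl

theorem galConj_one {X Y : Over (Spec (.of K))} (f : baseChange Kbar X ⟶ baseChange Kbar Y) :
    galConj 1 f = f := by
  ext1
  rw [galConj_left, inv_one, galMap_one, galMap_one, Category.id_comp, Category.comp_id]

theorem galConj_mul (τ σ : Gal(Kbar/K)) {X Y : Over (Spec (.of K))}
    (f : baseChange Kbar X ⟶ baseChange Kbar Y) :
    galConj (τ * σ) f = galConj τ (galConj σ f) := by
  ext1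
  simp only [galConj_left, mul_inv_rev, galMap_mul, Category.assoc]

theorem galConj_id (σ : Gal(Kbar/K)) (X : Over (Spec (.of K))) :
    galConj σ (𝟙 (baseChange Kbar X)) = 𝟙 _ := by
  ext1
  rw [galConj_left, Over.id_left, Category.id_comp, galMap_comp_inv]

theorem galConj_comp (σ : Gal(Kbar/K)) {X Y Z : Over (Spec (.of K))}
    (f : baseChange Kbar X ⟶ baseChange Kbar Y) (g : baseChange Kbar Y ⟶ baseChange Kbar Z) :
    galConj σ (f ≫ g) = galConj σ f ≫ galConj σ g := by
  ext1
  simp only [galConj_left, Over.comp_left, Category.assoc]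
  rw [← Category.assoc (galMap σ⁻¹ Y) (galMap σ Y), galMap_inv_comp, Category.id_comp]

/-- The Galois conjugate of an isomorphism. -/
noncomputable def galConjIso (σ : Gal(Kbar/K)) {X Y : Over (Spec (.of K))}
    (φ : baseChange Kbar X ≅ baseChange Kbar Y) : baseChange Kbar X ≅ baseChange Kbar Y where
  hom := galConj σ φ.hom
  inv := galConj σ φ.inv
  hom_inv_id := by rw [← galConj_comp, Iso.hom_inv_id, galConj_id]
  inv_hom_id := by rw [← galConj_comp, Iso.inv_hom_id, galConj_id]

theorem galConj_conj (σ : Gal(Kbar/K)) {X Y : Over (Spec (.of K))}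
    (f : baseChange Kbar X ⟶ baseChange Kbar X) (φ : baseChange Kbar Y ≅ baseChange Kbar X) :
    galConj σ (conj f φ) = conj (galConj σ f) (galConjIso σ φ) := by
  simp only [conj, galConj_comp, galConjIso]

/-- The Galois conjugate of an automorphism. -/
noncomputable def galConjAut (σ : Gal(Kbar/K)) {X : Over (Spec (.of K))}
    (α : Aut (baseChange Kbar X)) : Aut (baseChange Kbar X) :=
  galConjIso σ α

/-- A `Kbar`-morphism between `K`-schemes is defined over `K` if it is the base change of a
morphism of `K`-schemes. -/
def IsDefinedOver {X Y : Over (Spec (.of K))} (f : baseChange Kbar X ⟶ baseChange Kbar Y) : Prop :=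
  ∃ g : X ⟶ Y, baseChangeMap Kbar g = f

variable (Kbar) in
/-- The set `X(Kbar)` of `Kbar`-valued points of a `K`-scheme `X`, as sections of
`X ×_K Kbar ⟶ Spec Kbar`. -/
abbrev Point (X : Over (Spec (.of K))) : Type u :=
  Over.mk (𝟙 (Spec (.of Kbar))) ⟶ baseChange Kbar X

/-- The Galois conjugate `P^σ` of a point `P ∈ X(Kbar)` (apply `σ` to the coordinates of `P`). -/
noncomputable def galConjPoint (σ : Gal(Kbar/K)) {X : Over (Spec (.of K))} (P : Point Kbar X) :
    Point Kbar X :=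
  Over.homMk (specGal σ ≫ P.left ≫ galMap σ⁻¹ X) (by
    have hP : P.left ≫ (baseChange Kbar X).hom = 𝟙 _ := Over.w P
    rw [Category.assoc, Category.assoc, galMap_snd, ← Category.assoc P.left, hP,
      Category.id_comp, ← specGal_mul, mul_inv_cancel, specGal_one]
    rfl)

/-- A point of `X(Kbar)` is `K`-rational if it comes from a point `p ∈ X(K)`, that is, from a
section of `X ⟶ Spec K`. -/
def IsRationalPoint {X : Over (Spec (.of K))} (P : Point Kbar X) : Prop :=
  ∃ p : Over.mk (𝟙 (Spec (.of K))) ⟶ X,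
    P.left ≫ pullback.fst X.hom (specMap K Kbar) = specMap K Kbar ≫ p.left

/-- The set of `φ ∈ Aut(X)` with `f^σ = f^φ`, that is, the `Aut(f)`-coset `φ_σ` attached to `σ`
(when it is not empty). -/
def conjugators {X : Over (Spec (.of K))} (f : baseChange Kbar X ⟶ baseChange Kbar X)
    (σ : Gal(Kbar/K)) : Set (Aut (baseChange Kbar X)) :=
  {φ | galConj σ f = conj f φ}

theorem galConj_mul_eq_conj (τ σ : Gal(Kbar/K)) {X : Over (Spec (.of K))}
    (f : baseChange Kbar X ⟶ baseChange Kbar X) (φ ψ : baseChange Kbar X ≅ baseChange Kbar X)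
    (hφ : galConj τ f = conj f φ) (hψ : galConj σ f = conj f ψ) :
    galConj (τ * σ) f = conj f (galConjIso τ ψ ≪≫ φ) := by
  rw [galConj_mul, hψ, galConj_conj, hφ]
  simp only [conj, Category.assoc, Iso.trans_hom, Iso.trans_inv]

theorem galConj_inv_eq_conj (σ : Gal(Kbar/K)) {X : Over (Spec (.of K))}
    (f : baseChange Kbar X ⟶ baseChange Kbar X) (φ : baseChange Kbar X ≅ baseChange Kbar X)
    (hφ : galConj σ f = conj f φ) :
    galConj σ⁻¹ f = conj f (galConjIso σ⁻¹ φ).symm := by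
  have h := congrArg (galConj σ⁻¹) hφ
  rw [← galConj_mul, inv_mul_cancel, galConj_one, galConj_conj] at h
  exact ((conj_eq_iff _ _ _).2 (hom_comp_symm _ _ _ ((conj_eq_iff _ _ _).1 h.symm))).symm

/-- The group of all `σ ∈ Gal(Kbar/K)` for which there is a `φ ∈ Aut(X)` with `f^σ = f^φ`. -/
def moduliGroup {X : Over (Spec (.of K))} (f : baseChange Kbar X ⟶ baseChange Kbar X) :
    Subgroup Gal(Kbar/K) where
  carrier := {σ | ∃ φ : Aut (baseChange Kbar X), galConj σ f = conj f φ}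
  one_mem' := ⟨1, (galConj_one f).trans ((autGroup f).one_mem).symm⟩
  mul_mem' := by
    rintro τ σ ⟨φ, hφ⟩ ⟨ψ, hψ⟩
    exact ⟨φ * galConjAut τ ψ, galConj_mul_eq_conj τ σ f φ ψ hφ hψ⟩
  inv_mem' := by
    rintro σ ⟨φ, hφ⟩
    exact ⟨(galConjAut σ⁻¹ φ)⁻¹, galConj_inv_eq_conj σ f φ hφ⟩

/-- The field of moduli of `f` (relative to the base field `K`): the fixed field of the group of
all `σ ∈ Gal(Kbar/K)` such that `f^σ = f^φ` for some `φ ∈ Aut(X)`. -/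
noncomputable def fieldOfModuli {X : Over (Spec (.of K))}
    (f : baseChange Kbar X ⟶ baseChange Kbar X) : IntermediateField K Kbar :=
  IntermediateField.fixedField (moduliGroup f)

/-- A group of `Kbar`-automorphisms of `X` is defined over `K` if it is stable under the Galois
group. -/
def IsDefinedOverSubgroup {X : Over (Spec (.of K))} (G : Subgroup (Aut (baseChange Kbar X))) :
    Prop :=
  ∀ (σ : Gal(Kbar/K)), ∀ α ∈ G, galConjAut σ α ∈ G

/-- A (continuous) 1-cocycle of `Gal(Kbar/K)` with values in the discrete group `Aut(X)`. Since
the action is written as a left action, the cocycle relation for "first `σ`, then `τ`" reads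
`c (τ * σ) = c τ ∘ (c σ)^τ`. -/
structure IsCocycle {X : Over (Spec (.of K))} (c : Gal(Kbar/K) → Aut (baseChange Kbar X)) :
    Prop where
  map_mul : ∀ τ σ : Gal(Kbar/K), c (τ * σ) = c τ * galConjAut τ (c σ)
  isLocallyConstant : IsLocallyConstant c

/-- The `Kbar`-isomorphism `F : T ⟶ X` exhibits the `K`-scheme `T` as the `Kbar/K`-twist of `X`
by the cocycle `c`: `c_σ ∘ F^σ = F` for all `σ`. -/
def IsTwist {X T : Over (Spec (.of K))} (c : Gal(Kbar/K) → Aut (baseChange Kbar X))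
    (F : baseChange Kbar T ≅ baseChange Kbar X) : Prop :=
  ∀ σ : Gal(Kbar/K), galConj σ F.hom ≫ (c σ).hom = F.hom

end Galois

end FieldOfModuli

/-! Everything comes from one construction: the quotient of the scheme `V_Kbar` by a group E of
semilinear automorphisms that is an extension of G_K by the finite group A = Aut(f) and contains an
open subgroup of the Galois action (`IsDescentGroup`). E is usually infinite, but a section over a
nonempty E-stable open set is fixed by an open subgroup of G_K. Since A is finite and G_K is
compact, its E-orbit is finite. This replaces finiteness of the group in the classical theory: orbit
polynomials give integrality over the invariants, prime avoidance shows that the fibres are orbits,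
and the hypothesis on finite sets of points gives E-stable affine neighbourhoods. The affine
quotients glue to a K-scheme T (`IsAction.exists_quotient`).

The base change of T is the quotient by A alone. Over an affine open subset of T, the A-invariant
functions carry a continuous semilinear action of E/A = G_K whose invariants are the functions on T.
Galois descent (Dedekind independence of characters) identifies the tensor product of these with
`Kbar` with all A-invariant functions (`IsDescentGroup.app_bijective`). The properties of a variety
then pass from V to T (`IsDescentGroup.isVariety_and_isQuotientBy`).

Two choices of E give both varieties of the theorem. If E is generated by A and G_K, a group because
A is Galois stable, the quotient is Q, and the projection is Galois invariant and so descends to K.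
If E consists of the semilinear automorphisms commuting with f, the quotient is the twist: an
equality f^σ = f^ψ says exactly that ψ⁻¹ followed by the Galois map of σ commutes with f, so E
reaches every σ once conjugators exist for every σ. They do because the stabilizer of the
isomorphism class of f is an open, hence closed, subgroup with fixed field K. Both base changes are
quotients by A, and comparing them gives F.

The remaining assertions can be checked after composing with the quotient map, which can be
cancelled. Injectivity of the map to Aut(Q) is different: an automorphism inducing the identity on Q
moves each function on a stable affine open set within its A-orbit, and a vector space over an
infinite field is not a finite union of proper subspaces, so one element of A works for all
functions (`IsDescentGroup.mem_of_hom_comp_eq`). For the last assertion, rationality of F⁻¹(P̄)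
shows that P and ψ(P^σ) have the same image in Q, hence lie in one A-orbit; ψ normalizes A. -/

namespace FieldOfModuli

/-! ### Rings of invariants for actions with finite orbits -/

section Invariants

/-- The subring of elements fixed by a family of ring endomorphisms. -/
def fixedSubring {ι R : Type*} [CommRing R] (φ : ι → R →+* R) : Subring R where
  carrier := {r | ∀ i, φ i r = r}
  mul_mem' ha hb i := by rw [map_mul, ha, hb]
  one_mem' i := map_one _
  add_mem' ha hb i := by rw [map_add, ha, hb]
  zero_mem' i := map_zero _
  neg_mem' ha i := by rw [map_neg, ha]

variable {G R : Type*} [Group G] [CommRing R] (φ : G → R →+* R)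

/-- `φ` is a right action of the group `G` on the ring `R`. -/
structure IsRightAction : Prop where
  one : φ 1 = RingHom.id R
  mul : ∀ g h, φ (g * h) = (φ h).comp (φ g)

variable {φ}

namespace IsRightAction

theorem inv_apply (hφ : IsRightAction φ) (g : G) (r : R) : φ g⁻¹ (φ g r) = r := by
  rw [← RingHom.comp_apply, ← hφ.mul, mul_inv_cancel, hφ.one, RingHom.id_apply]

theorem apply_inv (hφ : IsRightAction φ) (g : G) (r : R) : φ g (φ g⁻¹ r) = r := by
  rw [← RingHom.comp_apply, ← hφ.mul, inv_mul_cancel, hφ.one, RingHom.id_apply]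

theorem image_orbit (hφ : IsRightAction φ) (r : R) (g : G) :
    φ g '' Set.range (fun h => φ h r) = Set.range (fun h => φ h r) := by
  ext x
  constructor
  · rintro ⟨_, ⟨h, rfl⟩, rfl⟩
    exact ⟨h * g, by simp [hφ.mul]⟩
  · rintro ⟨h, rfl⟩
    exact ⟨φ (h * g⁻¹) r, ⟨_, rfl⟩, by simp [hφ.mul, hφ.apply_inv]⟩

theorem injective (hφ : IsRightAction φ) (g : G) : Function.Injective (φ g) :=
  Function.LeftInverse.injective (hφ.inv_apply g)

/-- The element g permutes the orbit of r, so it only reorders the factors of a product over the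
orbit. -/
theorem map_prod_orbit (hφ : IsRightAction φ) {r : R} (hr : (Set.range fun h => φ h r).Finite)
    {M : Type*} [CommMonoid M] (F : R → M) (F' : R → M) (g : G) (hF : ∀ x, F' x = F (φ g x)) :
    ∏ c ∈ hr.toFinset, F' c = ∏ c ∈ hr.toFinset, F c := by
  classical
  have : hr.toFinset = hr.toFinset.image (φ g) := by
    rw [← Finset.coe_inj, Finset.coe_image, Set.Finite.coe_toFinset, hφ.image_orbit]
  conv_rhs => rw [this, Finset.prod_image (fun _ _ _ _ h => hφ.injective g h)]
  exact Finset.prod_congr rfl fun x _ => hF x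

theorem mem_orbit_self (hφ : IsRightAction φ) (r : R) : r ∈ Set.range fun h => φ h r :=
  ⟨1, by simp [hφ.one]⟩

/-- The orbit polynomial of `r` has invariant coefficients. -/
theorem exists_monic (hφ : IsRightAction φ) {r : R} (hr : (Set.range fun h => φ h r).Finite) :
    ∃ p : Polynomial (fixedSubring φ), p.Monic ∧
      p.map (fixedSubring φ).subtype =
        ∏ c ∈ hr.toFinset, (Polynomial.X - Polynomial.C c) := by
  set P : Polynomial R := ∏ c ∈ hr.toFinset, (Polynomial.X - Polynomial.C c) with hP
  have hfix : ∀ g, P.map (φ g) = P := fun g => by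
    rw [hP, Polynomial.map_prod]
    simp only [Polynomial.map_sub, Polynomial.map_X, Polynomial.map_C]
    exact hφ.map_prod_orbit hr (fun c => Polynomial.X - Polynomial.C c) _ g fun x => rfl
  have hcoeff : (↑P.coeffs : Set R) ⊆ fixedSubring φ := by
    intro a ha g
    obtain ⟨n, -, rfl⟩ := Polynomial.mem_coeffs_iff.1 ha
    rw [← Polynomial.coeff_map, hfix]
  refine ⟨P.toSubring _ hcoeff, ?_, ?_⟩
  · rw [Polynomial.monic_toSubring]
    exact Polynomial.monic_prod_of_monic _ _ fun c _ => Polynomial.monic_X_sub_C c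
  · ext n
    rw [Polynomial.coeff_map]
    exact Polynomial.coeff_toSubring' _ _ _

/-- Each r is a root of its orbit polynomial, which is monic with invariant coefficients. Only
finiteness of orbits is needed, not of the group. -/
theorem isIntegral (hφ : IsRightAction φ) (hfin : ∀ r, (Set.range fun h => φ h r).Finite) :
    (fixedSubring φ).subtype.IsIntegral := by
  intro r
  obtain ⟨p, hp, hpr⟩ := hφ.exists_monic (hfin r)
  refine ⟨p, hp, ?_⟩
  rw [Polynomial.eval₂_eq_eval_map, hpr, Polynomial.eval_prod]
  exact Finset.prod_eq_zero ((hfin r).mem_toFinset.2 (hφ.mem_orbit_self r)) (by simp)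

/-- An endomorphism that fixes all invariants moves `r` inside its orbit. -/
theorem exists_apply_eq [IsDomain R] (hφ : IsRightAction φ) {r : R}
    (hr : (Set.range fun h => φ h r).Finite) (ψ : R →+* R)
    (hψ : ∀ s ∈ fixedSubring φ, ψ s = s) : ∃ g, ψ r = φ g r := by
  obtain ⟨p, -, hpr⟩ := hφ.exists_monic hr
  have h1 : (p.map (fixedSubring φ).subtype).eval r = 0 := by
    rw [hpr, Polynomial.eval_prod]
    exact Finset.prod_eq_zero (hr.mem_toFinset.2 (hφ.mem_orbit_self r)) (by simp)
  -- ψ fixes the coefficients of the orbit polynomial, so it maps the root r to another root; in a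
  -- domain the only roots are the members of the orbit.
  have h2 : (p.map (fixedSubring φ).subtype).map ψ = p.map (fixedSubring φ).subtype := by
    rw [Polynomial.map_map]
    congr 1
    ext s
    exact hψ s s.2
  have h3 : (p.map (fixedSubring φ).subtype).eval (ψ r) = 0 := by
    have := congrArg ψ h1
    rwa [map_zero, ← Polynomial.eval_map_apply, h2] at this
  rw [hpr, Polynomial.eval_prod, Finset.prod_eq_zero_iff] at h3
  obtain ⟨c, hc, h⟩ := h3
  obtain ⟨g, rfl⟩ := hr.mem_toFinset.1 hc
  exact ⟨g, by simpa [sub_eq_zero] using h⟩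

/-- For b in p the product over the orbit of b is invariant and lies in p, hence in q, so some
conjugate of b lies in q. Thus p is covered by the conjugates of q, and prime avoidance puts it
inside one of them. -/
theorem exists_le_comap [IsNoetherianRing R] (hφ : IsRightAction φ)
    (hfin : ∀ r, (Set.range fun h => φ h r).Finite) (p q : Ideal R) [p.IsPrime] [q.IsPrime]
    (hpq : ∀ r ∈ fixedSubring φ, r ∈ p → r ∈ q) : ∃ g, p ≤ q.comap (φ g) := by
  classical
  have hcm : ∀ g, q.comap (φ g) = q.map (φ g⁻¹) := fun g => by
    apply le_antisymm
    · intro r hr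
      rw [← hφ.inv_apply g r]
      exact Ideal.mem_map_of_mem _ hr
    · rw [Ideal.map_le_iff_le_comap]
      intro r hr
      rw [Ideal.mem_comap, Ideal.mem_comap, hφ.apply_inv]
      exact hr
  -- Prime avoidance needs finitely many conjugates, although G may be infinite. A conjugate is
  -- generated by the images of finitely many generators of q, and each of these has a finite orbit.
  have hfinq : (Set.range fun g => q.comap (φ g)).Finite := by
    obtain ⟨s, hs⟩ := IsNoetherian.noetherian q
    have hpi : (Set.pi Set.univ fun r : s => Set.range fun h => φ h (r : R)).Finite :=
      Set.Finite.pi fun r => hfin r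
    refine (hpi.image fun t => Ideal.span (Set.range t)).subset ?_
    rintro _ ⟨g, rfl⟩
    refine ⟨fun r => φ g⁻¹ r, fun r _ => ⟨_, rfl⟩, ?_⟩
    simp only [hcm]
    rw [← hs]
    change _ = Ideal.map (φ g⁻¹) (Ideal.span (s : Set R))
    rw [Ideal.map_span]
    congr 1
    ext x
    simp
  have hcov : (p : Set R) ⊆ ⋃ I ∈ Set.range (fun g => q.comap (φ g)), ((I : Ideal R) : Set R) := by
    intro b hb
    have h1 : ∏ c ∈ (hfin b).toFinset, c ∈ fixedSubring φ := fun g => by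
      rw [map_prod]
      exact hφ.map_prod_orbit (hfin b) (fun x => x) _ g fun _ => rfl
    have h2 : ∏ c ∈ (hfin b).toFinset, c ∈ p :=
      Ideal.mem_of_dvd _ (Finset.dvd_prod_of_mem (fun x => x)
        ((hfin b).mem_toFinset.2 (hφ.mem_orbit_self b))) hb
    obtain ⟨c, hc, hcq⟩ := (Ideal.IsPrime.prod_mem_iff).1 (hpq _ h1 h2)
    obtain ⟨g, rfl⟩ := (hfin b).mem_toFinset.1 hc
    exact Set.mem_biUnion ⟨g, rfl⟩ hcq
  obtain ⟨I, ⟨g, rfl⟩, hI⟩ := (Ideal.subset_union_prime_finite hfinq (f := id) ⊥ ⊥ (by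
    rintro _ ⟨g, rfl⟩ _ _
    exact Ideal.comap_isPrime _ _)).1 hcov
  exact ⟨g, hI⟩

/-- Primes with the same invariant elements are conjugate. -/
theorem exists_eq_comap [IsNoetherianRing R] (hφ : IsRightAction φ)
    (hfin : ∀ r, (Set.range fun h => φ h r).Finite) (p q : Ideal R) [p.IsPrime] [q.IsPrime]
    (hpq : ∀ r ∈ fixedSubring φ, r ∈ p ↔ r ∈ q) : ∃ g, p = q.comap (φ g) := by
  obtain ⟨g, hg⟩ := hφ.exists_le_comap hfin p q fun r hr => (hpq r hr).1
  obtain ⟨h, hh⟩ := hφ.exists_le_comap hfin q p fun r hr => (hpq r hr).2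
  -- A prime contained in a conjugate of itself is equal to it: iterating the inclusion gives an
  -- ascending chain of ideals, which stabilizes, and undoing the n-th power of k brings the
  -- equality back to the first step.
  have key : ∀ k, p ≤ p.comap (φ k) → p.comap (φ k) ≤ p := by
    intro k hk
    have hmono : ∀ n : ℕ, p.comap (φ (k ^ n)) ≤ p.comap (φ (k ^ (n + 1))) := fun n => by
      rw [pow_succ', hφ.mul, ← Ideal.comap_comap]
      intro r hr
      rw [Ideal.mem_comap, Ideal.mem_comap, ← RingHom.comp_apply, ← hφ.mul,
        ← (Commute.refl k).pow_left n, hφ.mul]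
      exact hk hr
    obtain ⟨n, hn⟩ := monotone_stabilizes_iff_noetherian.2 ‹IsNoetherianRing R›
      ⟨fun n => p.comap (φ (k ^ n)), monotone_nat_of_le_succ hmono⟩
    have h1 : p.comap (φ (k ^ n)) = p.comap (φ (k ^ (n + 1))) := hn (n + 1) (Nat.le_succ n)
    intro r hr
    have h2 : φ (k ^ n)⁻¹ r ∈ p.comap (φ (k ^ (n + 1))) := by
      rw [pow_succ, hφ.mul, Ideal.mem_comap, RingHom.comp_apply, hφ.apply_inv]
      exact hr
    rw [← h1, Ideal.mem_comap, hφ.apply_inv] at h2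
    exact h2
  have h3 : q.comap (φ g) ≤ p.comap (φ (g * h)) := by
    rw [hφ.mul, ← Ideal.comap_comap]
    exact Ideal.comap_mono hh
  exact ⟨g, le_antisymm hg (h3.trans (key _ (hg.trans h3)))⟩

end IsRightAction

end Invariants

/-! ### Galois descent for vector spaces and algebras -/

section GaloisDescent

open scoped Topology TensorProduct

variable {K L : Type*} [Field K] [Field L] [Algebra K L]

/-- `ψ` is a semilinear action of the Galois group on the `L`-vector space `M`. -/
structure IsSemilinearAction {M : Type*} [AddCommGroup M] [Module L M]
    (ψ : Gal(L/K) → M →+ M) : Prop where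
  one : ∀ m, ψ 1 m = m
  mul : ∀ σ τ m, ψ (σ * τ) m = ψ σ (ψ τ m)
  smul : ∀ σ (c : L) m, ψ σ (c • m) = σ c • ψ σ m

namespace IsSemilinearAction

variable {M : Type*} [AddCommGroup M] [Module L M] {ψ : Gal(L/K) → M →+ M}

/-- The quotient τ⁻¹σ fixes E pointwise, hence fixes both c and m. So the value depends only on the
restriction to E, and arbitrary lifts from Gal(E/K) may be used. -/
theorem apply_eq_of_restrict_eq (hψ : IsSemilinearAction ψ) {E : IntermediateField K L} {m : M}
    (hm : ∀ σ ∈ E.fixingSubgroup, ψ σ m = m) {σ τ : Gal(L/K)} (h : ∀ x : E, σ x = τ x) (c : E) :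
    ψ σ ((c : L) • m) = ψ τ ((c : L) • m) := by
  have h1 : τ⁻¹ * σ ∈ E.fixingSubgroup := by
    rw [IntermediateField.mem_fixingSubgroup_iff]
    intro x hx
    rw [AlgEquiv.mul_apply, h ⟨x, hx⟩]
    exact τ.symm_apply_apply x
  have h2 : σ = τ * (τ⁻¹ * σ) := by group
  rw [h2, hψ.mul, hψ.smul, hm _ h1, (IntermediateField.mem_fixingSubgroup_iff _ _).1 h1 _ c.2]

/-- Every vector with open stabilizer is a linear combination of invariant vectors. -/
theorem mem_span (hψ : IsSemilinearAction ψ) [Normal K L] {m : M}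
    (hm : ∀ᶠ σ in 𝓝 (1 : Gal(L/K)), ψ σ m = m) :
    m ∈ Submodule.span L {x | ∀ σ, ψ σ x = x} := by
  obtain ⟨E, hEfin, hEn, hE⟩ := (krullTopology_mem_nhds_one_iff_of_normal K L _).1 hm
  replace hE : ∀ σ ∈ E.fixingSubgroup, ψ σ m = m := fun σ hσ => hE hσ
  let ℓ : (E ≃ₐ[K] E) → Gal(L/K) := fun τ => AlgEquiv.liftNormal τ L
  have hℓ : ∀ (τ : E ≃ₐ[K] E) (x : E), ℓ τ x = τ x := fun τ x =>
    AlgEquiv.liftNormal_commutes τ L x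
  -- The trace of c • m over Gal(E/K), computed with arbitrary lifts; it is an invariant vector for
  -- every c in E.
  let t : E → M := fun c => ∑ τ : E ≃ₐ[K] E, ψ (ℓ τ) ((c : L) • m)
  have ht : ∀ c g, ψ g (t c) = t c := by
    intro c g
    rw [map_sum]
    refine Fintype.sum_equiv (Equiv.mulLeft (g.restrictNormal E)) _ _ fun τ => ?_
    rw [← hψ.mul]
    refine hψ.apply_eq_of_restrict_eq hE (fun x => ?_) c
    rw [AlgEquiv.mul_apply, hℓ, hℓ]
    exact (AlgEquiv.restrictNormal_commutes g E (τ x)).symm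
  by_contra hmem
  obtain ⟨l, hl, hker⟩ := Submodule.exists_le_ker_of_notMem hmem
  have h0 : ∀ c : E, ∑ τ : E ≃ₐ[K] E, l (ψ (ℓ τ) m) * (τ c : L) = 0 := by
    intro c
    have h1 : l (t c) = 0 := hker (Submodule.subset_span (ht c))
    rw [map_sum] at h1
    rw [← h1]
    refine Finset.sum_congr rfl fun τ _ => ?_
    rw [hψ.smul, hℓ, map_smul, smul_eq_mul, mul_comm]
  -- A functional l that kills all traces gives a linear relation between the embeddings τ of E into
  -- L. By Dedekind its coefficients vanish, and the one at τ = 1 is l m.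
  let χ : (E ≃ₐ[K] E) → (E →* L) := fun τ => ((algebraMap E L).comp (τ : E →+* E) : E →+* L)
  have hχ : Function.Injective χ := by
    intro τ τ' h
    ext x
    exact DFunLike.congr_fun h x
  have hli := (linearIndependent_monoidHom E L).comp χ hχ
  rw [Fintype.linearIndependent_iff] at hli
  have h2 := hli (fun τ => l (ψ (ℓ τ) m)) (by
    ext c
    rw [Finset.sum_apply]
    exact h0 c) 1
  have h3 : ψ (ℓ 1) m = m := by
    refine hE _ ((IntermediateField.mem_fixingSubgroup_iff _ _).2 fun x hx => ?_)
    exact hℓ 1 ⟨x, hx⟩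
  rw [h3] at h2
  exact hl h2

/-- Invariant vectors that are linearly independent over `K` remain so over `L`. -/
theorem linearIndependent (hψ : IsSemilinearAction ψ) [IsGalois K L] {ι : Type*} {S : Type*}
    [AddCommGroup S] [Module K S] (f : S →+ M)
    (hf : ∀ (a : K) s, f (a • s) = algebraMap K L a • f s) (hinj : Function.Injective f)
    (hfix : ∀ s σ, ψ σ (f s) = f s)
    {s : ι → S} (hs : LinearIndependent K s) : LinearIndependent L (f ∘ s) := by
  classical
  rw [linearIndependent_iff']
  intro t
  induction t using Finset.induction_on with
  | empty => simp
  | insert a t hat ih =>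
    intro c hc
    by_cases hca : c a = 0
    · rw [Finset.sum_insert hat, hca, zero_smul, zero_add] at hc
      intro i hi
      rcases Finset.mem_insert.1 hi with rfl | hi
      · exact hca
      · exact ih c hc i hi
    exfalso
    -- Normalized so that the coefficient at a is 1. Subtracting the relation from its σ-conjugate
    -- then removes a, so by induction the coefficients are Galois invariant, hence in K.
    let d : ι → L := fun i => (c a)⁻¹ * c i
    have hd : ∑ i ∈ insert a t, d i • (f ∘ s) i = 0 := by
      simp only [d, mul_smul, ← Finset.smul_sum, hc, smul_zero]
    have hda : d a = 1 := inv_mul_cancel₀ hca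
    have hdσ : ∀ σ : Gal(L/K), ∀ i ∈ insert a t, σ (d i) = d i := by
      intro σ
      have h1 : ∑ i ∈ insert a t, σ (d i) • (f ∘ s) i = 0 := by
        have := congrArg (ψ σ) hd
        rw [map_sum, map_zero] at this
        rw [← this]
        exact Finset.sum_congr rfl fun i _ => by
          rw [hψ.smul, Function.comp_apply, hfix]
      have h2 : ∑ i ∈ t, (σ (d i) - d i) • (f ∘ s) i = 0 := by
        have := sub_eq_zero.2 (h1.trans hd.symm)
        rw [← Finset.sum_sub_distrib, Finset.sum_insert hat, hda, map_one, sub_self,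
          zero_add] at this
        simpa only [sub_smul] using this
      intro i hi
      rcases Finset.mem_insert.1 hi with rfl | hi
      · rw [hda, map_one]
      · exact sub_eq_zero.1 (ih _ h2 i hi)
    have hk : ∀ i, ∃ k : K, i ∈ insert a t → algebraMap K L k = d i := fun i => by
      by_cases hi : i ∈ insert a t
      · obtain ⟨k, hk⟩ := (InfiniteGalois.mem_range_algebraMap_iff_fixed (d i)).2
          fun σ => hdσ σ i hi
        exact ⟨k, fun _ => hk⟩
      · exact ⟨0, fun h => absurd h hi⟩
    choose k hk using hk
    have h3 : ∑ i ∈ insert a t, k i • s i = 0 := by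
      apply hinj
      rw [map_zero, map_sum, ← hd]
      exact Finset.sum_congr rfl fun i hi => by rw [hf, hk i hi, Function.comp_apply]
    have h4 := linearIndependent_iff'.1 hs _ _ h3 a (Finset.mem_insert_self a t)
    have h5 := hk a (Finset.mem_insert_self a t)
    rw [h4, map_zero, hda] at h5
    exact zero_ne_one h5

end IsSemilinearAction

/-- Galois descent for algebras with a continuous semilinear action. -/
theorem bijective_productMap_of_fixed [IsGalois K L] {S B : Type*} [CommRing S] [CommRing B]
    [Algebra K S] [Algebra K B] (g : L →ₐ[K] B) (f : S →ₐ[K] B) (hinj : Function.Injective f)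
    (ψ : Gal(L/K) → B →+* B) (hone : ∀ b, ψ 1 b = b)
    (hmul : ∀ σ τ b, ψ (σ * τ) b = ψ σ (ψ τ b)) (hg : ∀ σ c, ψ σ (g c) = g (σ c))
    (hrange : ∀ b, b ∈ Set.range f ↔ ∀ σ, ψ σ b = b)
    (hcont : ∀ b, ∀ᶠ σ in 𝓝 (1 : Gal(L/K)), ψ σ b = b) :
    Function.Bijective (Algebra.TensorProduct.productMap g f) := by
  algebraize [g.toRingHom]
  have hsmul : ∀ (c : L) (b : B), c • b = g c * b := fun c b => Algebra.smul_def c b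
  have hψ : IsSemilinearAction (M := B) (fun σ => (ψ σ : B →+ B)) :=
    ⟨hone, hmul, fun σ c m => by simp [hsmul, hg]⟩
  let F : L ⊗[K] S →ₗ[L] B :=
    { (Algebra.TensorProduct.productMap g f).toLinearMap with
      map_smul' := fun c x => by
        induction x with
        | zero => simp
        | add x y hx hy => simpa [mul_add] using congrArg₂ (· + ·) hx hy
        | tmul a s => simp [TensorProduct.smul_tmul', hsmul, mul_assoc] }
  change Function.Bijective F
  -- A K-basis of S stays independent over L, which gives injectivity; the invariant vectors span B,
  -- which gives surjectivity.
  constructor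
  · let b := Module.Basis.ofVectorSpace K S
    let b' := Algebra.TensorProduct.basis L b
    have hli := hψ.linearIndependent (f : S →+ B)
      (fun a s => by
        rw [Algebra.smul_def, hsmul]
        simp) hinj
      (fun s => (hrange (f s)).1 ⟨s, rfl⟩) b.linearIndependent
    have hF : F ∘ b' = (f : S →+ B) ∘ b := by
      ext i
      simp [F, b', Algebra.TensorProduct.basis_apply]
    rw [← hF] at hli
    rw [← LinearMap.ker_eq_bot, LinearMap.ker_eq_bot']
    intro x hx
    rw [← b'.linearCombination_repr x, Finsupp.apply_linearCombination] at hx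
    have h0 := linearIndependent_iff.1 hli _ hx
    rw [← b'.linearCombination_repr x, h0, map_zero]
  · intro x
    have hx := hψ.mem_span (hcont x)
    have hle : Submodule.span L {x | ∀ σ, ψ σ x = x} ≤ LinearMap.range F := by
      rw [Submodule.span_le]
      intro y hy
      obtain ⟨s, rfl⟩ := (hrange y).2 hy
      exact ⟨1 ⊗ₜ s, by simp [F]⟩
    exact hle hx

end GaloisDescent

/-- A map on the Galois group that is locally constant near each element has finite image. -/
theorem finite_range_of_eventually {G β : Type*} [Group G] [TopologicalSpace G]
    [IsTopologicalGroup G] [CompactSpace G] (F : G → β)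
    (hF : ∀ σ, ∀ᶠ τ in nhds (1 : G), F (σ * τ) = F σ) : IsLocallyConstant F ∧
      (Set.range F).Finite := by
  have : IsLocallyConstant F := by
    rw [IsLocallyConstant.iff_eventually_eq]
    intro σ
    have h : Filter.Tendsto (fun x => σ⁻¹ * x) (nhds σ) (nhds 1) := by
      have : Continuous fun x => σ⁻¹ * x := continuous_const_mul _
      simpa using this.tendsto σ
    filter_upwards [h.eventually (hF σ)] with x hx
    simpa using hx
  exact ⟨this, this.range_finite⟩

/-- The invariants of a finitely generated algebra under an action with finite orbits are a
finitely generated algebra. -/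
theorem finiteType_of_isIntegral {k S R : Type*} [CommRing k] [IsNoetherianRing k] [CommRing S]
    [CommRing R] (a : k →+* S) (b : S →+* R) (hb : b.IsIntegral) (hinj : Function.Injective b)
    (hab : (b.comp a).FiniteType) : a.FiniteType := by
  have hfin : b.Finite := RingHom.IsIntegral.to_finite hb
    (RingHom.FiniteType.of_comp_finiteType hab)
  algebraize [a, b, b.comp a]
  -- Artin–Tate: R is a finite module over S and a finitely generated algebra over the Noetherian
  -- ring k.
  exact ⟨fg_of_fg_of_fg k S R Algebra.FiniteType.out Module.Finite.fg_top hinj⟩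

/-! ### Sections, gluing and factorization through a quotient map -/

section SchemeLemmas

theorem appLE_appLE_apply {X Y Z : Scheme.{u}} (f : X ⟶ Y) (g : Y ⟶ Z) {U : Z.Opens} {V : Y.Opens}
    {W : X.Opens} (e₁ : V ≤ g ⁻¹ᵁ U) (e₂ : W ≤ f ⁻¹ᵁ V) (s : Γ(Z, U)) :
    f.appLE V W e₂ (g.appLE U V e₁ s) =
      (f ≫ g).appLE U W (e₂.trans (by
        rw [Scheme.Hom.comp_preimage]; exact fun x hx => e₁ hx)) s := by
  rw [← CommRingCat.comp_apply, Scheme.Hom.appLE_comp_appLE]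

theorem appLE_congr_hom {X Y : Scheme.{u}} {f g : X ⟶ Y} (h : f = g) {U : Y.Opens} {V : X.Opens}
    (e : V ≤ f ⁻¹ᵁ U) (e' : V ≤ g ⁻¹ᵁ U) (s : Γ(Y, U)) : f.appLE U V e s = g.appLE U V e' s := by
  subst h; rfl

theorem appLE_map_apply {X Y : Scheme.{u}} (f : X ⟶ Y) {U : Y.Opens} {V V' : X.Opens}
    (e : V ≤ f ⁻¹ᵁ U) (h : V' ≤ V) (s : Γ(Y, U)) :
    X.presheaf.map (homOfLE h).op (f.appLE U V e s) = f.appLE U V' (h.trans e) s := by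
  rw [← CommRingCat.comp_apply, Scheme.Hom.appLE_map]

theorem map_appLE_apply {X Y : Scheme.{u}} (f : X ⟶ Y) {U U' : Y.Opens} {V : X.Opens}
    (e : V ≤ f ⁻¹ᵁ U) (h : U ≤ U') (s : Γ(Y, U')) :
    f.appLE U V e (Y.presheaf.map (homOfLE h).op s) =
      f.appLE U' V (e.trans fun _ hx => h hx) s := by
  rw [← CommRingCat.comp_apply, Scheme.Hom.map_appLE]

theorem id_appLE_apply {X : Scheme.{u}} {U V : X.Opens} (e : V ≤ (𝟙 X) ⁻¹ᵁ U) (s : Γ(X, U)) :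
    (𝟙 X : X ⟶ X).appLE U V e s = X.presheaf.map (homOfLE e).op s := by
  rw [Scheme.Hom.appLE]; rfl

/-- The nonvanishing locus of a section that pulls back to zero has empty preimage, so it is empty,
and the section is zero because Y is reduced. -/
theorem app_injective_of_surjective {X Y : Scheme.{u}} (π : X ⟶ Y) [Surjective π] [IsReduced Y]
    (U : Y.Opens) : Function.Injective (π.app U) := by
  rw [injective_iff_map_eq_zero]
  intro s hs
  rw [← basicOpen_eq_bot_iff]
  have h : π ⁻¹ᵁ Y.basicOpen s = ⊥ := by
    rw [Scheme.preimage_basicOpen, hs, Scheme.basicOpen_zero]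
  rw [eq_bot_iff]
  intro y hy
  obtain ⟨x, rfl⟩ := π.surjective y
  have hx : x ∈ π ⁻¹ᵁ Y.basicOpen s := hy
  rw [h] at hx
  exact hx

theorem exists_ringHom_lift {A B C : Type*} [CommRing A] [CommRing B] [CommRing C] (p : B →+* C)
    (hp : Function.Injective p) (g : A →+* C) (h : ∀ a, g a ∈ Set.range p) :
    ∃ θ : A →+* B, p.comp θ = g := by
  choose θ hθ using h
  refine ⟨⟨⟨⟨θ, hp ?_⟩, fun x y => hp ?_⟩, hp ?_, fun x y => hp ?_⟩, RingHom.ext hθ⟩ <;> simp [hθ]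

/-- A section over an open subset lies in the image of `π` if it does so locally. -/
theorem mem_range_app_of_locally {X Y : Scheme.{u}} (π : X ⟶ Y)
    (hinj : ∀ U : Y.Opens, Function.Injective (π.app U)) (U : Y.Opens) (s : Γ(X, π ⁻¹ᵁ U))
    (h : ∀ y ∈ U, ∃ (D : Y.Opens) (hD : D ≤ U) (t : Γ(Y, D)), y ∈ D ∧
      π.app D t = X.presheaf.map (homOfLE (show π ⁻¹ᵁ D ≤ π ⁻¹ᵁ U from fun _ hx => hD hx)).op s) :
    s ∈ Set.range (π.app U) := by
  choose D hD t hyD ht using h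
  let 𝒟 : U → Y.Opens := fun y => D y y.2
  have hcov : U ≤ iSup 𝒟 := fun y hy => TopologicalSpace.Opens.mem_iSup.2 ⟨⟨y, hy⟩, hyD y hy⟩
  have hres : ∀ (y : U) (W : Y.Opens) (hW : W ≤ 𝒟 y),
      π.app W (Y.presheaf.map (homOfLE hW).op (t y y.2)) =
        X.presheaf.map (homOfLE (show π ⁻¹ᵁ W ≤ π ⁻¹ᵁ U from
          fun _ hx => hD y y.2 (hW hx))).op s := by
    intro y W hW
    rw [Scheme.Hom.app_eq_appLE, map_appLE_apply π le_rfl hW]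
    have := congrArg (X.presheaf.map (homOfLE (show π ⁻¹ᵁ W ≤ π ⁻¹ᵁ 𝒟 y from
      fun _ hx => hW hx)).op) (ht y y.2)
    rw [Scheme.Hom.app_eq_appLE, appLE_map_apply] at this
    rw [this, ← CommRingCat.comp_apply, ← Functor.map_comp]
    rfl
  -- The local preimages agree on overlaps because pullback of sections along π is injective.
  obtain ⟨g₀, hg₀, -⟩ := Y.sheaf.existsUnique_gluing' 𝒟 U (fun y => homOfLE (hD y y.2)) hcov
    (fun y => t y y.2) (by
      intro y z
      apply hinj
      exact (hres y _ inf_le_left).trans (hres z _ inf_le_right).symm)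
  obtain ⟨g, hg⟩ : ∃ g : Γ(Y, U), ∀ y : U, Y.presheaf.map (homOfLE (hD y y.2)).op g = t y y.2 :=
    ⟨g₀, hg₀⟩
  refine ⟨g, ?_⟩
  refine X.sheaf.eq_of_locally_eq' (fun y => π ⁻¹ᵁ 𝒟 y) (π ⁻¹ᵁ U)
    (fun y => homOfLE fun _ hx => hD y y.2 hx) (fun x hx => ?_) _ _ fun y => ?_
  · exact TopologicalSpace.Opens.mem_iSup.2 ⟨⟨π x, hx⟩, hyD (π x) hx⟩
  · have h1 := ht y y.2
    rw [← hg y, Scheme.Hom.app_eq_appLE, map_appLE_apply π le_rfl (hD y y.2)] at h1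
    refine Eq.trans ?_ h1
    have h2 := appLE_map_apply π (U := U) le_rfl
      (show π ⁻¹ᵁ D y y.2 ≤ π ⁻¹ᵁ U from fun _ hx => hD y y.2 hx) g
    rw [Scheme.Hom.app_eq_appLE]
    exact h2

/-- The universal property of a quotient map with respect to a single morphism. -/
theorem exists_desc {X Y Z : Scheme.{u}} [IsReduced Y] [Z.IsSeparated] (π : X ⟶ Y)
    (hq : Topology.IsQuotientMap π) (hinj : ∀ U : Y.Opens, Function.Injective (π.app U))
    (h : X ⟶ Z) (hfib : ∀ x y, π x = π y → h x = h y)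
    (hsec : ∀ (U : Y.Opens) (W : Z.Opens) (e : π ⁻¹ᵁ U ≤ h ⁻¹ᵁ W) (s : Γ(Z, W)),
      h.appLE W (π ⁻¹ᵁ U) e s ∈ Set.range (π.app U)) :
    ∃ k : Y ⟶ Z, π ≫ k = h := by
  let b : C(Y, Z) := hq.lift ⟨h, h.continuous⟩ hfib
  have hb : ∀ x, b (π x) = h x := fun x =>
    ContinuousMap.congr_fun (hq.lift_comp ⟨h, h.continuous⟩ hfib) x
  let U : Z.affineOpens → Y.Opens := fun W => ⟨b ⁻¹' (W.1 : Set Z), W.1.2.preimage b.continuous⟩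
  have hU : TopologicalSpace.IsOpenCover U := by
    rw [TopologicalSpace.IsOpenCover, eq_top_iff]
    intro y _
    have : b y ∈ (⊤ : Z.Opens) := trivial
    rw [← iSup_affineOpens_eq_top Z] at this
    obtain ⟨W, hW⟩ := TopologicalSpace.Opens.mem_iSup.1 this
    exact TopologicalSpace.Opens.mem_iSup.2 ⟨W, hW⟩
  have e : ∀ W, π ⁻¹ᵁ U W ≤ h ⁻¹ᵁ W.1 := by
    intro W x hx
    have : b (π x) ∈ W.1 := hx
    rwa [hb] at this
  have hθ : ∀ W : Z.affineOpens, ∃ θ : Γ(Z, W.1) ⟶ Γ(Y, U W),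
      θ ≫ π.app (U W) = h.appLE W.1 _ (e W) := fun W => by
    obtain ⟨θ, hθ⟩ := exists_ringHom_lift (π.app (U W)).hom (hinj _)
      (h.appLE W.1 _ (e W)).hom fun a => hsec _ _ _ a
    exact ⟨CommRingCat.ofHom θ, by ext x; exact RingHom.congr_fun hθ x⟩
  choose θ hθ using hθ
  let k : ∀ W : Z.affineOpens, (U W).toScheme ⟶ Z := fun W =>
    (U W).toSpecΓ ≫ Spec.map (θ W) ≫ W.2.fromSpec
  have hk : ∀ W, π ∣_ U W ≫ k W = (π ⁻¹ᵁ U W).ι ≫ h := by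
    intro W
    simp only [k]
    rw [← Scheme.Opens.toSpecΓ_naturality_assoc, ← Spec.map_comp_assoc, hθ,
      Scheme.Opens.toSpecΓ_SpecMap_appLE_assoc, W.2.toSpecΓ_fromSpec, Scheme.Hom.resLE_comp_ι]
  have hsurj : Surjective π := ⟨hq.surjective⟩
  let 𝒰 := Y.openCoverOfIsOpenCover U hU
  have hglue : ∀ W W', pullback.fst (𝒰.f W) (𝒰.f W') ≫ k W = pullback.snd _ _ ≫ k W' := by
    intro W W'
    change pullback.fst (U W).ι (U W').ι ≫ k W = pullback.snd (U W).ι (U W').ι ≫ k W'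
    have hred : IsReduced (pullback (U W).ι (U W').ι) :=
      isReduced_of_isOpenImmersion (pullback.fst (U W).ι (U W').ι)
    let j := pullback.fst (U W).ι (U W').ι ≫ (U W).ι
    have hj' : j = pullback.snd (U W).ι (U W').ι ≫ (U W').ι := pullback.condition
    -- The overlap is reduced, Z is separated, and the base change of π to the overlap is
    -- surjective, so the local maps may be compared upstairs, where both are induced by h.
    refine ext_of_isDominant (ι := pullback.snd π j) ?_
    have key : ∀ (V : Z.affineOpens) (p : pullback (U W).ι (U W').ι ⟶ (U V).toScheme),
        p ≫ (U V).ι = j → pullback.snd π j ≫ p ≫ k V = pullback.fst π j ≫ h := by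
      intro V p hp
      have hpb := isPullback_morphismRestrict π (U V)
      let l := hpb.lift (pullback.snd π j ≫ p) (pullback.fst π j) (by
        rw [Category.assoc, hp, pullback.condition])
      have h1 : l ≫ π ∣_ U V = pullback.snd π j ≫ p := hpb.lift_fst _ _ _
      have h2 : l ≫ (π ⁻¹ᵁ U V).ι = pullback.fst π j := hpb.lift_snd _ _ _
      rw [← Category.assoc, ← h1, Category.assoc, hk, ← Category.assoc, h2]
    rw [key W _ rfl, key W' _ hj'.symm]
  refine ⟨𝒰.glueMorphisms k hglue, ?_⟩
  refine Scheme.hom_ext_of_forall _ _ fun x => ?_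
  obtain ⟨W, hW⟩ := TopologicalSpace.Opens.mem_iSup.1
    (show π x ∈ iSup U by rw [hU.iSup_eq_top]; trivial)
  refine ⟨π ⁻¹ᵁ U W, hW, ?_⟩
  have h1 : (U W).ι ≫ 𝒰.glueMorphisms k hglue = k W := 𝒰.ι_glueMorphisms k hglue W
  rw [← hk, ← h1, morphismRestrict_ι_assoc]

end SchemeLemmas

/-! ### Geometric quotients by group actions -/

section GeometricQuotient

/-- `ρ` is an action of the group `G` on the scheme `X`. -/
structure IsAction {G : Type*} [Group G] {X : Scheme.{u}} (ρ : G → (X ⟶ X)) : Prop where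
  one : ρ 1 = 𝟙 X
  mul : ∀ g h, ρ (g * h) = ρ h ≫ ρ g

/-- The open subset `U` is stable under the action `ρ`. -/
def IsStable {G : Type*} {X : Scheme.{u}} (ρ : G → (X ⟶ X)) (U : X.Opens) : Prop :=
  ∀ g, U ≤ ρ g ⁻¹ᵁ U

/-- The action on the sections over a stable open subset. -/
noncomputable def sectionAction {G : Type*} {X : Scheme.{u}} {ρ : G → (X ⟶ X)} {U : X.Opens}
    (hU : IsStable ρ U) (g : G) : Γ(X, U) →+* Γ(X, U) :=
  ((ρ g).appLE U U (hU g)).hom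

/-- `π` is the geometric quotient of `X` for the family `ρ` of endomorphisms. -/
structure IsGeometricQuotient {G : Type*} {X Y : Scheme.{u}} (ρ : G → (X ⟶ X)) (π : X ⟶ Y) :
    Prop where
  invariant : ∀ g, ρ g ≫ π = π
  orbit : ∀ x y, π x = π y → ∃ g, ρ g x = y
  isQuotientMap : Topology.IsQuotientMap π
  injective : ∀ U : Y.Opens, Function.Injective (π.app U)
  mem_range : ∀ (U : Y.Opens) (hU : IsStable ρ (π ⁻¹ᵁ U)) (s : Γ(X, π ⁻¹ᵁ U)),
    s ∈ fixedSubring (sectionAction hU) → s ∈ Set.range (π.app U)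

theorem isStable_preimage {G : Type*} {X Y : Scheme.{u}} {ρ : G → (X ⟶ X)} {π : X ⟶ Y}
    (h : ∀ g, ρ g ≫ π = π) (U : Y.Opens) : IsStable ρ (π ⁻¹ᵁ U) := by
  intro g
  rw [← Scheme.Hom.comp_preimage, h]

theorem IsStable.inf {G : Type*} {X : Scheme.{u}} {ρ : G → (X ⟶ X)} {U V : X.Opens}
    (hU : IsStable ρ U) (hV : IsStable ρ V) : IsStable ρ (U ⊓ V) :=
  fun g _ hx => ⟨hU g hx.1, hV g hx.2⟩

variable {G : Type*} {X Y : Scheme.{u}} {ρ : G → (X ⟶ X)}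

theorem sectionAction_restrict {U V : X.Opens} (hU : IsStable ρ U) (hV : IsStable ρ V)
    (h : V ≤ U) (g : G) (s : Γ(X, U)) :
    sectionAction hV g (X.presheaf.map (homOfLE h).op s) =
      X.presheaf.map (homOfLE h).op (sectionAction hU g s) :=
  (map_appLE_apply _ _ _ _).trans (appLE_map_apply _ _ _ _).symm

theorem app_mem_fixedSubring {π : X ⟶ Y} (h : ∀ g, ρ g ≫ π = π) (U : Y.Opens) (s : Γ(Y, U)) :
    π.app U s ∈ fixedSubring (sectionAction (isStable_preimage h U)) := by
  intro g
  rw [Scheme.Hom.app_eq_appLE]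
  exact (appLE_appLE_apply _ _ _ _ _).trans (appLE_congr_hom (h g) _ _ _)

theorem IsGeometricQuotient.exists_desc {π : X ⟶ Y} (hπ : IsGeometricQuotient ρ π)
    {Z : Scheme.{u}} [IsReduced Y] [Z.IsSeparated] (h : X ⟶ Z) (hinv : ∀ g, ρ g ≫ h = h) :
    ∃ k : Y ⟶ Z, π ≫ k = h := by
  refine FieldOfModuli.exists_desc π hπ.isQuotientMap hπ.injective h ?_ ?_
  · intro x y hxy
    obtain ⟨g, rfl⟩ := hπ.orbit x y hxy
    rw [← Scheme.Hom.comp_apply, hinv]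
  · intro U W e s
    refine hπ.mem_range U (isStable_preimage hπ.invariant U) _ fun g => ?_
    exact (appLE_appLE_apply _ _ _ _ _).trans (appLE_congr_hom (hinv g) _ _ _)

variable [Group G]

theorem IsAction.sectionAction (hρ : IsAction ρ) {U : X.Opens} (hU : IsStable ρ U) :
    IsRightAction (sectionAction hU) where
  one := by
    ext s
    refine (appLE_congr_hom hρ.one _ le_rfl s).trans ?_
    rw [id_appLE_apply]
    exact ConcreteCategory.congr_hom (X.presheaf.map_id _) s
  mul g h := by
    ext s
    refine (appLE_congr_hom (hρ.mul g h) _ ((hU h).trans fun _ hx => hU g hx) s).trans ?_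
    exact (appLE_appLE_apply _ _ _ _ _).symm

theorem mem_primeIdealOf_iff {U : X.Opens} (hU : IsAffineOpen U) {x : X} (hx : x ∈ U)
    (s : Γ(X, U)) : s ∈ (hU.primeIdealOf ⟨x, hx⟩).asIdeal ↔ x ∉ X.basicOpen s := by
  have h : hU.fromSpec (hU.primeIdealOf ⟨x, hx⟩) ∈ X.basicOpen s ↔
      s ∉ (hU.primeIdealOf ⟨x, hx⟩).asIdeal :=
    SetLike.ext_iff.1 (hU.fromSpec_preimage_basicOpen s) (hU.primeIdealOf ⟨x, hx⟩)
  rw [hU.fromSpec_primeIdealOf] at h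
  rw [h, not_not]

theorem eq_of_forall_mem_basicOpen_iff {U : X.Opens} (hU : IsAffineOpen U) {x y : X} (hx : x ∈ U)
    (hy : y ∈ U) (h : ∀ s : Γ(X, U), x ∈ X.basicOpen s ↔ y ∈ X.basicOpen s) : x = y := by
  have : hU.primeIdealOf ⟨x, hx⟩ = hU.primeIdealOf ⟨y, hy⟩ := by
    ext s
    rw [mem_primeIdealOf_iff, mem_primeIdealOf_iff, h]
  calc x = hU.fromSpec (hU.primeIdealOf ⟨x, hx⟩) := (hU.fromSpec_primeIdealOf ⟨x, hx⟩).symm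
    _ = hU.fromSpec (hU.primeIdealOf ⟨y, hy⟩) := by rw [this]
    _ = y := hU.fromSpec_primeIdealOf ⟨y, hy⟩

/-- Points of a stable affine open subset that are not separated by invariant functions are
conjugate. -/
theorem IsAction.exists_apply_eq (hρ : IsAction ρ) {U : X.Opens} (hU : IsAffineOpen U)
    (hstab : IsStable ρ U) [IsNoetherianRing Γ(X, U)]
    (hfin : ∀ s : Γ(X, U), (Set.range fun g => FieldOfModuli.sectionAction hstab g s).Finite)
    {x y : X} (hx : x ∈ U) (hy : y ∈ U)
    (h : ∀ s ∈ fixedSubring (FieldOfModuli.sectionAction hstab),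
      x ∈ X.basicOpen s ↔ y ∈ X.basicOpen s) : ∃ g, ρ g x = y := by
  obtain ⟨g, hg⟩ := (hρ.sectionAction hstab).exists_eq_comap hfin
    (hU.primeIdealOf ⟨y, hy⟩).asIdeal (hU.primeIdealOf ⟨x, hx⟩).asIdeal (fun s hs => by
      rw [mem_primeIdealOf_iff, mem_primeIdealOf_iff, h s hs])
  refine ⟨g, eq_of_forall_mem_basicOpen_iff hU (hstab g hx) hy fun s => ?_⟩
  have h1 := SetLike.ext_iff.1 hg s
  rw [mem_primeIdealOf_iff, Ideal.mem_comap, mem_primeIdealOf_iff, not_iff_not] at h1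
  rw [h1]
  change _ ↔ x ∈ X.basicOpen ((ρ g).appLE U U (hstab g) s)
  rw [Scheme.basicOpen_appLE]
  exact ⟨fun h => ⟨hx, h⟩, fun h => h.2⟩

/-- Being a geometric quotient can be checked on an affine cover of the target. -/
theorem IsAction.isGeometricQuotient (hρ : IsAction ρ) [IsIntegral X] [IsReduced Y] (π : X ⟶ Y)
    [IsIntegralHom π] [Surjective π] (hinv : ∀ g, ρ g ≫ π = π)
    (hloc : ∀ y : Y, ∃ O : Y.Opens, y ∈ O ∧ IsAffineOpen O ∧ IsNoetherianRing Γ(X, π ⁻¹ᵁ O) ∧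
      (∀ s : Γ(X, π ⁻¹ᵁ O),
        (Set.range fun g => FieldOfModuli.sectionAction (isStable_preimage hinv O) g s).Finite) ∧
      ∀ s ∈ fixedSubring (FieldOfModuli.sectionAction (isStable_preimage hinv O)),
        s ∈ Set.range (π.app O)) :
    IsGeometricQuotient ρ π where
  invariant := hinv
  orbit x y hxy := by
    obtain ⟨O, hxO, hO, _, hfin, hrange⟩ := hloc (π x)
    refine hρ.exists_apply_eq (hO.preimage π) _ hfin hxO (by rwa [hxy] at hxO) fun s hs => ?_
    obtain ⟨t, rfl⟩ := hrange s hs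
    rw [← Scheme.preimage_basicOpen, Scheme.Hom.mem_preimage, hxy, Scheme.Hom.mem_preimage]
  isQuotientMap := π.isClosedMap.isQuotientMap π.continuous π.surjective
  injective := app_injective_of_surjective π
  mem_range U hU s hs := by
    refine mem_range_app_of_locally π (app_injective_of_surjective π) U s fun y hyU => ?_
    obtain ⟨O, hyO, hO, -, -, hrange⟩ := hloc y
    obtain ⟨b, hb, hyb⟩ := hO.exists_basicOpen_le ⟨y, hyU⟩ hyO
    refine ⟨Y.basicOpen b, hb, ?_⟩
    have hD := isStable_preimage hinv (Y.basicOpen b)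
    have hle : π ⁻¹ᵁ Y.basicOpen b ≤ π ⁻¹ᵁ O := fun x hx => Y.basicOpen_le b hx
    have hle' : π ⁻¹ᵁ Y.basicOpen b ≤ π ⁻¹ᵁ U := fun x hx => hb hx
    set s' : Γ(X, π ⁻¹ᵁ Y.basicOpen b) := X.presheaf.map (homOfLE hle').op s with hs'
    have hne : Nonempty (π ⁻¹ᵁ Y.basicOpen b) := by
      obtain ⟨x, rfl⟩ := π.surjective y
      exact ⟨⟨x, hyb⟩⟩
    have hs'inv : s' ∈ fixedSubring (FieldOfModuli.sectionAction hD) := fun g => by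
      rw [hs', sectionAction_restrict hU, hs g]
    -- Clear the denominator: s' times a power of the invariant function b extends to a section r
    -- over the whole chart. As X is integral, r is invariant because its restriction is, so r
    -- descends; then divide by the power of b, which is invertible on the basic open set of b.
    have hloc' : ∃ (n : ℕ) (r : Γ(X, π ⁻¹ᵁ O)),
        X.presheaf.map (homOfLE hle).op r =
          s' * X.presheaf.map (homOfLE hle).op (π.app O b) ^ n := by
      have hbo := Scheme.preimage_basicOpen π b
      have hsurj := (hO.preimage π).isLocalization_basicOpen (π.app O b)
      have e : X.basicOpen (π.app O b) ≤ π ⁻¹ᵁ Y.basicOpen b := hbo.ge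
      obtain ⟨⟨r, m, ⟨n, hn⟩⟩, hr⟩ := IsLocalization.surj (Submonoid.powers (π.app O b))
        (X.presheaf.map (homOfLE e).op s')
      refine ⟨n, r, ?_⟩
      have hinj : Function.Injective (X.presheaf.map (homOfLE e).op) := by
        have := (X.presheaf.mapIso (eqToIso hbo).op)
        have : Nonempty (X.basicOpen (π.app O b)) := by rwa [← hbo]
        exact map_injective_of_isIntegral X (homOfLE e)
      apply hinj
      have hmap : ∀ z : Γ(X, π ⁻¹ᵁ O), X.presheaf.map (homOfLE e).op
          (X.presheaf.map (homOfLE hle).op z) =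
          algebraMap Γ(X, π ⁻¹ᵁ O) Γ(X, X.basicOpen (π.app O b)) z := fun z => by
        rw [← CommRingCat.comp_apply, ← Functor.map_comp]
        rfl
      subst hn
      rw [map_mul, map_pow, hmap, hmap]
      refine hr.symm.trans ?_
      rw [map_pow]
    obtain ⟨n, r, hr⟩ := hloc'
    have hrinv : r ∈ fixedSubring (FieldOfModuli.sectionAction (isStable_preimage hinv O)) := by
      intro g
      have hinj : Function.Injective (X.presheaf.map (homOfLE hle).op) :=
        map_injective_of_isIntegral X (homOfLE hle)
      apply hinj
      rw [← sectionAction_restrict (isStable_preimage hinv O) hD hle, hr, map_mul, map_pow,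
        hs'inv g, sectionAction_restrict (isStable_preimage hinv O) hD hle,
        app_mem_fixedSubring hinv O b g]
    obtain ⟨t, rfl⟩ := hrange r hrinv
    have hu : IsUnit (Y.presheaf.map (homOfLE (Y.basicOpen_le b)).op b) :=
      RingedSpace.isUnit_res_basicOpen _ b
    obtain ⟨c, hc⟩ := hu
    have hcomm : ∀ z : Γ(Y, O), X.presheaf.map (homOfLE hle).op (π.app O z) =
        π.app (Y.basicOpen b) (Y.presheaf.map (homOfLE (Y.basicOpen_le b)).op z) := fun z => by
      rw [Scheme.Hom.app_eq_appLE, Scheme.Hom.app_eq_appLE, map_appLE_apply π]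
      exact appLE_map_apply π _ _ _
    refine ⟨Y.presheaf.map (homOfLE (Y.basicOpen_le b)).op t * ((c⁻¹ : Units _) : Γ(Y, _)) ^ n,
      hyb, ?_⟩
    rw [hcomm, hcomm] at hr
    rw [map_mul, hr, mul_assoc, ← map_pow, ← map_mul, ← mul_pow, ← hc, Units.mul_inv, one_pow,
      map_one, mul_one]

end GeometricQuotient

/-! ### Quotients of stable open subsets -/

section OpenImmersions

variable {G : Type*} {X X' Y Y' : Scheme.{u}} {ρ : G → (X ⟶ X)} {ρ' : G → (X' ⟶ X')}

/-- An equivariant open immersion induces an open immersion of geometric quotients. -/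
theorem IsGeometricQuotient.isOpenImmersion {p : X ⟶ Y} {p' : X' ⟶ Y'}
    (hp : IsGeometricQuotient ρ p) (hp' : IsGeometricQuotient ρ' p') (j : X ⟶ X')
    [IsOpenImmersion j] (hj : ∀ g, ρ g ≫ j = j ≫ ρ' g) (k : Y ⟶ Y') (hk : p ≫ k = j ≫ p') :
    IsOpenImmersion k := by
  have hkp : ∀ x, k (p x) = p' (j x) := fun x => by
    rw [← Scheme.Hom.comp_apply, hk, Scheme.Hom.comp_apply]
  have hjρ : ∀ g x, j (ρ g x) = ρ' g (j x) := fun g x => by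
    rw [← Scheme.Hom.comp_apply, hj, Scheme.Hom.comp_apply]
  have hpρ : ∀ g x, p (ρ g x) = p x := fun g x => by
    rw [← Scheme.Hom.comp_apply, hp.invariant]
  have hinj : Function.Injective k := by
    intro y y' h
    obtain ⟨x, rfl⟩ := hp.isQuotientMap.surjective y
    obtain ⟨x', rfl⟩ := hp.isQuotientMap.surjective y'
    rw [hkp, hkp] at h
    obtain ⟨g, hg⟩ := hp'.orbit _ _ h
    rw [← hjρ] at hg
    rw [← j.isOpenEmbedding.injective hg, hpρ]
  -- The fibres of p' are orbits and j is equivariant, so the preimage of an image under k is the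
  -- j-image of a preimage under p. Together with the quotient topology on Y' this makes k open.
  have hpre : ∀ W : Set Y, p' ⁻¹' (k '' W) = j '' (p ⁻¹' W) := by
    intro W
    ext x'
    constructor
    · rintro ⟨y, hy, h⟩
      obtain ⟨x, rfl⟩ := hp.isQuotientMap.surjective y
      rw [hkp] at h
      obtain ⟨g, hg⟩ := hp'.orbit _ _ h
      refine ⟨ρ g x, ?_, by rw [hjρ, hg]⟩
      rw [Set.mem_preimage, hpρ]
      exact hy
    · rintro ⟨x, hx, rfl⟩
      exact ⟨p x, hx, hkp x⟩
  have hopen : Topology.IsOpenEmbedding k := by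
    refine .of_continuous_injective_isOpenMap k.continuous hinj fun W hW => ?_
    rw [← hp'.isQuotientMap.isOpen_preimage, hpre]
    exact j.isOpenEmbedding.isOpenMap _ (hW.preimage p.continuous)
  refine ⟨hopen, fun W => ?_⟩
  set V : Y'.Opens := hopen.functor.obj W with hV
  change IsIso (k.app V)
  have hVj : p' ⁻¹ᵁ V ≤ j.opensRange := by
    intro x' hx'
    have h1 : x' ∈ p' ⁻¹' (k '' W) := hx'
    rw [hpre] at h1
    obtain ⟨x, -, rfl⟩ := h1
    exact ⟨x, rfl⟩
  have hjiso : IsIso (j.app (p' ⁻¹ᵁ V)) := j.isIso_app _ hVj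
  have hjbij : Function.Bijective (j.app (p' ⁻¹ᵁ V)) :=
    (ConcreteCategory.isIso_iff_bijective _).1 hjiso
  have hle : j ⁻¹ᵁ p' ⁻¹ᵁ V ≤ p ⁻¹ᵁ k ⁻¹ᵁ V := by
    rw [← Scheme.Hom.comp_preimage, ← Scheme.Hom.comp_preimage, hk]
  have hcomp : ∀ t : Γ(Y', V), p.appLE (k ⁻¹ᵁ V) (j ⁻¹ᵁ p' ⁻¹ᵁ V) hle (k.app V t) =
      j.app (p' ⁻¹ᵁ V) (p'.app V t) := fun t => by
    rw [Scheme.Hom.app_eq_appLE, Scheme.Hom.app_eq_appLE, Scheme.Hom.app_eq_appLE]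
    exact (appLE_appLE_apply _ _ _ _ _).trans
      ((appLE_congr_hom hk _ _ _).trans (appLE_appLE_apply _ _ _ _ _).symm)
  have hpinj : Function.Injective (p.appLE (k ⁻¹ᵁ V) (j ⁻¹ᵁ p' ⁻¹ᵁ V) hle) := by
    have heq : p ⁻¹ᵁ k ⁻¹ᵁ V = j ⁻¹ᵁ p' ⁻¹ᵁ V := by
      rw [← Scheme.Hom.comp_preimage, ← Scheme.Hom.comp_preimage, hk]
    have h1 := hp.injective (k ⁻¹ᵁ V)
    rw [Scheme.Hom.app_eq_appLE] at h1
    exact (Scheme.Hom.appLE_congr p le_rfl rfl heq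
      (fun f => Function.Injective f)).1 h1
  rw [ConcreteCategory.isIso_iff_bijective]
  constructor
  · intro t t' h
    apply hp'.injective V
    apply hjbij.1
    rw [← hcomp, ← hcomp, h]
  · intro s
    -- A function s on the source of k is pulled back to X, transported to X' through j, and
    -- descends to Y' because it is invariant there.
    obtain ⟨r, hr⟩ := hjbij.2 (p.appLE (k ⁻¹ᵁ V) (j ⁻¹ᵁ p' ⁻¹ᵁ V) hle s)
    obtain ⟨t, rfl⟩ := hp'.mem_range V (isStable_preimage hp'.invariant V) r (by
      intro g
      apply hjbij.1
      have hstab : j ⁻¹ᵁ p' ⁻¹ᵁ V ≤ ρ g ⁻¹ᵁ j ⁻¹ᵁ p' ⁻¹ᵁ V := by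
        rw [← Scheme.Hom.comp_preimage, ← Scheme.Hom.comp_preimage, ← hk, ← Category.assoc,
          hp.invariant]
      have h1 : j.app (p' ⁻¹ᵁ V) (sectionAction (isStable_preimage hp'.invariant V) g r) =
          (ρ g).appLE _ _ hstab (j.app (p' ⁻¹ᵁ V) r) := by
        rw [Scheme.Hom.app_eq_appLE]
        exact (appLE_appLE_apply _ _ _ _ _).trans
          ((appLE_congr_hom (hj g).symm _ _ _).trans (appLE_appLE_apply _ _ _ _ _).symm)
      rw [h1, hr]
      exact (appLE_appLE_apply _ _ _ _ _).trans (appLE_congr_hom (hp.invariant g) _ _ _))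
    refine ⟨t, hpinj ?_⟩
    rw [hcomp, hr]

end OpenImmersions

/-! ### The affine case: the spectrum of the invariants -/

section Affine

variable {G : Type*} {X : Scheme.{u}} {ρ : G → (X ⟶ X)}

theorem isStable_top : IsStable ρ ⊤ := fun _ _ _ => trivial

/-- The restriction of an action to a stable open subset. -/
noncomputable def restrictAction {U : X.Opens} (hU : IsStable ρ U) (g : G) :
    U.toScheme ⟶ U.toScheme :=
  (ρ g).resLE U U (hU g)

theorem restrictAction_ι {U : X.Opens} (hU : IsStable ρ U) (g : G) :
    restrictAction hU g ≫ U.ι = U.ι ≫ ρ g :=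
  Scheme.Hom.resLE_comp_ι _ _

theorem ι_appLE_sectionAction {U : X.Opens} (hU : IsStable ρ U) (g : G) (s : Γ(X, U)) :
    U.ι.appLE U ⊤ (by simp) (sectionAction hU g s) =
      sectionAction (ρ := restrictAction hU) isStable_top g (U.ι.appLE U ⊤ (by simp) s) :=
  (appLE_appLE_apply _ _ _ _ _).trans
    ((appLE_congr_hom (restrictAction_ι hU g).symm _ _ _).trans
      (appLE_appLE_apply _ _ _ _ _).symm)

variable [Group G]

/-- The quotient of an affine scheme. -/
theorem IsAction.exists_quotient_of_isAffine (hρ : IsAction ρ) [IsIntegral X] [IsAffine X]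
    [IsNoetherianRing Γ(X, ⊤)]
    (hfin : ∀ s : Γ(X, ⊤),
      (Set.range fun g => FieldOfModuli.sectionAction (ρ := ρ) isStable_top g s).Finite) :
    ∃ (Y : Scheme.{u}) (p : X ⟶ Y), IsAffine Y ∧ IsIntegral Y ∧ IsIntegralHom p ∧
      IsGeometricQuotient ρ p := by
  let S := fixedSubring (FieldOfModuli.sectionAction (ρ := ρ) (U := ⊤) isStable_top)
  let ι : CommRingCat.of S ⟶ Γ(X, ⊤) := CommRingCat.ofHom S.subtype
  have hint : S.subtype.IsIntegral := (hρ.sectionAction isStable_top).isIntegral hfin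
  let p : X ⟶ Spec (.of S) := X.toSpecΓ ≫ Spec.map ι
  have hp : IsIntegralHom p := by
    have : IsIntegralHom (Spec.map ι) := IsIntegralHom.SpecMap_iff.2 hint
    infer_instance
  have hsurj : Surjective p := by
    have : Surjective (Spec.map ι) :=
      ⟨hint.comap_surjective Subtype.val_injective⟩
    infer_instance
  have hinv : ∀ g, ρ g ≫ p = p := fun g => by
    simp only [p]
    rw [← Category.assoc, Scheme.toSpecΓ_naturality, Category.assoc, ← Spec.map_comp]
    congr 2
    ext s
    have h1 := s.2 g
    change (ρ g).appTop s.1 = s.1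
    rw [Scheme.Hom.appTop, Scheme.Hom.app_eq_appLE]
    exact h1
  have hdom : IsIntegral (Spec (CommRingCat.of S)) := by
    have : IsDomain (CommRingCat.of S) := inferInstanceAs (IsDomain S)
    infer_instance
  refine ⟨_, p, inferInstance, hdom, hp, hρ.isGeometricQuotient p hinv fun y => ?_⟩
  refine ⟨⊤, trivial, isAffineOpen_top _, ‹_›, hfin, fun s hs => ?_⟩
  refine ⟨(Scheme.ΓSpecIso (.of S)).inv ⟨s, hs⟩, ?_⟩
  have h2 : p.app ⊤ = (Spec.map ι).appTop ≫ X.toSpecΓ.appTop := Scheme.Hom.comp_app _ _ _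
  have h3 : (Scheme.ΓSpecIso (.of S)).inv ≫ (Spec.map ι).appTop ≫ X.toSpecΓ.appTop = ι := by
    rw [← Category.assoc, ← Scheme.ΓSpecIso_inv_naturality, Category.assoc, Scheme.toSpecΓ_appTop,
      Iso.inv_hom_id, Category.comp_id]
  exact (ConcreteCategory.congr_hom h2 _).trans (ConcreteCategory.congr_hom h3 ⟨s, hs⟩)

theorem IsAction.restrict (hρ : IsAction ρ) {U : X.Opens} (hU : IsStable ρ U) :
    IsAction (restrictAction hU) where
  one := by
    rw [← cancel_mono U.ι, restrictAction_ι, hρ.one, Category.comp_id, Category.id_comp]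
  mul g h := by
    rw [← cancel_mono U.ι, restrictAction_ι, hρ.mul, Category.assoc, restrictAction_ι hU g,
      ← Category.assoc (restrictAction hU h), restrictAction_ι, Category.assoc]

theorem ι_appLE_bijective (U : X.Opens) :
    Function.Bijective (U.ι.appLE U ⊤ (by simp)) := by
  rw [← ConcreteCategory.isIso_iff_bijective]
  have : U.ι.appLE U ⊤ (by simp) = U.topIso.inv := by
    simp only [Scheme.Hom.appLE, Scheme.Opens.topIso, Scheme.Opens.ι_app]
    exact (X.presheaf.map_comp _ _).symm
  rw [this]
  infer_instance

end Affine

/-! ### Gluing the quotients of stable affine open subsets -/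

section Gluing

variable {G : Type*} {X : Scheme.{u}} {ρ : G → (X ⟶ X)}

variable (ρ) in
/-- The nonempty affine open subsets that are stable under an action. -/
abbrev StableAffine : Type u :=
  {U : X.Opens // IsStable ρ U ∧ IsAffineOpen U ∧ Nonempty U}

variable (ρ) in
/-- A choice of geometric quotients of the stable affine open subsets. -/
structure QuotientAtlas where
  obj : StableAffine ρ → Scheme.{u}
  proj : ∀ i, i.1.toScheme ⟶ obj i
  isAffine : ∀ i, IsAffine (obj i)
  isIntegral : ∀ i, IsIntegral (obj i)
  isIntegralHom : ∀ i, IsIntegralHom (proj i)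
  isGeometricQuotient : ∀ i, IsGeometricQuotient (restrictAction i.2.1) (proj i)

namespace QuotientAtlas

attribute [instance] isAffine isIntegral isIntegralHom

variable (𝒜 : QuotientAtlas ρ)

instance (i : StableAffine ρ) : Surjective (𝒜.proj i) :=
  ⟨(𝒜.isGeometricQuotient i).isQuotientMap.surjective⟩

theorem proj_cancel {i : StableAffine ρ} {Z : Scheme.{u}} [Z.IsSeparated] {f g : 𝒜.obj i ⟶ Z}
    (h : 𝒜.proj i ≫ f = 𝒜.proj i ≫ g) : f = g :=
  ext_of_isDominant (ι := 𝒜.proj i) h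

theorem restrictAction_homOfLE {U V : X.Opens} (hU : IsStable ρ U) (hV : IsStable ρ V)
    (h : U ≤ V) (g : G) :
    restrictAction hU g ≫ X.homOfLE h = X.homOfLE h ≫ restrictAction hV g := by
  rw [← cancel_mono V.ι, Category.assoc, Scheme.homOfLE_ι, restrictAction_ι, Category.assoc,
    restrictAction_ι, Scheme.homOfLE_ι_assoc]

theorem exists_trans {i j : StableAffine ρ} (h : i ≤ j) :
    ∃ k : 𝒜.obj i ⟶ 𝒜.obj j, 𝒜.proj i ≫ k = X.homOfLE h ≫ 𝒜.proj j := by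
  refine (𝒜.isGeometricQuotient i).exists_desc _ fun g => ?_
  rw [← Category.assoc, restrictAction_homOfLE i.2.1 j.2.1, Category.assoc,
    (𝒜.isGeometricQuotient j).invariant]

/-- The transition maps between the charts. -/
noncomputable def trans {i j : StableAffine ρ} (h : i ≤ j) : 𝒜.obj i ⟶ 𝒜.obj j :=
  (𝒜.exists_trans h).choose

theorem proj_trans {i j : StableAffine ρ} (h : i ≤ j) :
    𝒜.proj i ≫ 𝒜.trans h = X.homOfLE h ≫ 𝒜.proj j :=
  (𝒜.exists_trans h).choose_spec

/-- The diagram of charts. -/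
noncomputable def functor : StableAffine ρ ⥤ Scheme.{u} where
  obj := 𝒜.obj
  map h := 𝒜.trans h.le
  map_id i := 𝒜.proj_cancel (by
    rw [proj_trans, Category.comp_id, Scheme.homOfLE_rfl, Category.id_comp])
  map_comp {i j k} h h' := 𝒜.proj_cancel (by
    rw [proj_trans, ← Category.assoc, proj_trans, Category.assoc, proj_trans,
      Scheme.homOfLE_homOfLE_assoc])

instance {i j : StableAffine ρ} (h : i ⟶ j) : IsOpenImmersion (𝒜.functor.map h) :=
  (𝒜.isGeometricQuotient i).isOpenImmersion (𝒜.isGeometricQuotient j) (X.homOfLE h.le)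
    (restrictAction_homOfLE i.2.1 j.2.1 h.le) _ (𝒜.proj_trans h.le)

theorem restrictAction_apply {U : X.Opens} (hU : IsStable ρ U) (g : G) (x : U.toScheme) :
    (restrictAction hU g x).1 = ρ g x.1 :=
  Scheme.Hom.coe_resLE_apply _ _ x

theorem trans_proj_apply {i j : StableAffine ρ} (h : i ≤ j) (x : i.1.toScheme) :
    𝒜.trans h (𝒜.proj i x) = 𝒜.proj j ⟨x.1, h x.2⟩ := by
  rw [← Scheme.Hom.comp_apply, proj_trans, Scheme.Hom.comp_apply]
  congr 1
  exact Subtype.ext (Scheme.homOfLE_apply h x)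

theorem exists_of_proj_eq {i : StableAffine ρ} {x y : i.1.toScheme}
    (h : 𝒜.proj i x = 𝒜.proj i y) : ∃ g, ρ g x.1 = y.1 := by
  obtain ⟨g, rfl⟩ := (𝒜.isGeometricQuotient i).orbit x y h
  exact ⟨g, (restrictAction_apply _ _ _).symm⟩

theorem proj_apply_of_eq {i : StableAffine ρ} {x y : i.1.toScheme} {g : G} (h : ρ g x.1 = y.1) :
    𝒜.proj i x = 𝒜.proj i y := by
  have : restrictAction i.2.1 g x = y := Subtype.ext ((restrictAction_apply _ _ _).trans h)
  rw [← this, ← Scheme.Hom.comp_apply, (𝒜.isGeometricQuotient i).invariant]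

section

variable [X.IsSeparated] [IsIntegral X]

/-- The intersection of two stable affine open subsets. -/
def inf (i j : StableAffine ρ) : StableAffine ρ :=
  ⟨i.1 ⊓ j.1, i.2.1.inf j.2.1, i.2.2.1.inf j.2.2.1, by
    obtain ⟨x, hx⟩ := nonempty_preirreducible_inter i.1.2 j.1.2
      (Set.nonempty_coe_sort.1 i.2.2.2) (Set.nonempty_coe_sort.1 j.2.2.2)
    exact ⟨⟨x, hx⟩⟩⟩

theorem inf_le_fst (i j : StableAffine ρ) : inf i j ≤ i := fun _ h => h.1

theorem inf_le_snd (i j : StableAffine ρ) : inf i j ≤ j := fun _ h => h.2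

/-- If points of charts i and j become equal in chart k, their lifts x and y lie in one orbit.
Stability of the i-th open set puts y into the intersection, whose chart supplies the required
common point. -/
instance : (𝒜.functor ⋙ Scheme.forget).IsLocallyDirected where
  cond {i j k} fi fj xi xj h := by
    obtain ⟨x, rfl⟩ := (𝒜.proj i).surjective xi
    obtain ⟨y, rfl⟩ := (𝒜.proj j).surjective xj
    have h' : 𝒜.trans fi.le (𝒜.proj i x) = 𝒜.trans fj.le (𝒜.proj j y) := h
    rw [trans_proj_apply, trans_proj_apply] at h'
    obtain ⟨g, hg⟩ := 𝒜.exists_of_proj_eq h'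
    have hyi : y.1 ∈ i.1 := by
      have : ρ g x.1 = y.1 := hg
      rw [← this]
      exact i.2.1 g x.2
    refine ⟨inf i j, homOfLE (inf_le_fst i j), homOfLE (inf_le_snd i j),
      𝒜.proj (inf i j) ⟨y.1, hyi, y.2⟩, ?_, ?_⟩
    · refine (𝒜.trans_proj_apply (inf_le_fst i j) _).trans ?_
      exact (𝒜.proj_apply_of_eq (i := i) hg).symm
    · exact 𝒜.trans_proj_apply (inf_le_snd i j) _

/-- The scheme glued from the charts. -/
noncomputable def glued : Scheme.{u} := colimit 𝒜.functor

/-- The inclusion of a chart. -/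
noncomputable def chart (i : StableAffine ρ) : 𝒜.obj i ⟶ 𝒜.glued := colimit.ι 𝒜.functor i

instance (i : StableAffine ρ) : IsOpenImmersion (𝒜.chart i) :=
  inferInstanceAs (IsOpenImmersion (colimit.ι 𝒜.functor i))

theorem trans_chart {i j : StableAffine ρ} (h : i ≤ j) : 𝒜.trans h ≫ 𝒜.chart j = 𝒜.chart i :=
  colimit.w 𝒜.functor (homOfLE h)

theorem exists_chart_eq (y : 𝒜.glued) : ∃ i z, 𝒜.chart i z = y :=
  Scheme.IsLocallyDirected.ι_jointly_surjective 𝒜.functor y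

theorem chart_eq_chart {i j : StableAffine ρ} {zi : 𝒜.obj i} {zj : 𝒜.obj j}
    (h : 𝒜.chart i zi = 𝒜.chart j zj) :
    ∃ (k : StableAffine ρ) (hi : k ≤ i) (hj : k ≤ j) (z : 𝒜.obj k),
      𝒜.trans hi z = zi ∧ 𝒜.trans hj z = zj := by
  obtain ⟨k, fi, fj, z, h1, h2⟩ := (Scheme.IsLocallyDirected.ι_eq_ι_iff 𝒜.functor).1 h
  exact ⟨k, fi.le, fj.le, z, h1, h2⟩

/-- The cover by the stable affine open subsets. -/
noncomputable def stableCover (hcov : ∀ x : X, ∃ i : StableAffine ρ, x ∈ i.1) : X.OpenCover where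
  I₀ := StableAffine ρ
  X i := i.1.toScheme
  f i := i.1.ι
  mem₀ := by
    rw [Scheme.presieve₀_mem_precoverage_iff]
    refine ⟨fun x => ?_, inferInstance⟩
    obtain ⟨i, hi⟩ := hcov x
    exact ⟨i, ⟨x, hi⟩, rfl⟩

variable (hcov : ∀ x : X, ∃ i : StableAffine ρ, x ∈ i.1)

/-- The projection to the glued quotient. -/
noncomputable def gluedProj : X ⟶ 𝒜.glued :=
  (stableCover hcov).glueMorphisms (fun i => 𝒜.proj i ≫ 𝒜.chart i) fun i j => by
    change pullback.fst i.1.ι j.1.ι ≫ 𝒜.proj i ≫ 𝒜.chart i =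
      pullback.snd i.1.ι j.1.ι ≫ 𝒜.proj j ≫ 𝒜.chart j
    let e := (isPullback_opens_inf i.1 j.1).isoPullback
    rw [← cancel_epi e.hom, ← Category.assoc, ← Category.assoc e.hom,
      IsPullback.isoPullback_hom_fst, IsPullback.isoPullback_hom_snd]
    have h1 := 𝒜.proj_trans (inf_le_fst i j)
    have h2 := 𝒜.proj_trans (inf_le_snd i j)
    have h3 : X.homOfLE inf_le_left ≫ 𝒜.proj i ≫ 𝒜.chart i =
        𝒜.proj (inf i j) ≫ 𝒜.chart (inf i j) := by
      rw [← 𝒜.trans_chart (inf_le_fst i j), ← Category.assoc, ← Category.assoc, h1]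
      rfl
    have h4 : X.homOfLE inf_le_right ≫ 𝒜.proj j ≫ 𝒜.chart j =
        𝒜.proj (inf i j) ≫ 𝒜.chart (inf i j) := by
      rw [← 𝒜.trans_chart (inf_le_snd i j), ← Category.assoc, ← Category.assoc, h2]
      rfl
    exact h3.trans h4.symm

theorem ι_gluedProj (i : StableAffine ρ) :
    i.1.ι ≫ 𝒜.gluedProj hcov = 𝒜.proj i ≫ 𝒜.chart i :=
  (stableCover hcov).ι_glueMorphisms _ _ i

theorem gluedProj_apply (i : StableAffine ρ) (x : i.1.toScheme) :
    𝒜.gluedProj hcov x.1 = 𝒜.chart i (𝒜.proj i x) := by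
  have := congrArg (fun f : i.1.toScheme ⟶ 𝒜.glued => f x) (𝒜.ι_gluedProj hcov i)
  exact this

/-- A point lying over chart i is conjugate to a point of the i-th open set, which is stable. This
makes the square over each chart cartesian, so that properties of the charts pass to the glued map.
-/
theorem gluedProj_preimage (i : StableAffine ρ) :
    𝒜.gluedProj hcov ⁻¹ᵁ (𝒜.chart i).opensRange = i.1 := by
  ext x
  constructor
  · rintro ⟨z, hz⟩
    obtain ⟨y, rfl⟩ := (𝒜.proj i).surjective z
    obtain ⟨j, hj⟩ := hcov x
    have h1 := 𝒜.gluedProj_apply hcov j ⟨x, hj⟩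
    obtain ⟨k, hki, hkj, w, hwi, hwj⟩ := 𝒜.chart_eq_chart (hz.trans h1)
    obtain ⟨v, rfl⟩ := (𝒜.proj k).surjective w
    rw [trans_proj_apply] at hwj
    obtain ⟨g, hg⟩ := 𝒜.exists_of_proj_eq hwj
    have : ρ g v.1 = x := hg
    rw [← this]
    exact i.2.1 g (hki v.2)
  · intro hx
    exact ⟨_, (𝒜.gluedProj_apply hcov i ⟨x, hx⟩).symm⟩

theorem isPullback_chart (i : StableAffine ρ) :
    IsPullback (𝒜.proj i) i.1.ι (𝒜.chart i) (𝒜.gluedProj hcov) :=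
  IsOpenImmersion.isPullback _ _ _ _ (𝒜.ι_gluedProj hcov i) (by
    rw [gluedProj_preimage, Scheme.Opens.opensRange_ι])

instance isIntegralHom_gluedProj : IsIntegralHom (𝒜.gluedProj hcov) := by
  have : IsZariskiLocalAtTarget @IsIntegralHom :=
    (HasAffineProperty.iff.1 IsIntegralHom.hasAffineProperty).1
  refine (IsZariskiLocalAtTarget.iff_of_openCover (P := @IsIntegralHom) (f := 𝒜.gluedProj hcov)
    (Scheme.IsLocallyDirected.openCover 𝒜.functor)).2 ?_
  intro i
  have h := (𝒜.isPullback_chart hcov i).flip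
  have : pullback.snd (𝒜.gluedProj hcov) (𝒜.chart i) = h.isoPullback.inv ≫ 𝒜.proj i := by
    rw [Iso.eq_inv_comp, IsPullback.isoPullback_hom_snd]
  change IsIntegralHom (pullback.snd (𝒜.gluedProj hcov) (𝒜.chart i))
  rw [this]
  have := 𝒜.isIntegralHom i
  infer_instance

instance surjective_gluedProj : Surjective (𝒜.gluedProj hcov) where
  surj y := by
    obtain ⟨i, z, rfl⟩ := 𝒜.exists_chart_eq y
    obtain ⟨x, rfl⟩ := (𝒜.proj i).surjective z
    exact ⟨x.1, 𝒜.gluedProj_apply hcov i x⟩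

instance isReduced_glued : IsReduced 𝒜.glued := by
  have (i : StableAffine ρ) : IsReduced (𝒜.obj i) := by
    have := 𝒜.isIntegral i
    exact isReduced_of_isIntegral _
  have : ∀ i, IsReduced ((Scheme.IsLocallyDirected.openCover 𝒜.functor).X i) := fun i =>
    this i
  exact IsReduced.of_openCover _ (Scheme.IsLocallyDirected.openCover 𝒜.functor)

end

end QuotientAtlas

theorem appLE_bijective_of_opensRange_eq {Y : Scheme.{u}} (j : X ⟶ Y) [IsOpenImmersion j]
    {O : Y.Opens} (h : j.opensRange = O) (e : ⊤ ≤ j ⁻¹ᵁ O) :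
    Function.Bijective (j.appLE O ⊤ e) := by
  have h1 : j ⁻¹ᵁ O = ⊤ := top_le_iff.1 e
  have : IsIso (j.app O) := j.isIso_app O h.ge
  have h2 : Function.Bijective (j.appLE O (j ⁻¹ᵁ O) le_rfl) := by
    rw [← Scheme.Hom.app_eq_appLE]
    exact (ConcreteCategory.isIso_iff_bijective _).1 this
  exact (Scheme.Hom.appLE_congr j le_rfl rfl h1 (fun f => Function.Bijective f)).1 h2

/-- A scheme covered by stable affine open subsets has a geometric quotient if the orbits of
sections are finite. -/
theorem IsAction.exists_quotient [Group G] (hρ : IsAction ρ) [IsIntegral X] [X.IsSeparated]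
    [IsLocallyNoetherian X] (hcov : ∀ x : X, ∃ U : X.Opens, x ∈ U ∧ IsStable ρ U ∧ IsAffineOpen U)
    (hfin : ∀ (U : X.Opens) (hU : IsStable ρ U), IsAffineOpen U → ∀ s : Γ(X, U),
      (Set.range fun g => FieldOfModuli.sectionAction hU g s).Finite) :
    ∃ (Y : Scheme.{u}) (π : X ⟶ Y), IsReduced Y ∧ IsIntegralHom π ∧ IsGeometricQuotient ρ π := by
  have hex : ∀ i : StableAffine ρ, ∃ (Y : Scheme.{u}) (p : i.1.toScheme ⟶ Y), IsAffine Y ∧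
      IsIntegral Y ∧ IsIntegralHom p ∧ IsGeometricQuotient (restrictAction i.2.1) p := by
    intro i
    have : Nonempty i.1 := i.2.2.2
    have : IsAffine i.1.toScheme := i.2.2.1
    have : IsLocallyNoetherian i.1.toScheme := isLocallyNoetherian_of_isOpenImmersion i.1.ι
    have : IsNoetherianRing Γ(i.1.toScheme, ⊤) :=
      IsLocallyNoetherian.component_noetherian ⟨⊤, isAffineOpen_top _⟩
    refine (hρ.restrict i.2.1).exists_quotient_of_isAffine fun s => ?_
    obtain ⟨s, rfl⟩ := (ι_appLE_bijective i.1).2 s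
    refine ((hfin i.1 i.2.1 i.2.2.1 s).image (i.1.ι.appLE i.1 ⊤ (by simp))).subset ?_
    rintro _ ⟨g, rfl⟩
    exact ⟨_, ⟨g, rfl⟩, ι_appLE_sectionAction i.2.1 g s⟩
  choose Y p h1 h2 h3 h4 using hex
  let 𝒜 : QuotientAtlas ρ := ⟨Y, p, h1, h2, h3, h4⟩
  have hcov' : ∀ x : X, ∃ i : StableAffine ρ, x ∈ i.1 := fun x => by
    obtain ⟨U, hx, hU, hU'⟩ := hcov x
    exact ⟨⟨U, hU, hU', ⟨⟨x, hx⟩⟩⟩, hx⟩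
  have hinv : ∀ g, ρ g ≫ 𝒜.gluedProj hcov' = 𝒜.gluedProj hcov' := fun g => by
    have (i : StableAffine ρ) :
        i.1.ι ≫ ρ g ≫ 𝒜.gluedProj hcov' = i.1.ι ≫ 𝒜.gluedProj hcov' := by
      rw [← Category.assoc, ← restrictAction_ι i.2.1, Category.assoc, 𝒜.ι_gluedProj hcov',
        ← Category.assoc, (𝒜.isGeometricQuotient i).invariant]
    exact (QuotientAtlas.stableCover hcov').hom_ext _ _ this
  refine ⟨𝒜.glued, 𝒜.gluedProj hcov', inferInstance, inferInstance,
    hρ.isGeometricQuotient _ hinv fun y => ?_⟩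
  obtain ⟨i, z, rfl⟩ := 𝒜.exists_chart_eq y
  have hOaff : IsAffineOpen (𝒜.chart i).opensRange :=
    have := 𝒜.isAffine i
    isAffineOpen_opensRange _
  have hpre := 𝒜.gluedProj_preimage hcov' i
  refine ⟨(𝒜.chart i).opensRange, ⟨z, rfl⟩, hOaff,
    IsLocallyNoetherian.component_noetherian ⟨_, hOaff.preimage _⟩,
    hfin _ _ (hOaff.preimage _), fun s hs => ?_⟩
  have e1 : ⊤ ≤ i.1.ι ⁻¹ᵁ 𝒜.gluedProj hcov' ⁻¹ᵁ (𝒜.chart i).opensRange := by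
    rw [hpre]
    simp
  have e2 : ⊤ ≤ 𝒜.chart i ⁻¹ᵁ (𝒜.chart i).opensRange := fun x _ => ⟨x, rfl⟩
  -- An invariant section over the preimage of the chart is a section on the i-th open set, where
  -- the affine quotient already provides a descent.
  obtain ⟨t, ht⟩ := (𝒜.isGeometricQuotient i).mem_range ⊤ isStable_top (i.1.ι.appLE _ ⊤ e1 s) (by
    intro g
    refine Eq.trans ?_ (congrArg (i.1.ι.appLE _ ⊤ e1) (hs g))
    exact (appLE_appLE_apply _ _ _ _ _).trans
      ((appLE_congr_hom (restrictAction_ι i.2.1 g) _ _ _).trans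
      (appLE_appLE_apply _ _ _ _ _).symm))
  obtain ⟨t, rfl⟩ := (appLE_bijective_of_opensRange_eq (𝒜.chart i) rfl e2).2 t
  refine ⟨t, (appLE_bijective_of_opensRange_eq i.1.ι (by simpa using hpre.symm) e1).1 ?_⟩
  rw [← ht, Scheme.Hom.app_eq_appLE, Scheme.Hom.app_eq_appLE]
  exact (appLE_appLE_apply _ _ _ _ _).trans
    ((appLE_congr_hom (𝒜.ι_gluedProj hcov' i) _ _ _).trans (appLE_appLE_apply _ _ _ _ _).symm)

end Gluing

/-! ### Constant functions and pushouts of rings -/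

section Constants

variable {k k' : Type u} [Field k] [Field k'] {X Y : Scheme.{u}}

theorem le_preimage_top (f : X ⟶ Y) (U : X.Opens) : U ≤ f ⁻¹ᵁ ⊤ := fun _ _ => trivial

/-- The constant functions on an open subset of a scheme over a field. -/
noncomputable def constants (p : X ⟶ Spec (.of k)) (U : X.Opens) : CommRingCat.of k ⟶ Γ(X, U) :=
  (Scheme.ΓSpecIso (.of k)).inv ≫ p.appLE ⊤ U (le_preimage_top p U)

theorem constants_appLE (p : X ⟶ Spec (.of k)) (p' : Y ⟶ Spec (.of k'))
    (φ : CommRingCat.of k ⟶ CommRingCat.of k') (e : Y ⟶ X)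
    (he : e ≫ p = p' ≫ Spec.map φ) {U : X.Opens} {W : Y.Opens} (h : W ≤ e ⁻¹ᵁ U) :
    constants p U ≫ e.appLE U W h = φ ≫ constants p' W := by
  have h1 : p.appLE ⊤ U (le_preimage_top p U) ≫ e.appLE U W h =
      (e ≫ p).appLE ⊤ W (le_preimage_top _ _) := Scheme.Hom.appLE_comp_appLE _ _ _ _ _ _ _
  have h2 : (Spec.map φ).appTop ≫ p'.appLE ⊤ W (le_preimage_top _ _) =
      (p' ≫ Spec.map φ).appLE ⊤ W (le_preimage_top _ _) := by
    rw [Scheme.Hom.appTop, Scheme.Hom.app_eq_appLE]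
    exact Scheme.Hom.appLE_comp_appLE _ _ _ _ _ _ _
  simp only [constants, Category.assoc]
  rw [h1, ← Category.assoc φ, Scheme.ΓSpecIso_inv_naturality, Category.assoc, h2]
  simp only [he]

theorem appLE_constants_apply (p : X ⟶ Spec (.of k)) (p' : Y ⟶ Spec (.of k'))
    (φ : k →+* k') (e : Y ⟶ X)
    (he : e ≫ p = p' ≫ Spec.map (CommRingCat.ofHom φ)) {U : X.Opens} {W : Y.Opens}
    (h : W ≤ e ⁻¹ᵁ U) (c : k) :
    e.appLE U W h (constants p U c) = constants p' W (φ c) :=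
  ConcreteCategory.congr_hom (constants_appLE p p' (CommRingCat.ofHom φ) e he h) c

theorem appLE_constants_of_comp_eq (p : X ⟶ Spec (.of k)) (p' : Y ⟶ Spec (.of k)) (e : Y ⟶ X)
    (he : e ≫ p = p') {U : X.Opens} {W : Y.Opens} (h : W ≤ e ⁻¹ᵁ U) (c : k) :
    e.appLE U W h (constants p U c) = constants p' W c :=
  appLE_constants_apply p p' (RingHom.id k) e (by
    rw [he]
    exact ((congrArg (p' ≫ ·) (Spec.map_id _)).trans (Category.comp_id p')).symm) h c

/-- Both legs factor through S, so the universal property gives a map from P to S whose composite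
with the inclusion is the identity of P. -/
theorem eq_top_of_isPushout {A B C P : CommRingCat.{u}} {f : A ⟶ B} {g : A ⟶ C} {inl : B ⟶ P}
    {inr : C ⟶ P} (h : IsPushout f g inl inr) (S : Subring P) (hl : ∀ b, inl b ∈ S)
    (hr : ∀ c, inr c ∈ S) : S = ⊤ := by
  let l : B ⟶ CommRingCat.of S := CommRingCat.ofHom (inl.hom.codRestrict S hl)
  let r : C ⟶ CommRingCat.of S := CommRingCat.ofHom (inr.hom.codRestrict S hr)
  have hlr : f ≫ l = g ≫ r := by
    ext a
    exact ConcreteCategory.congr_hom h.w a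
  have : h.desc l r hlr ≫ CommRingCat.ofHom S.subtype = 𝟙 P := by
    apply h.hom_ext
    · rw [IsPushout.inl_desc_assoc, Category.comp_id]
      rfl
    · rw [IsPushout.inr_desc_assoc, Category.comp_id]
      rfl
  refine top_le_iff.1 fun x _ => ?_
  have h1 := ConcreteCategory.congr_hom this x
  change (h.desc l r hlr x).1 = x at h1
  rw [← h1]
  exact (h.desc l r hlr x).2

end Constants

/-! ### Base change to the algebraic closure and continuity of the Galois action -/

section BaseChange

variable {K : Type u} [Field K] (Kbar : Type u) [Field Kbar] [Algebra K Kbar]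

/-- The projection `V ×_K Kbar ⟶ V`. -/
noncomputable def proj (V : Over (Spec (.of K))) : (baseChange Kbar V).left ⟶ V.left :=
  pullback.fst V.hom (specMap K Kbar)

variable {Kbar}

theorem galMap_proj (σ : Gal(Kbar/K)) (V : Over (Spec (.of K))) :
    galMap σ V ≫ proj Kbar V = proj Kbar V := galMap_fst σ V

theorem isPullback_proj (V : Over (Spec (.of K))) :
    IsPullback (proj Kbar V) (baseChange Kbar V).hom V.hom (specMap K Kbar) :=
  IsPullback.of_hasPullback _ _

theorem proj_hom (V : Over (Spec (.of K))) :
    proj Kbar V ≫ V.hom = (baseChange Kbar V).hom ≫ specMap K Kbar :=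
  (isPullback_proj V).w

theorem baseChangeMap_proj {V W : Over (Spec (.of K))} (g : V ⟶ W) :
    (baseChangeMap Kbar g).left ≫ proj Kbar W = proj Kbar V ≫ g.left :=
  pullback.lift_fst _ _ _

/-- Over an affine open subset the sections of the base change are Γ(W) ⊗ `Kbar`; in pushout form
this lets assertions be checked on Γ(W) and on constants. -/
theorem isPushout_proj (V : Over (Spec (.of K))) {W : V.left.Opens} (hW : IsAffineOpen W) :
    IsPushout (constants V.hom W) (CommRingCat.ofHom (algebraMap K Kbar))
      ((proj Kbar V).appLE W (proj Kbar V ⁻¹ᵁ W) le_rfl)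
      (constants (baseChange Kbar V).hom (proj Kbar V ⁻¹ᵁ W)) := by
  have h := (isIso_pushoutSection_iff (isPullback_proj (Kbar := Kbar) V) (US := ⊤) (UT := ⊤)
    (UX := W) (UY := proj Kbar V ⁻¹ᵁ W) le_top le_top (by simp)).1
    (isIso_pushoutSection_of_isAffineOpen _ _ _ _ (isAffineOpen_top _) (isAffineOpen_top _) hW)
  refine h.of_iso (Scheme.ΓSpecIso _) (Iso.refl _) (Scheme.ΓSpecIso _) (Iso.refl _) ?_ ?_ ?_ ?_
  · simp [constants]
  · refine Eq.trans ?_ (Scheme.ΓSpecIso_naturality _)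
    rw [Scheme.Hom.appTop, Scheme.Hom.app_eq_appLE]
    rfl
  · simp
  · simp [constants]

theorem le_galMap_preimage (V : Over (Spec (.of K))) (σ : Gal(Kbar/K)) (W : V.left.Opens) :
    proj Kbar V ⁻¹ᵁ W ≤ galMap σ V ⁻¹ᵁ proj Kbar V ⁻¹ᵁ W := by
  rw [← Scheme.Hom.comp_preimage, galMap_proj]

variable [IsAlgClosure K Kbar]

instance isIntegralHom_specMap : IsIntegralHom (specMap K Kbar) := by
  have : Algebra.IsAlgebraic K Kbar := IsAlgClosure.isAlgebraic
  exact IsIntegralHom.SpecMap_iff.2 (algebraMap_isIntegral_iff.2 inferInstance)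

instance surjective_specMap : Surjective (specMap K Kbar) := by
  refine ⟨fun x => ?_⟩
  have : Subsingleton (Spec (CommRingCat.of K)) :=
    inferInstanceAs (Subsingleton (PrimeSpectrum K))
  have : Nonempty (Spec (CommRingCat.of Kbar)) := inferInstanceAs (Nonempty (PrimeSpectrum Kbar))
  exact ⟨Classical.arbitrary _, Subsingleton.elim _ _⟩

instance isIntegralHom_proj (V : Over (Spec (.of K))) : IsIntegralHom (proj Kbar V) :=
  MorphismProperty.of_isPullback (isPullback_proj V).flip inferInstance

instance surjective_proj (V : Over (Spec (.of K))) : Surjective (proj Kbar V) :=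
  MorphismProperty.of_isPullback (P := @Surjective) (isPullback_proj V).flip inferInstance

/-- The extension K(c) is finite, so its fixing subgroup is open. -/
theorem eventually_apply_eq (c : Kbar) : ∀ᶠ σ in nhds (1 : Gal(Kbar/K)), σ c = c := by
  have : Algebra.IsAlgebraic K Kbar := IsAlgClosure.isAlgebraic
  have : FiniteDimensional K (IntermediateField.adjoin K {c}) :=
    IntermediateField.adjoin.finiteDimensional (Algebra.IsIntegral.isIntegral c)
  have h := (IntermediateField.adjoin K {c}).fixingSubgroup_isOpen
  filter_upwards [h.mem_nhds (one_mem _)] with σ hσ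
  exact hσ ⟨c, IntermediateField.mem_adjoin_simple_self K c⟩

variable (V : Over (Spec (.of K)))

/-- The sections with open stabilizer form a subring. It contains the functions from V, which are
fixed by everything, and the constants, and these generate. -/
theorem eventually_galMap_appLE_preimage {W : V.left.Opens} (hW : IsAffineOpen W)
    (s : Γ((baseChange Kbar V).left, proj Kbar V ⁻¹ᵁ W)) :
    ∀ᶠ σ in nhds (1 : Gal(Kbar/K)),
      (galMap σ V).appLE _ _ (le_galMap_preimage V σ W) s = s := by
  let S : Subring Γ((baseChange Kbar V).left, proj Kbar V ⁻¹ᵁ W) :=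
    { carrier := {s | ∀ᶠ σ in nhds (1 : Gal(Kbar/K)),
        (galMap σ V).appLE _ _ (le_galMap_preimage V σ W) s = s}
      mul_mem' := fun ha hb => by
        filter_upwards [ha, hb] with σ h1 h2
        rw [map_mul, h1, h2]
      add_mem' := fun ha hb => by
        filter_upwards [ha, hb] with σ h1 h2
        rw [map_add, h1, h2]
      neg_mem' := fun ha => by
        filter_upwards [ha] with σ h1
        rw [map_neg, h1]
      one_mem' := .of_forall fun σ => map_one _
      zero_mem' := .of_forall fun σ => map_zero _ }
  have : S = ⊤ := eq_top_of_isPushout (isPushout_proj V hW) S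
    (fun b => .of_forall fun σ => (appLE_appLE_apply _ _ _ _ _).trans
      (appLE_congr_hom (galMap_proj σ V) _ _ _))
    (fun c => by
      filter_upwards [eventually_apply_eq (K := K) c] with σ hσ
      refine (appLE_constants_apply _ _ (σ : Kbar →+* Kbar) _ (galMap_snd σ V) _ c).trans ?_
      exact congrArg _ hσ)
  have h : s ∈ S := this ▸ Subring.mem_top s
  exact h

/-- Open sets pulled back from V need not form a basis of the base change, but their basic open
subsets do. -/
theorem exists_basicOpen_mem_le (x : (baseChange Kbar V).left) {U : (baseChange Kbar V).left.Opens}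
    (hx : x ∈ U) : ∃ (W : V.left.Opens) (_ : IsAffineOpen W)
      (g : Γ((baseChange Kbar V).left, proj Kbar V ⁻¹ᵁ W)),
      x ∈ (baseChange Kbar V).left.basicOpen g ∧ (baseChange Kbar V).left.basicOpen g ≤ U := by
  obtain ⟨W, hW, hxW, -⟩ := exists_isAffineOpen_mem_and_subset
    (x := proj Kbar V x) (U := ⊤) trivial
  obtain ⟨g, hg, hxg⟩ := (hW.preimage (proj Kbar V)).exists_basicOpen_le ⟨x, hx⟩ hxW
  exact ⟨W, hW, g, hxg, hg⟩

/-- Sections over basic open subsets are fixed by a neighbourhood of `1`. -/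
theorem eventually_galMap_appLE_basicOpen {W : V.left.Opens} (hW : IsAffineOpen W)
    (g : Γ((baseChange Kbar V).left, proj Kbar V ⁻¹ᵁ W))
    (s : Γ((baseChange Kbar V).left, (baseChange Kbar V).left.basicOpen g)) :
    ∀ᶠ σ in nhds (1 : Gal(Kbar/K)), ∃ h, (galMap σ V).appLE _ _ h s = s := by
  have hU : IsAffineOpen (proj Kbar V ⁻¹ᵁ W) := hW.preimage _
  have hloc := hU.isLocalization_basicOpen g
  -- Write s as a fraction with numerator r and denominator a power of g; once σ fixes r and g it
  -- preserves the basic open set and fixes s.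
  obtain ⟨⟨r, m, ⟨n, hn⟩⟩, hr⟩ := IsLocalization.surj (Submonoid.powers g) s
  filter_upwards [eventually_galMap_appLE_preimage V hW g,
    eventually_galMap_appLE_preimage V hW r] with σ hg hr'
  have hD : (baseChange Kbar V).left.basicOpen g ≤
      galMap σ V ⁻¹ᵁ (baseChange Kbar V).left.basicOpen g := by
    have h1 := Scheme.basicOpen_appLE (galMap σ V) _ _ (le_galMap_preimage V σ W) g
    rw [hg] at h1
    exact h1.le.trans fun _ hx => hx.2
  refine ⟨hD, ?_⟩
  have hres : ∀ z, (galMap σ V).appLE _ _ hD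
      (algebraMap _ Γ((baseChange Kbar V).left, (baseChange Kbar V).left.basicOpen g) z) =
      algebraMap _ Γ((baseChange Kbar V).left, (baseChange Kbar V).left.basicOpen g)
        ((galMap σ V).appLE _ _ (le_galMap_preimage V σ W) z) := fun z =>
    (map_appLE_apply _ _ _ _).trans (appLE_map_apply _ _ _ _).symm
  have hu : IsUnit (algebraMap Γ((baseChange Kbar V).left, proj Kbar V ⁻¹ᵁ W)
      Γ((baseChange Kbar V).left, (baseChange Kbar V).left.basicOpen g) m) :=
    IsLocalization.map_units (M := Submonoid.powers g) _ ⟨m, ⟨n, hn⟩⟩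
  subst hn
  apply hu.mul_right_cancel
  have h2 := congrArg ((galMap σ V).appLE _ _ hD) hr
  rw [map_mul, hres, hres, hr', map_pow, hg] at h2
  exact h2.trans hr.symm

variable [IsIntegral (baseChange Kbar V).left]

/-- On an integral scheme a section is determined by its restriction to a small nonempty basic open
set, where it is a fraction of sections with open stabilizers. -/
theorem eventually_galMap_appLE {U : (baseChange Kbar V).left.Opens} (hU : Nonempty U)
    (s : Γ((baseChange Kbar V).left, U)) :
    ∀ᶠ σ in nhds (1 : Gal(Kbar/K)), ∀ h, (galMap σ V).appLE U U h s = s := by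
  obtain ⟨x, hx⟩ := hU
  obtain ⟨W, hW, g, hxg, hg⟩ := exists_basicOpen_mem_le V x hx
  filter_upwards [eventually_galMap_appLE_basicOpen V hW g
    ((baseChange Kbar V).left.presheaf.map (homOfLE hg).op s)] with σ ⟨hD, hσ⟩ h
  have : Nonempty ((baseChange Kbar V).left.basicOpen g) := ⟨⟨x, hxg⟩⟩
  apply map_injective_of_isIntegral (baseChange Kbar V).left (homOfLE hg)
  refine Eq.trans ?_ hσ
  exact (appLE_map_apply _ _ _ _).trans (map_appLE_apply _ _ _ _).symm

theorem ι_comp_eq_of_appLE_eq {X Y : Scheme.{u}} {f g : X ⟶ Y} {O : Y.Opens} (hO : IsAffineOpen O)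
    {D : X.Opens} (hf : D ≤ f ⁻¹ᵁ O) (hg : D ≤ g ⁻¹ᵁ O)
    (h : ∀ t, f.appLE O D hf t = g.appLE O D hg t) : D.ι ≫ f = D.ι ≫ g := by
  rw [← Scheme.Hom.resLE_comp_ι f hf, ← Scheme.Hom.resLE_comp_ι g hg]
  congr 1
  have : IsAffine O.toScheme := hO
  apply ext_of_isAffine
  rw [Scheme.Hom.appTop, Scheme.Hom.appTop, Scheme.Hom.resLE_app_top, Scheme.Hom.resLE_app_top]
  congr 2
  ext t
  exact h t

/-- Morphisms to schemes of finite type are fixed by a neighbourhood of `1`. -/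
theorem eventually_galMap_comp {Y : Scheme.{u}} [Y.IsSeparated] (p : Y ⟶ Spec (.of K))
    [LocallyOfFiniteType p] (h : (baseChange Kbar V).left ⟶ Y)
    (hp : h ≫ p = (baseChange Kbar V).hom ≫ specMap K Kbar) :
    ∀ᶠ σ in nhds (1 : Gal(Kbar/K)), galMap σ V ≫ h = h := by
  obtain ⟨x⟩ : Nonempty (baseChange Kbar V).left := inferInstance
  obtain ⟨O, hO, hxO, -⟩ := exists_isAffineOpen_mem_and_subset (x := h x) (U := ⊤) trivial
  obtain ⟨W, hW, g, hxg, hg⟩ := exists_basicOpen_mem_le V x (U := h ⁻¹ᵁ O) hxO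
  set D := (baseChange Kbar V).left.basicOpen g with hD
  have hft : (constants p O).hom.FiniteType := by
    have h1 := p.finiteType_appLE (isAffineOpen_top _) hO (fun _ _ => trivial)
    exact h1.comp (RingHom.FiniteType.of_surjective _
      (Scheme.ΓSpecIso (.of K)).commRingCatIsoToRingEquiv.symm.surjective)
  algebraize [(constants p O).hom]
  -- On a dense open set the morphism is given by the images of finitely many generators of a
  -- K-algebra, and each image has an open stabilizer.
  obtain ⟨T, hT⟩ := hft.out
  have hev := (Filter.eventually_all_finset T).2 fun t _ =>
    eventually_galMap_appLE_basicOpen V hW g (h.appLE O D hg t)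
  -- The section 1 is used only to obtain that D is stable under σ.
  filter_upwards [hev, eventually_galMap_appLE_basicOpen V hW g 1] with σ hσ ⟨hDσ, _⟩
  have hle : D ≤ (galMap σ V ≫ h) ⁻¹ᵁ O := fun z hz => hg (hDσ hz)
  have hp' : (galMap σ V ≫ h) ≫ p = (baseChange Kbar V).hom ≫ specMap K Kbar := by
    rw [Category.assoc, hp, ← Category.assoc, galMap_snd, Category.assoc, specGal_comp_specMap]
  have key : ∀ t, (galMap σ V ≫ h).appLE O D hle t = h.appLE O D hg t := fun t => by
    have ht : t ∈ Algebra.adjoin K (T : Set Γ(Y, O)) := by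
      rw [hT]
      trivial
    induction ht using Algebra.adjoin_induction with
    | mem t ht =>
      obtain ⟨h1, h2⟩ := hσ t ht
      exact (appLE_appLE_apply _ _ _ _ _).symm.trans h2
    | algebraMap c =>
      exact (appLE_constants_apply p _ (algebraMap K Kbar) _ hp' hle c).trans
        (appLE_constants_apply p _ (algebraMap K Kbar) _ hp hg c).symm
    | add a b _ _ ha hb => rw [map_add, map_add, ha, hb]
    | mul a b _ _ ha hb => rw [map_mul, map_mul, ha, hb]
  have : Nonempty D := ⟨⟨x, hxg⟩⟩
  have : IsDominant D.ι := Opens.isDominant_ι (D.2.dense ⟨x, hxg⟩)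
  exact ext_of_isDominant (ι := D.ι) (ι_comp_eq_of_appLE_eq hO hle hg key)

end BaseChange

theorem isGalois_of_isAlgClosure (K Kbar : Type*) [Field K] [Field Kbar] [Algebra K Kbar]
    [IsAlgClosure K Kbar] [CharZero K] : IsGalois K Kbar := by
  have : Algebra.IsAlgebraic K Kbar := IsAlgClosure.isAlgebraic
  have : Normal K Kbar := IsAlgClosure.normal K Kbar
  exact ⟨⟩

/-! ### Semilinear automorphisms and descent groups -/

section DescentGroup

variable {K : Type u} [Field K] {Kbar : Type u} [Field Kbar] [Algebra K Kbar]

/-- The automorphism `id × Spec σ` of the scheme `V ×_K Kbar`. -/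
noncomputable def galIso (σ : Gal(Kbar/K)) (V : Over (Spec (.of K))) :
    Aut (baseChange Kbar V).left where
  hom := galMap σ V
  inv := galMap σ⁻¹ V
  hom_inv_id := galMap_comp_inv σ V
  inv_hom_id := galMap_inv_comp σ V

variable {V : Over (Spec (.of K))}

/-- The automorphism of schemes underlying an automorphism of schemes over a base. -/
noncomputable def leftAut {S : Scheme.{u}} {X : Over S} (α : Aut X) : Aut X.left :=
  (Over.forget S).mapIso α

/-- The endomorphism `e` of the scheme `V ×_K Kbar` is semilinear with respect to `σ`. -/
def IsSemilinear (σ : Gal(Kbar/K)) (e : Aut (baseChange Kbar V).left) : Prop :=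
  e.hom ≫ (baseChange Kbar V).hom = (baseChange Kbar V).hom ≫ specGal σ

theorem isSemilinear_galIso (σ : Gal(Kbar/K)) : IsSemilinear σ (galIso σ V) := galMap_snd σ V

theorem IsSemilinear.mul {σ τ : Gal(Kbar/K)} {e e' : Aut (baseChange Kbar V).left}
    (h : IsSemilinear σ e) (h' : IsSemilinear τ e') : IsSemilinear (τ * σ) (e * e') := by
  change (e'.hom ≫ e.hom) ≫ _ = _
  rw [Category.assoc, h, ← Category.assoc, h', Category.assoc, specGal_mul]

theorem IsSemilinear.inv {σ : Gal(Kbar/K)} {e : Aut (baseChange Kbar V).left}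
    (h : IsSemilinear σ e) : IsSemilinear σ⁻¹ e⁻¹ := by
  change e.inv ≫ _ = _
  refine (Iso.inv_comp_eq (α := e)).2 ?_
  rw [← Category.assoc, h, Category.assoc, ← specGal_mul, mul_inv_cancel, specGal_one,
    Category.comp_id]

theorem IsSemilinear.exists_eq {e : Aut (baseChange Kbar V).left}
    (h : IsSemilinear (1 : Gal(Kbar/K)) e) :
    ∃ α : Aut (baseChange Kbar V), leftAut α = e := by
  refine ⟨Over.isoMk e ?_, ?_⟩
  · rw [h, specGal_one, Category.comp_id]
  · ext1
    rfl

theorem isSemilinear_leftAut (α : Aut (baseChange Kbar V)) :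
    IsSemilinear (1 : Gal(Kbar/K)) (leftAut α) := by
  change α.hom.left ≫ _ = _
  rw [Over.w, specGal_one, Category.comp_id]

/-- A group of semilinear automorphisms of `V ×_K Kbar` that is an extension of the Galois group
by a finite group `A` of `Kbar`-automorphisms and contains an open subgroup of the Galois group. -/
structure IsDescentGroup (A : Subgroup (Aut (baseChange Kbar V)))
    (E : Subgroup (Aut (baseChange Kbar V).left)) : Prop where
  finite : Finite A
  semilinear : ∀ e ∈ E, ∃ σ : Gal(Kbar/K), IsSemilinear σ e
  exists_mem : ∀ σ : Gal(Kbar/K), ∃ e ∈ E, IsSemilinear σ e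
  mem_iff : ∀ α : Aut (baseChange Kbar V), leftAut α ∈ E ↔ α ∈ A
  eventually : ∀ᶠ σ in nhds (1 : Gal(Kbar/K)), galIso σ V ∈ E

/-- The action of a group of automorphisms. -/
def autAction {X : Scheme.{u}} (E : Subgroup (Aut X)) (e : E) : X ⟶ X := e.1.hom

theorem isAction_autAction {X : Scheme.{u}} (E : Subgroup (Aut X)) : IsAction (autAction E) where
  one := rfl
  mul _ _ := rfl

namespace IsDescentGroup

variable {A : Subgroup (Aut (baseChange Kbar V))} {E : Subgroup (Aut (baseChange Kbar V).left)}

/-- The quotient e⁻¹e' lies over the identity of G_K, so it is linear over `Kbar` and belongs to A.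
Hence the elements of E over a given σ form a single coset of A. -/
theorem exists_mul_eq (hE : IsDescentGroup A E) {σ : Gal(Kbar/K)}
    {e e' : Aut (baseChange Kbar V).left} (he : e ∈ E) (he' : e' ∈ E) (h : IsSemilinear σ e)
    (h' : IsSemilinear σ e') : ∃ α ∈ A, e * leftAut α = e' := by
  have h1 := h.inv.mul h'
  rw [mul_inv_cancel] at h1
  obtain ⟨α, hα⟩ := h1.exists_eq
  refine ⟨α, (hE.mem_iff α).1 (hα ▸ mul_mem (inv_mem he) he'), ?_⟩
  rw [hα, mul_inv_cancel_left]

variable [IsAlgClosure K Kbar] [CharZero K]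

/-- A function on a descent group that is invariant under a neighbourhood of `1` in the Galois
group takes finitely many values. -/
theorem finite_range (hE : IsDescentGroup A E) {β : Type*} (F : E → β)
    (hF : ∀ᶠ τ in nhds (1 : Gal(Kbar/K)), ∀ (e : E) (h : galIso τ V ∈ E),
      F (⟨galIso τ V, h⟩ * e) = F e) : (Set.range F).Finite := by
  have := hE.finite
  have := isGalois_of_isAlgClosure K Kbar
  -- Φ σ is the set of values of F on the part of E lying over σ. It is finite because A is, and
  -- locally constant in σ, so compactness of the Galois group leaves finitely many such sets.
  let Φ : Gal(Kbar/K) → Set β := fun σ => F '' {e | IsSemilinear σ e.1}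
  have hfin : ∀ σ, (Φ σ).Finite := fun σ => by
    obtain ⟨e, he, hσ⟩ := hE.exists_mem σ
    refine Set.Finite.image _ ?_
    refine (Set.finite_range fun α : A =>
      (⟨e, he⟩ * ⟨leftAut α.1, (hE.mem_iff _).2 α.2⟩ : E)).subset ?_
    intro e' he'
    obtain ⟨α, hα, h⟩ := hE.exists_mul_eq he e'.2 hσ he'
    exact ⟨⟨α, hα⟩, Subtype.ext h⟩
  have hloc : ∀ σ, ∀ᶠ τ in nhds (1 : Gal(Kbar/K)), Φ (σ * τ) = Φ σ := fun σ => by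
    filter_upwards [hE.eventually, hF] with τ hτ hFτ
    ext b
    constructor
    · rintro ⟨e, he, rfl⟩
      have h := (isSemilinear_galIso (V := V) τ).inv.mul he
      rw [mul_inv_cancel_right] at h
      refine ⟨(⟨galIso τ V, hτ⟩ : E)⁻¹ * e, h, ?_⟩
      rw [← hFτ _ hτ, mul_inv_cancel_left]
    · rintro ⟨e, he, rfl⟩
      exact ⟨(⟨galIso τ V, hτ⟩ : E) * e, (isSemilinear_galIso τ).mul he, hFτ _ _⟩
  refine ((finite_range_of_eventually Φ hloc).2.sUnion ?_).subset (?_ : _ ⊆ ⋃₀ Set.range Φ)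
  · rintro _ ⟨σ, rfl⟩
    exact hfin σ
  · rintro _ ⟨e, rfl⟩
    obtain ⟨σ, hσ⟩ := hE.semilinear e.1 e.2
    exact ⟨Φ σ, ⟨σ, rfl⟩, e, hσ, rfl⟩

/-- The orbits of sections over stable open subsets are finite. -/
theorem finite_orbit (hE : IsDescentGroup A E) [IsIntegral (baseChange Kbar V).left]
    (U : (baseChange Kbar V).left.Opens) (hU : IsStable (autAction E) U)
    (s : Γ((baseChange Kbar V).left, U)) : (Set.range fun e => sectionAction hU e s).Finite := by
  by_cases hne : Nonempty U
  · refine hE.finite_range _ ?_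
    filter_upwards [eventually_galMap_appLE V hne s] with τ hτ e h
    rw [((isAction_autAction E).sectionAction hU).mul]
    exact congrArg (sectionAction hU e) (hτ (hU ⟨_, h⟩))
  · have : U = ⊥ := by
      ext x
      exact ⟨fun hx => (hne ⟨⟨x, hx⟩⟩).elim, fun hx => hx.elim⟩
    subst this
    exact Set.toFinite _

/-- Every point has a stable affine open neighbourhood. -/
theorem exists_isStable (hE : IsDescentGroup A E) [(baseChange Kbar V).left.IsSeparated]
    (hV : FiniteSetsInAffineOpens V.left) (x : (baseChange Kbar V).left) :
    ∃ U : (baseChange Kbar V).left.Opens, x ∈ U ∧ IsStable (autAction E) U ∧ IsAffineOpen U := by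
  classical
  -- The projection to V absorbs the Galois maps, so these composites are finite in number. An
  -- affine W containing the image of x under each of them pulls back to finitely many affine open
  -- sets, and their intersection is the required neighbourhood.
  have hfin : (Set.range fun e : E => e.1.hom ≫ proj Kbar V).Finite := by
    refine hE.finite_range _ (.of_forall fun τ e h => ?_)
    change (e.1.hom ≫ galMap τ V) ≫ proj Kbar V = _
    rw [Category.assoc, galMap_proj]
  have := hfin.to_subtype
  let M := Set.range fun e : E => e.1.hom ≫ proj Kbar V
  obtain ⟨W, hW, hxW⟩ := hV ((hfin.image fun m => m x).toFinset)
  have hmem : ∀ m : M, m.1 x ∈ W := fun m => hxW _ (by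
    rw [Set.Finite.mem_toFinset]
    exact ⟨m.1, m.2, rfl⟩)
  have : Nonempty M := ⟨⟨_, ⟨1, rfl⟩⟩⟩
  let U : (baseChange Kbar V).left.Opens :=
    ⟨⋂ m : M, m.1 ⁻¹ᵁ W, isOpen_iInter_of_finite fun m => (m.1 ⁻¹ᵁ W).2⟩
  have hU : U = ⨅ m : M, m.1 ⁻¹ᵁ W :=
    le_antisymm (le_iInf fun m y hy => Set.mem_iInter.1 hy m) fun y hy =>
      Set.mem_iInter.2 fun m => iInf_le (fun m : M => m.1 ⁻¹ᵁ W) m hy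
  refine ⟨U, Set.mem_iInter.2 hmem, ?_, ?_⟩
  · intro e y hy
    refine Set.mem_iInter.2 ?_
    rintro ⟨_, e', rfl⟩
    -- Translation by e only permutes the composites whose preimages are intersected.
    exact Set.mem_iInter.1 hy ⟨_, e' * e, rfl⟩
  · rw [hU]
    refine IsAffineOpen.iInf ?_
    rintro ⟨_, e, rfl⟩
    have : IsIso e.1.hom := Iso.isIso_hom e.1
    exact hW.preimage (e.1.hom ≫ proj Kbar V)

end IsDescentGroup

end DescentGroup

/-- Under the identification of the pushout P with L ⊗ S, the map χ becomes the product map of g and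
f. -/
theorem bijective_of_isPushout {K L S B : Type u} [CommRing K] [CommRing L] [CommRing S]
    [CommRing B] [Algebra K L] [Algebra K S] [Algebra K B] {P : CommRingCat.{u}}
    {inl : CommRingCat.of S ⟶ P} {inr : CommRingCat.of L ⟶ P}
    (h : IsPushout (CommRingCat.ofHom (algebraMap K S)) (CommRingCat.ofHom (algebraMap K L))
      inl inr) (g : L →ₐ[K] B) (f : S →ₐ[K] B)
    (hgf : Function.Bijective (Algebra.TensorProduct.productMap g f)) (χ : P ⟶ CommRingCat.of B)
    (hl : ∀ s, χ (inl s) = f s) (hr : ∀ c, χ (inr c) = g c) : Function.Bijective χ := by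
  have h' := (CommRingCat.isPushout_tensorProduct K L S).flip
  let i := h'.isoIsPushout _ _ h
  have hi : i.hom ≫ χ = CommRingCat.ofHom (Algebra.TensorProduct.productMap g f).toRingHom := by
    apply h'.hom_ext
    · rw [IsPushout.inl_isoIsPushout_hom_assoc]
      ext s
      refine (hl s).trans ?_
      change _ = Algebra.TensorProduct.productMap g f (1 ⊗ₜ[K] s)
      simp
    · rw [IsPushout.inr_isoIsPushout_hom_assoc]
      ext s
      refine (hr s).trans ?_
      change _ = Algebra.TensorProduct.productMap g f (s ⊗ₜ[K] 1)
      simp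
  rw [← ConcreteCategory.isIso_iff_bijective]
  have : IsIso (i.hom ≫ χ) := by
    rw [hi, ConcreteCategory.isIso_iff_bijective]
    exact hgf
  exact IsIso.of_isIso_comp_left i.hom χ

/-! ### The base change of a quotient by a descent group -/

section

variable {K : Type u} [Field K] {Kbar : Type u} [Field Kbar] [Algebra K Kbar]
  {V T : Over (Spec (.of K))}

/-- The action on the underlying scheme of a group of automorphisms of a scheme over a base. -/
def leftAction {S : Scheme.{u}} {X : Over S} (A : Subgroup (Aut X)) (α : A) : X.left ⟶ X.left :=
  α.1.hom.left

theorem isAction_leftAction {S : Scheme.{u}} {X : Over S} (A : Subgroup (Aut X)) :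
    IsAction (leftAction A) where
  one := rfl
  mul _ _ := rfl

namespace IsDescentGroup

variable {A : Subgroup (Aut (baseChange Kbar V))} {E : Subgroup (Aut (baseChange Kbar V).left)}

theorem exists_eq_mul (hE : IsDescentGroup A E) {σ : Gal(Kbar/K)}
    {e e' : Aut (baseChange Kbar V).left} (he : e ∈ E) (he' : e' ∈ E) (h : IsSemilinear σ e)
    (h' : IsSemilinear σ e') : ∃ α ∈ A, leftAut α * e = e' := by
  have h1 := h'.mul h.inv
  rw [inv_mul_cancel] at h1
  obtain ⟨α, hα⟩ := h1.exists_eq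
  refine ⟨α, (hE.mem_iff α).1 (hα ▸ mul_mem he' (inv_mem he)), ?_⟩
  rw [hα, inv_mul_cancel_right]

/-- The elements of `A` as elements of the descent group. -/
noncomputable def incl (hE : IsDescentGroup A E) (α : A) : E :=
  ⟨leftAut α.1, (hE.mem_iff _).2 α.2⟩

section Sections

variable (hE : IsDescentGroup A E) {U : (baseChange Kbar V).left.Opens}
  (hU : IsStable (autAction E) U)

/-- The `A`-invariant sections. -/
noncomputable def invariants : Subring Γ((baseChange Kbar V).left, U) :=
  fixedSubring fun α : A => sectionAction hU (hE.incl α)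

/-- Two elements of E over the same σ differ by an element of A, which acts trivially on b. So E
acts on A-invariant sections through the Galois group. -/
theorem sectionAction_eq {σ : Gal(Kbar/K)} {e e' : E} (h : IsSemilinear σ e.1)
    (h' : IsSemilinear σ e'.1) {b : Γ((baseChange Kbar V).left, U)}
    (hb : b ∈ hE.invariants hU) : sectionAction hU e b = sectionAction hU e' b := by
  obtain ⟨α, hα, hmul⟩ := hE.exists_eq_mul e.2 e'.2 h h'
  have : e' = hE.incl ⟨α, hα⟩ * e := Subtype.ext hmul.symm
  rw [this, ((isAction_autAction E).sectionAction hU).mul, RingHom.comp_apply, hb ⟨α, hα⟩]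

/-- The product of e and an element of A lies over the same σ as e, so it acts on b in the same way.
-/
theorem sectionAction_mem (e : E) {b : Γ((baseChange Kbar V).left, U)}
    (hb : b ∈ hE.invariants hU) : sectionAction hU e b ∈ hE.invariants hU := fun α => by
  obtain ⟨σ, hσ⟩ := hE.semilinear e.1 e.2
  have h := ((isAction_autAction E).sectionAction hU).mul e (hE.incl α)
  refine (RingHom.congr_fun h b).symm.trans (hE.sectionAction_eq hU (σ := σ) ?_ hσ hb)
  have h1 := hσ.mul (isSemilinear_leftAut (K := K) α.1)
  rwa [one_mul] at h1

/-- The action on the invariant sections. -/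
noncomputable def invariantsAction (e : E) : hE.invariants hU →+* hE.invariants hU :=
  (sectionAction hU e).restrict _ _ fun _ hb => hE.sectionAction_mem hU e hb

end Sections

/-- Both sides have the same two components in the fibre product defining `T ×_K Kbar`. This says
that e induces on the quotient the Galois map of T, which is what later makes T a twist. -/
theorem comp_left (π : baseChange Kbar V ⟶ baseChange Kbar T)
    (hπ : ∀ e : E, autAction E e ≫ π.left ≫ proj Kbar T = π.left ≫ proj Kbar T)
    {σ : Gal(Kbar/K)} {e : Aut (baseChange Kbar V).left} (he : e ∈ E) (h : IsSemilinear σ e) :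
    e.hom ≫ π.left = π.left ≫ galMap σ T := by
  apply (isPullback_proj T).hom_ext
  · rw [Category.assoc, Category.assoc, galMap_proj]
    exact hπ ⟨e, he⟩
  · rw [Category.assoc, Category.assoc, galMap_snd, Over.w, h, Over.w_assoc]

theorem leftAction_comp (hE : IsDescentGroup A E) (π : baseChange Kbar V ⟶ baseChange Kbar T)
    (hπ : ∀ e : E, autAction E e ≫ π.left ≫ proj Kbar T = π.left ≫ proj Kbar T) (α : A) :
    leftAction A α ≫ π.left = π.left := by
  have h := comp_left (K := K) π hπ (hE.incl α).2 (isSemilinear_leftAut α.1)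
  rw [galMap_one, Category.comp_id] at h
  exact h

variable [IsAlgClosure K Kbar] [CharZero K]

set_option maxHeartbeats 1000000 in
/-- The functions on an affine open subset of the base change of the quotient by a descent group
are the `A`-invariant functions. -/
theorem app_bijective (hE : IsDescentGroup A E) [IsIntegral (baseChange Kbar V).left]
    (π : baseChange Kbar V ⟶ baseChange Kbar T)
    (hπ : IsGeometricQuotient (autAction E) (π.left ≫ proj Kbar T)) {O : T.left.Opens}
    (hO : IsAffineOpen O) (hne : Nonempty O)
    (hU : IsStable (autAction E) (π.left ⁻¹ᵁ proj Kbar T ⁻¹ᵁ O)) :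
    Function.Injective (π.left.app (proj Kbar T ⁻¹ᵁ O)) ∧
      ∀ s, s ∈ Set.range (π.left.app (proj Kbar T ⁻¹ᵁ O)) ↔ s ∈ hE.invariants hU := by
  have := isGalois_of_isAlgClosure K Kbar
  set W := proj Kbar T ⁻¹ᵁ O with hW
  set U := π.left ⁻¹ᵁ W with hU'
  set π₀ := π.left ≫ proj Kbar T with hπ₀
  have hφ := (isAction_autAction E).sectionAction hU
  have hneU : Nonempty U := by
    obtain ⟨y, hy⟩ := hne
    obtain ⟨x, rfl⟩ := hπ.isQuotientMap.surjective y
    exact ⟨⟨x, hy⟩⟩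
  have hπK : π₀ ≫ T.hom = (baseChange Kbar V).hom ≫ specMap K Kbar := by
    rw [hπ₀, Category.assoc, proj_hom, Over.w_assoc]
  let cB : Kbar →+* hE.invariants hU :=
    (constants (baseChange Kbar V).hom U).hom.codRestrict _ fun c α =>
      appLE_constants_of_comp_eq _ _ _ (Over.w α.1.hom) _ c
  algebraize [(constants T.hom O).hom, cB.comp (algebraMap K Kbar)]
  let g : Kbar →ₐ[K] hE.invariants hU := { cB with commutes' := fun _ => rfl }
  have hmem : ∀ s, π₀.appLE O U le_rfl s ∈ fixedSubring (sectionAction hU) := fun s e =>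
    (appLE_appLE_apply _ _ _ _ _).trans (appLE_congr_hom (hπ.invariant e) _ _ _)
  let f : Γ(T.left, O) →ₐ[K] hE.invariants hU :=
    { (π₀.appLE O U le_rfl).hom.codRestrict (hE.invariants hU) fun s α => hmem s _ with
      commutes' := fun k => Subtype.ext
        (appLE_constants_apply _ _ (algebraMap K Kbar) π₀ hπK _ k) }
  have hf : ∀ s, (f s).1 = π₀.appLE O U le_rfl s := fun _ => rfl
  -- Arbitrary lifts of the Galois elements to E; on A-invariant sections the resulting action does
  -- not depend on them and is therefore multiplicative.
  choose e he hσ using hE.exists_mem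
  have hbij : Function.Bijective (Algebra.TensorProduct.productMap g f) := by
    refine bijective_productMap_of_fixed g f ?_
      (fun σ => hE.invariantsAction hU ⟨e σ, he σ⟩) ?_ ?_ ?_ ?_ ?_
    · intro s t hst
      apply hπ.injective O
      rw [Scheme.Hom.app_eq_appLE]
      exact congrArg Subtype.val hst
    · intro b
      apply Subtype.ext
      refine (hE.sectionAction_eq hU (e := ⟨e 1, he 1⟩) (e' := 1) (hσ 1) ?_ b.2).trans ?_
      · change 𝟙 _ ≫ _ = _
        rw [specGal_one, Category.comp_id, Category.id_comp]
      · rw [hφ.one]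
        rfl
    · intro σ τ b
      apply Subtype.ext
      refine (hE.sectionAction_eq hU (e := ⟨e (σ * τ), he _⟩) (e' := ⟨e τ, he τ⟩ * ⟨e σ, he σ⟩)
        (hσ (σ * τ))
        ((hσ τ).mul (hσ σ)) b.2).trans ?_
      rw [hφ.mul]
      rfl
    · intro σ c
      exact Subtype.ext (appLE_constants_apply _ _ (σ : Kbar →+* Kbar) _ (hσ σ) _ c)
    · intro b
      constructor
      · rintro ⟨s, rfl⟩ σ
        exact Subtype.ext (hmem s _)
      · intro h
        -- An A-invariant section fixed by the chosen lifts is fixed by all of E, hence comes from a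
        -- function on the quotient.
        obtain ⟨s, hs⟩ := hπ.mem_range O hU b.1 fun e' => by
          obtain ⟨σ, hσ'⟩ := hE.semilinear e'.1 e'.2
          exact (hE.sectionAction_eq hU (e := e') (e' := ⟨e σ, he σ⟩) hσ' (hσ σ) b.2).trans
            (congrArg Subtype.val (h σ))
        refine ⟨s, Subtype.ext ?_⟩
        rw [← hs, hf, Scheme.Hom.app_eq_appLE]
        rfl
    · intro b
      filter_upwards [hE.eventually, eventually_galMap_appLE V hneU b.1] with σ h1 h2
      exact Subtype.ext ((hE.sectionAction_eq hU (e := ⟨e σ, he σ⟩) (e' := ⟨galIso σ V, h1⟩) (hσ σ)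
        (isSemilinear_galIso σ) b.2).trans (h2 _))
  let χ : Γ((baseChange Kbar T).left, W) ⟶ CommRingCat.of (hE.invariants hU) :=
    CommRingCat.ofHom ((π.left.app W).hom.codRestrict _ fun s α => by
      rw [Scheme.Hom.app_eq_appLE]
      exact (appLE_appLE_apply _ _ _ _ _).trans
        (appLE_congr_hom (hE.leftAction_comp π hπ.invariant α) _ _ _))
  -- The functions on the base change of O are the tensor product of those on O with `Kbar`, so
  -- Galois descent applies to χ.
  have hχ : Function.Bijective χ := by
    refine bijective_of_isPushout (isPushout_proj T hO) g f hbij χ (fun s => Subtype.ext ?_)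
      fun c => Subtype.ext ?_
    · change π.left.app W _ = _
      rw [Scheme.Hom.app_eq_appLE]
      exact appLE_appLE_apply _ _ _ _ _
    · change π.left.app W _ = _
      rw [Scheme.Hom.app_eq_appLE]
      exact appLE_constants_of_comp_eq _ _ _ (Over.w π) _ c
  refine ⟨fun s t h => hχ.1 (Subtype.ext h), fun s => ⟨?_, fun hs => ?_⟩⟩
  · rintro ⟨t, rfl⟩
    exact (χ t).2
  · obtain ⟨t, ht⟩ := hχ.2 ⟨s, hs⟩
    exact ⟨t, congrArg Subtype.val ht⟩

end IsDescentGroup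

end

/-! ### Descent of properties along integral morphisms -/

theorem isSeparated_of_isSeparated_hom {X S : Scheme.{u}} [S.IsSeparated] (p : X ⟶ S)
    [IsSeparated p] : X.IsSeparated := by
  refine ⟨?_⟩
  rw [← terminal.comp_from p]
  infer_instance

/-- Separatedness descends along surjective integral morphisms. -/
theorem isSeparated_of_surjective {X Y S : Scheme.{u}} (π : X ⟶ Y) (t : Y ⟶ S) [IsIntegralHom π]
    [Surjective π] [IsSeparated (π ≫ t)] : IsSeparated t := by
  let m := pullback.map (π ≫ t) (π ≫ t) t t π π (𝟙 S) (by simp) (by simp)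
  have hm : IsIntegralHom m :=
    MorphismProperty.pullbackMap (P := @IsIntegralHom) inferInstance inferInstance rfl rfl
  have hdiag : pullback.diagonal (π ≫ t) ≫ m = π ≫ pullback.diagonal t := by
    apply pullback.hom_ext
    · rw [Category.assoc, pullback.lift_fst, pullback.diagonal_fst_assoc, Category.assoc,
        pullback.diagonal_fst, Category.comp_id]
    · rw [Category.assoc, pullback.lift_snd, pullback.diagonal_snd_assoc, Category.assoc,
        pullback.diagonal_snd, Category.comp_id]
  -- By surjectivity of π, the diagonal of Y is the image of the closed diagonal of X under m, which
  -- is integral and hence a closed map.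
  have hrange : Set.range (pullback.diagonal t) = m '' Set.range (pullback.diagonal (π ≫ t)) := by
    ext z
    constructor
    · rintro ⟨y, rfl⟩
      obtain ⟨x, rfl⟩ := π.surjective y
      refine ⟨_, ⟨x, rfl⟩, ?_⟩
      rw [← Scheme.Hom.comp_apply, hdiag, Scheme.Hom.comp_apply]
    · rintro ⟨_, ⟨x, rfl⟩, rfl⟩
      refine ⟨π x, ?_⟩
      rw [← Scheme.Hom.comp_apply, ← hdiag, Scheme.Hom.comp_apply]
  refine ⟨IsClosedImmersion.of_isPreimmersion _ ?_⟩
  rw [hrange]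
  exact m.isClosedMap _ (pullback.diagonal (π ≫ t)).isClosedEmbedding.isClosed_range

theorem isReduced_of_isAffineOpen {X : Scheme.{u}} (h : ∀ x : X, ∃ U : X.Opens, x ∈ U ∧
    IsAffineOpen U ∧ _root_.IsReduced Γ(X, U)) : IsReduced X := by
  choose U hx hU hred using h
  have hcov : TopologicalSpace.IsOpenCover U := by
    refine top_le_iff.1 fun x _ => ?_
    exact TopologicalSpace.Opens.mem_iSup.2 ⟨x, hx x⟩
  let 𝒰 := X.openCoverOfIsOpenCover U hcov
  have (x : 𝒰.I₀) : IsReduced (𝒰.X x) := by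
    let x : X := x
    have : IsAffine (U x).toScheme := hU x
    have : _root_.IsReduced Γ((U x).toScheme, ⊤) :=
      isReduced_of_injective (U x).topIso.hom.hom
        ((ConcreteCategory.isIso_iff_bijective (U x).topIso.hom).1 inferInstance).1
    exact isReduced_of_isAffine_isReduced (U x).toScheme
  exact IsReduced.of_openCover _ 𝒰

theorem irreducibleSpace_of_surjective {X Y : Scheme.{u}} (π : X ⟶ Y) [Surjective π]
    [IrreducibleSpace X] : IrreducibleSpace Y := by
  rw [irreducibleSpace_def]
  have h := (IrreducibleSpace.isIrreducible_univ X).image π π.continuous.continuousOn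
  rwa [Set.image_univ, π.surjective.range_eq] at h

/-- An integral morphism to a scheme covered by affine open subsets whose sections pull back
injectively is surjective. -/
theorem surjective_of_app_injective {X Y : Scheme.{u}} (π : X ⟶ Y) [IsIntegralHom π] [IsReduced X]
    (h : ∀ y : Y, ∃ U : Y.Opens, y ∈ U ∧ IsAffineOpen U ∧ Function.Injective (π.app U)) :
    Surjective π := by
  refine ⟨fun y => ?_⟩
  by_contra hy
  obtain ⟨U, hyU, hU, hinj⟩ := h y
  -- The image of π is closed, so a point outside it has a basic open neighbourhood missing it. Its
  -- defining function pulls back to zero, contradicting injectivity.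
  obtain ⟨f, hf, hyf⟩ := hU.exists_basicOpen_le
    (V := ⟨(Set.range π)ᶜ, π.isClosedMap.isClosed_range.isOpen_compl⟩) ⟨y, hy⟩ hyU
  have h1 : X.basicOpen (π.app U f) = ⊥ := by
    rw [← Scheme.preimage_basicOpen]
    ext x
    exact ⟨fun hx => hf hx ⟨x, rfl⟩, fun hx => hx.elim⟩
  rw [basicOpen_eq_bot_iff] at h1
  have h2 : f = 0 := hinj (by rw [h1, map_zero])
  rw [h2, Scheme.basicOpen_zero] at hyf
  exact hyf

/-- Local finiteness descends along integral morphisms to a scheme covered by affine open subsets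
whose sections pull back injectively. -/
theorem locallyOfFiniteType_of_app_injective {X Y S : Scheme.{u}} [IsAffine S]
    [IsNoetherianRing Γ(S, ⊤)] (π : X ⟶ Y) [IsIntegralHom π] (p : Y ⟶ S)
    [LocallyOfFiniteType (π ≫ p)]
    (h : ∀ y : Y, ∃ U : Y.Opens, y ∈ U ∧ IsAffineOpen U ∧ Function.Injective (π.app U)) :
    LocallyOfFiniteType p := by
  rw [HasRingHomProperty.iff_exists_appLE (P := @LocallyOfFiniteType)
    (RingHom.finiteType_stableUnderComposition.stableUnderCompositionWithLocalizationAway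
      RingHom.finiteType_holdsForLocalizationAway).left]
  intro y
  obtain ⟨U, hy, hU, hinj⟩ := h y
  refine ⟨⟨⊤, isAffineOpen_top _⟩, ⟨U, hU⟩, hy, le_preimage_top _ _, ?_⟩
  refine finiteType_of_isIntegral _ (π.app U).hom (π.isIntegral_app _ hU) hinj ?_
  have h1 := (π ≫ p).finiteType_appLE (isAffineOpen_top _) (hU.preimage π) (le_preimage_top _ _)
  have h2 : p.appLE ⊤ U (le_preimage_top _ _) ≫ π.app U =
      (π ≫ p).appLE ⊤ _ (le_preimage_top _ _) := by
    rw [Scheme.Hom.app_eq_appLE]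
    exact Scheme.Hom.appLE_comp_appLE _ _ _ _ _ _ _
  rw [← h2] at h1
  exact h1

/-- A geometric quotient is a quotient in the sense of `IsQuotientBy`. -/
theorem IsGeometricQuotient.isQuotientBy {S : Scheme.{u}} {X Y : Over S} {A : Subgroup (Aut X)}
    {π : X ⟶ Y} (h : IsGeometricQuotient (leftAction A) π.left) : IsQuotientBy A π where
  invariant a ha := Over.OverMorphism.ext (h.invariant ⟨a, ha⟩)
  orbit x y hxy := by
    obtain ⟨a, ha⟩ := h.orbit x y hxy
    exact ⟨a.1, a.2, ha⟩
  isQuotientMap := h.isQuotientMap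
  injective := h.injective
  mem_range_iff U s := by
    constructor
    · rintro ⟨t, rfl⟩ a ha
      exact app_mem_fixedSubring h.invariant U t ⟨a, ha⟩
    · intro hs
      exact h.mem_range U (isStable_preimage h.invariant U) s fun a => hs a.1 a.2

theorem IsQuotientBy.isGeometricQuotient {S : Scheme.{u}} {X Y : Over S}
    {A : Subgroup (Aut X)} {π : X ⟶ Y} (h : IsQuotientBy A π) :
    IsGeometricQuotient (leftAction A) π.left where
  invariant a := congrArg CommaMorphism.left (h.invariant a.1 a.2)
  orbit x y hxy := by
    obtain ⟨a, ha, h⟩ := h.orbit x y hxy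
    exact ⟨⟨a, ha⟩, h⟩
  isQuotientMap := h.isQuotientMap
  injective := h.injective
  mem_range U hU s hs := (h.mem_range_iff U s).2 fun a ha => hs ⟨a, ha⟩

/-! ### The quotient by a descent group as a variety over K -/

section

variable {K : Type u} [Field K] {Kbar : Type u} [Field Kbar] [Algebra K Kbar]
  {V T : Over (Spec (.of K))}

instance flat_specMap : Flat (specMap K Kbar) := by
  rw [Flat.SpecMap_iff]
  change (algebraMap K Kbar).Flat
  exact RingHom.flat_algebraMap_iff.2 inferInstance

theorem IsVariety.isSeparated_baseChange (hV : IsVariety Kbar V) :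
    (baseChange Kbar V).left.IsSeparated := by
  have := hV.isSeparated
  have : IsSeparated (baseChange Kbar V).hom :=
    MorphismProperty.of_isPullback (isPullback_proj V) this
  exact isSeparated_of_isSeparated_hom (baseChange Kbar V).hom

theorem IsVariety.isSeparated_left (hV : IsVariety Kbar V) : V.left.IsSeparated := by
  have := hV.isSeparated
  exact isSeparated_of_isSeparated_hom (S := Spec (.of K)) V.hom

theorem IsVariety.locallyOfFiniteType_baseChange (hV : IsVariety Kbar V) :
    LocallyOfFiniteType (baseChange Kbar V).hom :=
  MorphismProperty.of_isPullback (isPullback_proj V) hV.locallyOfFiniteType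

theorem IsVariety.isLocallyNoetherian_baseChange (hV : IsVariety Kbar V) :
    IsLocallyNoetherian (baseChange Kbar V).left := by
  have := hV.locallyOfFiniteType_baseChange
  have : IsLocallyNoetherian (Spec (CommRingCat.of Kbar)) := inferInstance
  exact LocallyOfFiniteType.isLocallyNoetherian (baseChange Kbar V).hom

namespace IsDescentGroup

variable {A : Subgroup (Aut (baseChange Kbar V))} {E : Subgroup (Aut (baseChange Kbar V).left)}
  [IsAlgClosure K Kbar] [CharZero K]

/-- The identification of functions on charts with A-invariants makes π injective on functions.
Together with integrality of π this gives surjectivity, reducedness and local finiteness over `Kbar`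
(by Artin–Tate); irreducibility and compactness are inherited through surjections. -/
theorem isVariety_and_isQuotientBy (hE : IsDescentGroup A E) (hV : IsVariety Kbar V)
    (π : baseChange Kbar V ⟶ baseChange Kbar T) [IsIntegralHom (π.left ≫ proj Kbar T)]
    (hπ : IsGeometricQuotient (autAction E) (π.left ≫ proj Kbar T)) :
    IsVariety Kbar T ∧ IsQuotientBy A π := by
  have := hV.isIntegral
  have := hV.isSeparated_baseChange
  have := hV.isLocallyNoetherian_baseChange
  have := hV.locallyOfFiniteType_baseChange
  have : Surjective (π.left ≫ proj Kbar T) := ⟨hπ.isQuotientMap.surjective⟩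
  have : IsIntegralHom π.left := IsIntegralHom.of_comp π.left (proj Kbar T)
  have hchart : ∀ y : (baseChange Kbar T).left, ∃ O : T.left.Opens, y ∈ proj Kbar T ⁻¹ᵁ O ∧
      IsAffineOpen O ∧ Nonempty O := fun y => by
    obtain ⟨O, hO, hyO, -⟩ := exists_isAffineOpen_mem_and_subset (x := proj Kbar T y) (U := ⊤)
      trivial
    exact ⟨O, hyO, hO, ⟨⟨_, hyO⟩⟩⟩
  have hstab : ∀ O : T.left.Opens, IsStable (autAction E) (π.left ⁻¹ᵁ proj Kbar T ⁻¹ᵁ O) :=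
    fun O => isStable_preimage hπ.invariant O
  have hinj : ∀ y : (baseChange Kbar T).left, ∃ U : (baseChange Kbar T).left.Opens, y ∈ U ∧
      IsAffineOpen U ∧ Function.Injective (π.left.app U) := fun y => by
    obtain ⟨O, hy, hO, hne⟩ := hchart y
    exact ⟨_, hy, hO.preimage _, (hE.app_bijective π hπ hO hne (hstab O)).1⟩
  have hsurj : Surjective π.left := surjective_of_app_injective π.left hinj
  have hred : IsReduced (baseChange Kbar T).left := isReduced_of_isAffineOpen fun y => by
    obtain ⟨U, hy, hU, h⟩ := hinj y
    exact ⟨U, hy, hU, isReduced_of_injective (π.left.app U).hom h⟩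
  have hirr := irreducibleSpace_of_surjective π.left
  have hTint : IsIntegral (baseChange Kbar T).left := isIntegral_of_irreducibleSpace_of_isReduced _
  have hlft : LocallyOfFiniteType (baseChange Kbar T).hom := by
    have : LocallyOfFiniteType (π.left ≫ (baseChange Kbar T).hom) := by rwa [Over.w]
    exact locallyOfFiniteType_of_app_injective π.left _ hinj
  have hTK : (π.left ≫ proj Kbar T) ≫ T.hom = (baseChange Kbar V).hom ≫ specMap K Kbar := by
    rw [Category.assoc, proj_hom, Over.w_assoc]
  refine ⟨⟨?_, ?_, ?_, hTint⟩, ?_⟩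
  · have : IsSeparated ((π.left ≫ proj Kbar T) ≫ T.hom) := by
      rw [hTK]
      infer_instance
    exact isSeparated_of_surjective (π.left ≫ proj Kbar T) T.hom
  -- Local finiteness has been obtained over `Kbar` and descends along the flat, surjective,
  -- quasi-compact map to Spec K.
  · exact MorphismProperty.of_isPullback_of_descendsAlong
      (Q := @Surjective ⊓ @Flat ⊓ @QuasiCompact) (isPullback_proj T).flip
      ⟨⟨inferInstance, inferInstance⟩, inferInstance⟩ hlft
  · have := hV.quasiCompact
    have : QuasiCompact (baseChange Kbar V).hom :=
      MorphismProperty.of_isPullback (isPullback_proj V) this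
    have : CompactSpace (baseChange Kbar V).left :=
      QuasiCompact.compactSpace_of_compactSpace (baseChange Kbar V).hom
    have : CompactSpace T.left := ⟨by
      rw [← (π.left ≫ proj Kbar T).surjective.range_eq]
      exact isCompact_range (π.left ≫ proj Kbar T).continuous⟩
    infer_instance
  · have := hE.finite
    refine ((isAction_leftAction A).isGeometricQuotient π.left
      (hE.leftAction_comp π hπ.invariant) fun y => ?_).isQuotientBy
    obtain ⟨O, hy, hO, hne⟩ := hchart y
    refine ⟨_, hy, hO.preimage _,
      IsLocallyNoetherian.component_noetherian ⟨_, (hO.preimage _).preimage _⟩,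
      fun s => Set.finite_range _, fun s hs => ?_⟩
    exact ((hE.app_bijective π hπ hO hne (hstab O)).2 s).2 hs

/-- The quotient by a descent group is a variety over `K`, whose base change is the quotient
by `A`. -/
theorem exists_quotient (hE : IsDescentGroup A E) (hV : IsVariety Kbar V)
    (hVaff : FiniteSetsInAffineOpens V.left) :
    ∃ (T : Over (Spec (.of K))) (π : baseChange Kbar V ⟶ baseChange Kbar T),
      IsVariety Kbar T ∧ IsQuotientBy A π ∧
        ∀ e ∈ E, ∀ σ : Gal(Kbar/K), IsSemilinear σ e → e.hom ≫ π.left = π.left ≫ galMap σ T := by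
  have := hV.isIntegral
  have := hV.isSeparated_baseChange
  have := hV.isLocallyNoetherian_baseChange
  obtain ⟨Y, π₀, hred, hint, hπ₀⟩ := (isAction_autAction E).exists_quotient
    (hE.exists_isStable hVaff) fun U hU _ s => hE.finite_orbit U hU s
  -- Semilinear maps preserve the structure morphism to Spec K, though not the one to Spec `Kbar`;
  -- so the quotient is a K-scheme.
  obtain ⟨t, ht⟩ := hπ₀.exists_desc ((baseChange Kbar V).hom ≫ specMap K Kbar) fun e => by
    obtain ⟨σ, hσ⟩ := hE.semilinear e.1 e.2
    change e.1.hom ≫ _ = _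
    rw [← Category.assoc, hσ, Category.assoc, specGal_comp_specMap]
  let T : Over (Spec (.of K)) := Over.mk t
  let π : baseChange Kbar V ⟶ baseChange Kbar T :=
    Over.homMk ((isPullback_proj T).lift π₀ (baseChange Kbar V).hom ht)
      ((isPullback_proj T).lift_snd _ _ _)
  have hπ : π.left ≫ proj Kbar T = π₀ := (isPullback_proj T).lift_fst _ _ _
  rw [← hπ] at hπ₀ hint
  obtain ⟨h1, h2⟩ := hE.isVariety_and_isQuotientBy hV π hπ₀
  exact ⟨T, π, h1, h2, fun e he σ h => comp_left π hπ₀.invariant he h⟩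

end IsDescentGroup

end

/-! ### Descent of morphisms to the base field -/

section

open scoped TensorProduct

/-- The Galois-invariant elements of `L ⊗ S` are the elements of `S`. -/
theorem mem_range_includeRight_of_fixed {K L S : Type*} [Field K] [Field L] [Algebra K L]
    [IsGalois K L] [CommRing S] [Algebra K S] (x : L ⊗[K] S)
    (hx : ∀ σ : Gal(L/K), Algebra.TensorProduct.map (σ : L →ₐ[K] L) (AlgHom.id K S) x = x) :
    ∃ s : S, 1 ⊗ₜ s = x := by
  let b := Module.Basis.ofVectorSpace K S
  let b' := Algebra.TensorProduct.basis L b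
  -- In a K-basis of S, the Galois group acts on L ⊗ S coordinatewise, so an invariant element has
  -- coordinates in K.
  have hrepr : ∀ (σ : Gal(L/K)) (y : L ⊗[K] S) (i),
      b'.repr (Algebra.TensorProduct.map (σ : L →ₐ[K] L) (AlgHom.id K S) y) i =
        σ (b'.repr y i) := fun σ y i => by
    induction y with
    | zero => simp
    | add y z hy hz => rw [map_add, map_add, map_add, Finsupp.add_apply, Finsupp.add_apply,
        map_add, hy, hz]
    | tmul a s =>
      rw [Algebra.TensorProduct.map_tmul, Algebra.TensorProduct.basis_repr_tmul,
        Algebra.TensorProduct.basis_repr_tmul]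
      simp
  have hk : ∀ i, ∃ k : K, algebraMap K L k = b'.repr x i := fun i =>
    (InfiniteGalois.mem_range_algebraMap_iff_fixed _).2 fun σ => by rw [← hrepr, hx]
  choose k hk using hk
  refine ⟨∑ i ∈ (b'.repr x).support, k i • b i, ?_⟩
  conv_rhs => rw [← b'.linearCombination_repr x, Finsupp.linearCombination_apply, Finsupp.sum]
  rw [TensorProduct.tmul_sum]
  refine Finset.sum_congr rfl fun i _ => ?_
  rw [← hk, Algebra.TensorProduct.basis_apply, TensorProduct.smul_tmul', TensorProduct.tmul_smul,
    TensorProduct.smul_tmul', smul_eq_mul, mul_one, Algebra.smul_def, mul_one]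

theorem injective_and_mem_range_of_isPushout {K L : Type u} [Field K] [Field L] [Algebra K L]
    [IsGalois K L] {S P : CommRingCat.{u}} {a : CommRingCat.of K ⟶ S}
    {inl : S ⟶ P} {inr : CommRingCat.of L ⟶ P}
    (h : IsPushout a (CommRingCat.ofHom (algebraMap K L)) inl inr)
    (θ : Gal(L/K) → (P ⟶ P)) (hl : ∀ σ, inl ≫ θ σ = inl)
    (hr : ∀ σ, inr ≫ θ σ = CommRingCat.ofHom (σ : L →+* L) ≫ inr) :
    Function.Injective inl ∧ ∀ x : P, (∀ σ, θ σ x = x) → x ∈ Set.range inl := by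
  algebraize [a.hom]
  have h' : IsPushout a (CommRingCat.ofHom (algebraMap K L)) _ _ :=
    (CommRingCat.isPushout_tensorProduct K L S).flip
  let i := h'.isoIsPushout _ _ h
  have hi : ∀ s, i.hom (1 ⊗ₜ[K] s : L ⊗[K] S) = inl s := fun s =>
    ConcreteCategory.congr_hom (h'.inl_isoIsPushout_hom _ _ h) s
  have hinv : ∀ x, i.hom (i.inv x) = x := fun x => ConcreteCategory.congr_hom i.inv_hom_id x
  have hinj : Function.Injective i.hom :=
    ((ConcreteCategory.isIso_iff_bijective i.hom).1 inferInstance).1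
  constructor
  · intro s t hst
    rw [← hi, ← hi] at hst
    exact Algebra.TensorProduct.includeRight_injective (algebraMap K L).injective (hinj hst)
  · intro x hx
    have hθ : ∀ σ, i.hom ≫ θ σ = CommRingCat.ofHom (Algebra.TensorProduct.map (σ : L →ₐ[K] L)
        (AlgHom.id K S)).toRingHom ≫ i.hom := fun σ => by
      apply h'.hom_ext
      · rw [IsPushout.inl_isoIsPushout_hom_assoc, hl]
        ext s
        refine (hi s).symm.trans (congrArg i.hom ?_)
        change _ = Algebra.TensorProduct.map (σ : L →ₐ[K] L) (AlgHom.id K S) (1 ⊗ₜ s)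
        simp
      · rw [IsPushout.inr_isoIsPushout_hom_assoc, hr]
        ext c
        have h1 : ∀ c, i.hom (c ⊗ₜ[K] 1 : L ⊗[K] S) = inr c := fun c =>
          ConcreteCategory.congr_hom (h'.inr_isoIsPushout_hom _ _ h) c
        refine (h1 _).symm.trans (congrArg i.hom ?_)
        change _ = Algebra.TensorProduct.map (σ : L →ₐ[K] L) (AlgHom.id K S) (c ⊗ₜ 1)
        simp
        rfl
    obtain ⟨s, hs⟩ := mem_range_includeRight_of_fixed (K := K) (i.inv x : L ⊗[K] S) fun σ => by
      apply hinj
      refine (ConcreteCategory.congr_hom (hθ σ) (i.inv x)).symm.trans ?_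
      change θ σ (i.hom (i.inv x)) = _
      rw [hinv, hx]
    exact ⟨s, by rw [← hi, hs, hinv]⟩

end

section

variable {K : Type u} [Field K] {Kbar : Type u} [Field Kbar] [Algebra K Kbar]
  {V W : Over (Spec (.of K))}

variable (V) in
/-- The Galois group acting on `V ×_K Kbar`. -/
noncomputable def galSubgroup : Subgroup (Aut (baseChange Kbar V).left) where
  carrier := Set.range fun σ : Gal(Kbar/K) => galIso σ V
  one_mem' := ⟨1, by
    ext1
    exact galMap_one V⟩
  mul_mem' := by
    rintro _ _ ⟨σ, rfl⟩ ⟨τ, rfl⟩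
    refine ⟨τ * σ, ?_⟩
    ext1
    exact galMap_mul τ σ V
  inv_mem' := by
    rintro _ ⟨σ, rfl⟩
    refine ⟨σ⁻¹, ?_⟩
    ext1
    rfl

theorem specGal_injective {σ τ : Gal(Kbar/K)} (h : specGal σ = specGal τ) : σ = τ := by
  have h1 := Spec.map_injective h
  ext c
  exact ConcreteCategory.congr_hom h1 c

/-- The structure morphism of a nonempty scheme over a field is surjective, so it can be cancelled:
a semilinear automorphism lies over only one σ. -/
theorem eq_of_hom_comp_specGal_eq [Nonempty (baseChange Kbar V).left] {σ τ : Gal(Kbar/K)}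
    (h : (baseChange Kbar V).hom ≫ specGal σ = (baseChange Kbar V).hom ≫ specGal τ) : σ = τ := by
  have : Subsingleton (Spec (CommRingCat.of Kbar)) :=
    inferInstanceAs (Subsingleton (PrimeSpectrum Kbar))
  have : Surjective (baseChange Kbar V).hom :=
    ⟨fun x => ⟨Classical.arbitrary (baseChange Kbar V).left, Subsingleton.elim _ _⟩⟩
  exact specGal_injective (ext_of_isDominant (X := Spec (.of Kbar))
    (ι := (baseChange Kbar V).hom) h)

-- The case of trivial A; it supplies the finiteness of Galois orbits of sections.
variable (V) in
theorem isDescentGroup_galSubgroup [Nonempty (baseChange Kbar V).left] :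
    IsDescentGroup ⊥ (galSubgroup (Kbar := Kbar) V) where
  finite := inferInstance
  semilinear := by
    rintro _ ⟨σ, rfl⟩
    exact ⟨σ, isSemilinear_galIso σ⟩
  exists_mem σ := ⟨galIso σ V, ⟨σ, rfl⟩, isSemilinear_galIso σ⟩
  mem_iff α := by
    rw [Subgroup.mem_bot]
    constructor
    · rintro ⟨σ, hσ⟩
      have h1 : IsSemilinear σ (leftAut α) := by
        rw [← hσ]
        exact isSemilinear_galIso σ
      obtain rfl := eq_of_hom_comp_specGal_eq ((isSemilinear_leftAut α).symm.trans h1)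
      ext
      have h2 : (leftAut α).hom = galMap 1 V := by
        rw [← hσ]
        rfl
      rw [galMap_one] at h2
      exact h2
    · rintro rfl
      exact one_mem _
  eventually := .of_forall fun σ => ⟨σ, rfl⟩

variable [IsAlgClosure K Kbar] [CharZero K]

/-- On affine charts the Galois invariants of Γ(W) ⊗ `Kbar` are Γ(W). Viewing V as a quotient of its
base change turns descent of morphisms into the universal property of quotients. -/
theorem isGeometricQuotient_proj (hV : IsVariety Kbar V) :
    IsReduced V.left ∧
      IsGeometricQuotient (autAction (galSubgroup (Kbar := Kbar) V)) (proj Kbar V) := by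
  have := hV.isIntegral
  have := hV.isLocallyNoetherian_baseChange
  have := isGalois_of_isAlgClosure K Kbar
  have hinv : ∀ e, autAction (galSubgroup (Kbar := Kbar) V) e ≫ proj Kbar V = proj Kbar V := by
    rintro ⟨_, σ, rfl⟩
    exact galMap_proj σ V
  have hconst : ∀ (O : V.left.Opens) (σ : Gal(Kbar/K)),
      constants (baseChange Kbar V).hom (proj Kbar V ⁻¹ᵁ O) ≫
          (galMap σ V).appLE _ _ (le_galMap_preimage V σ O) =
        CommRingCat.ofHom (σ : Kbar →+* Kbar) ≫
          constants (baseChange Kbar V).hom (proj Kbar V ⁻¹ᵁ O) := fun O σ =>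
    constants_appLE (baseChange Kbar V).hom (baseChange Kbar V).hom _ (galMap σ V)
      (galMap_snd σ V) (le_galMap_preimage V σ O)
  have hproj : ∀ (O : V.left.Opens) (σ : Gal(Kbar/K)),
      (proj Kbar V).appLE O (proj Kbar V ⁻¹ᵁ O) le_rfl ≫
          (galMap σ V).appLE _ _ (le_galMap_preimage V σ O) =
        (proj Kbar V).appLE O (proj Kbar V ⁻¹ᵁ O) le_rfl := fun O σ => by
    rw [Scheme.Hom.appLE_comp_appLE]
    simp only [galMap_proj]
  have key : ∀ {O : V.left.Opens}, IsAffineOpen O →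
      Function.Injective ((proj Kbar V).appLE O (proj Kbar V ⁻¹ᵁ O) le_rfl) ∧
        ∀ s, (∀ σ : Gal(Kbar/K), (galMap σ V).appLE _ _ (le_galMap_preimage V σ O) s = s) →
          s ∈ Set.range ((proj Kbar V).appLE O (proj Kbar V ⁻¹ᵁ O) le_rfl) := fun {O} hO =>
    injective_and_mem_range_of_isPushout (isPushout_proj V hO)
      (fun σ => (galMap σ V).appLE _ _ (le_galMap_preimage V σ O)) (hproj O) (hconst O)
  have hred : IsReduced V.left := isReduced_of_isAffineOpen fun y => by
    obtain ⟨O, hO, hyO, -⟩ := exists_isAffineOpen_mem_and_subset (x := y) (U := ⊤) trivial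
    exact ⟨O, hyO, hO, isReduced_of_injective ((proj Kbar V).appLE O _ le_rfl).hom (key hO).1⟩
  refine ⟨hred, (isAction_autAction _).isGeometricQuotient _ hinv fun y => ?_⟩
  obtain ⟨O, hO, hyO, -⟩ := exists_isAffineOpen_mem_and_subset (x := y) (U := ⊤) trivial
  refine ⟨O, hyO, hO, IsLocallyNoetherian.component_noetherian ⟨_, hO.preimage _⟩,
    (isDescentGroup_galSubgroup V).finite_orbit _ _, fun s hs => ?_⟩
  rw [Scheme.Hom.app_eq_appLE]
  exact (key hO).2 s fun σ => hs ⟨galIso σ V, σ, rfl⟩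

/-- Galois-invariant morphisms are defined over the base field. -/
theorem isDefinedOver_of_galConj_eq (hV : IsVariety Kbar V) (hW : IsVariety Kbar W)
    (f : baseChange Kbar V ⟶ baseChange Kbar W) (hf : ∀ σ : Gal(Kbar/K), galConj σ f = f) :
    IsDefinedOver f := by
  obtain ⟨hred, hq⟩ := isGeometricQuotient_proj hV
  have := hV.isIntegral
  have := hW.isSeparated_left
  -- Composing f with the projection to W gives a Galois-invariant morphism, which therefore factors
  -- through V.
  obtain ⟨k, hk⟩ := hq.exists_desc (f.left ≫ proj Kbar W) (by
    rintro ⟨_, σ, rfl⟩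
    change galMap σ V ≫ _ = _
    conv_rhs => rw [← hf σ, galConj_left, Category.assoc, Category.assoc, galMap_proj])
  have hkW : k ≫ W.hom = V.hom := by
    refine ext_of_isDominant (Y := Spec (.of K)) (ι := proj Kbar V) ?_
    rw [← Category.assoc, hk, Category.assoc, proj_hom, Over.w_assoc, proj_hom]
  refine ⟨Over.homMk k hkW, Over.OverMorphism.ext ?_⟩
  apply (isPullback_proj W).hom_ext
  · rw [baseChangeMap_proj, ← hk]
    rfl
  · rw [Over.w, Over.w]

end

/-! ### Conjugators, the normalizer and the field of moduli -/

section Conjugation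

variable {C : Type v} [Category.{w} C] {X : C} {f : X ⟶ X}

theorem mem_autGroup_iff {α : Aut X} : α ∈ autGroup f ↔ α.hom ≫ f = f ≫ α.hom :=
  conj_eq_iff f α f

theorem conj_conj {Y Z : C} (f : X ⟶ X) (ψ : Y ≅ X) (φ : Z ≅ Y) :
    conj (conj f ψ) φ = conj f (φ ≪≫ ψ) := by
  simp only [conj, Category.assoc, Iso.trans_hom, Iso.trans_inv]

theorem conj_mul (f : X ⟶ X) (ψ φ : Aut X) :
    conj f (show Aut X from ψ * φ) = conj (conj f ψ) φ :=
  (conj_conj f ψ φ).symm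

theorem conj_one (f : X ⟶ X) : conj f (show Aut X from 1) = f :=
  (autGroup f).one_mem

theorem conj_eq_conj_iff {ψ ψ' : Aut X} : conj f ψ' = conj f ψ ↔ ψ' * ψ⁻¹ ∈ autGroup f := by
  change _ ↔ conj f (show Aut X from ψ' * ψ⁻¹) = f
  rw [conj_mul]
  constructor
  · intro h
    rw [h, ← conj_mul, mul_inv_cancel, conj_one]
  · intro h
    have h1 := congrArg (fun g => conj g ψ) h
    simp only [← conj_mul] at h1
    rwa [inv_mul_cancel_right] at h1

theorem mem_autGroup_conj_iff {α ψ : Aut X} :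
    α ∈ autGroup (conj f ψ) ↔ ψ * α * ψ⁻¹ ∈ autGroup f := by
  rw [← conj_eq_conj_iff, conj_mul]
  rfl

end Conjugation

section Galois

variable {K : Type u} [Field K] {Kbar : Type u} [Field Kbar] [Algebra K Kbar]
  {V : Over (Spec (.of K))} {f : baseChange Kbar V ⟶ baseChange Kbar V} {σ τ : Gal(Kbar/K)}

theorem mem_conjugators_iff {ψ : Aut (baseChange Kbar V)} :
    ψ ∈ conjugators f σ ↔ ψ.hom ≫ f = galConj σ f ≫ ψ.hom :=
  eq_comm.trans (conj_eq_iff f ψ _)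

theorem galConjAut_mem_autGroup {α : Aut (baseChange Kbar V)} (hα : α ∈ autGroup f) :
    galConjAut σ α ∈ autGroup (galConj σ f) := by
  rw [mem_autGroup_iff] at hα ⊢
  change galConj σ α.hom ≫ _ = _ ≫ galConj σ α.hom
  rw [← galConj_comp, hα, galConj_comp]

theorem galConjAut_mul (τ σ : Gal(Kbar/K)) (α : Aut (baseChange Kbar V)) :
    galConjAut (τ * σ) α = galConjAut τ (galConjAut σ α) := by
  ext1
  exact galConj_mul τ σ α.hom

theorem galConjAut_one (α : Aut (baseChange Kbar V)) :
    galConjAut (1 : Gal(Kbar/K)) α = α := by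
  ext1
  exact galConj_one α.hom

/-- If `autGroup f` is Galois stable, it is the automorphism group of every conjugate of `f`. -/
theorem autGroup_galConj (hdef : IsDefinedOverSubgroup (autGroup f)) (σ : Gal(Kbar/K)) :
    autGroup (galConj σ f) = autGroup f := by
  ext α
  constructor
  · intro h
    have h1 := galConjAut_mem_autGroup (σ := σ⁻¹) h
    rw [← galConj_mul, inv_mul_cancel, galConj_one] at h1
    have h2 := hdef σ _ h1
    rwa [← galConjAut_mul, mul_inv_cancel, galConjAut_one] at h2
  · intro h
    have h1 := galConjAut_mem_autGroup (σ := σ) (hdef σ⁻¹ _ h)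
    rwa [← galConjAut_mul, mul_inv_cancel, galConjAut_one] at h1

/-- Aut(f^ψ) = ψ⁻¹ Aut(f) ψ, while Aut(f^σ) = Aut(f) by Galois stability. -/
theorem conjugators_subset_autNormalizer (hdef : IsDefinedOverSubgroup (autGroup f))
    {ψ : Aut (baseChange Kbar V)} (hψ : ψ ∈ conjugators f σ) : ψ ∈ autNormalizer f := by
  refine Subgroup.mem_normalizer_iff.2 fun α => ?_
  rw [← mem_autGroup_conj_iff, ← show galConj σ f = conj f ψ from hψ, autGroup_galConj hdef]

theorem mem_conjugators_iff_of_mem {ψ ψ' : Aut (baseChange Kbar V)} (hψ : ψ ∈ conjugators f σ) :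
    ψ' ∈ conjugators f σ ↔ ψ' * ψ⁻¹ ∈ autGroup f := by
  rw [← conj_eq_conj_iff, ← show galConj σ f = conj f ψ from hψ]
  exact eq_comm

theorem mul_galConjAut_mem_conjugators {ψ ψ' : Aut (baseChange Kbar V)}
    (hψ : ψ ∈ conjugators f τ) (hψ' : ψ' ∈ conjugators f σ) :
    ψ * galConjAut τ ψ' ∈ conjugators f (τ * σ) :=
  galConj_mul_eq_conj τ σ f ψ ψ' hψ hψ'

/-- The sets of conjugators are cosets of `autGroup f` in its normalizer. -/
theorem exists_conjugators_eq (hdef : IsDefinedOverSubgroup (autGroup f))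
    (hne : ∀ σ : Gal(Kbar/K), (conjugators f σ).Nonempty) :
    ∃ φ : Gal(Kbar/K) → NormalizerQuotient f, ∀ σ, conjugators f σ =
      {ψ | ∃ n : autNormalizer f, n.1 = ψ ∧ QuotientGroup.mk n = φ σ} := by
  choose ψ hψ using hne
  have hN := fun σ => conjugators_subset_autNormalizer hdef (hψ σ)
  refine ⟨fun σ => QuotientGroup.mk ⟨ψ σ, hN σ⟩, fun σ => Set.ext fun ψ' => ?_⟩
  constructor
  · intro h
    refine ⟨⟨ψ', conjugators_subset_autNormalizer hdef h⟩, rfl,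
      QuotientGroup.eq_iff_div_mem.2 ?_⟩
    rw [div_eq_mul_inv]
    exact (mem_conjugators_iff_of_mem (hψ σ)).1 h
  · rintro ⟨n, rfl, h⟩
    rw [QuotientGroup.eq_iff_div_mem, div_eq_mul_inv] at h
    exact (mem_conjugators_iff_of_mem (hψ σ)).2 h

variable [IsAlgClosure K Kbar] {W : Over (Spec (.of K))}

/-- A morphism is fixed by an open subgroup of the Galois group. -/
theorem eventually_galConj_eq (hV : IsVariety Kbar V) (hW : IsVariety Kbar W)
    (g : baseChange Kbar V ⟶ baseChange Kbar W) :
    ∀ᶠ σ in nhds (1 : Gal(Kbar/K)), galConj σ g = g := by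
  have := hV.isIntegral
  have := hW.isSeparated_left
  have := hW.locallyOfFiniteType
  filter_upwards [eventually_galMap_comp V W.hom (g.left ≫ proj Kbar W) (by
    rw [Category.assoc, proj_hom, Over.w_assoc])] with σ hσ
  apply Over.OverMorphism.ext
  apply (isPullback_proj W).hom_ext
  · rw [galConj_left, Category.assoc, Category.assoc, galMap_proj, hσ]
  · rw [Over.w, Over.w]

/-- Because f is fixed by an open subgroup, `moduliGroup f` is open and hence closed. Infinite
Galois theory then recovers it from its fixed field, which is K. -/
theorem conjugators_nonempty [CharZero K] (hV : IsVariety Kbar V) (hf : fieldOfModuli f = ⊥)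
    (σ : Gal(Kbar/K)) : (conjugators f σ).Nonempty := by
  have := isGalois_of_isAlgClosure K Kbar
  have hopen : IsOpen (moduliGroup f : Set Gal(Kbar/K)) := by
    refine Subgroup.isOpen_of_mem_nhds _ (g := 1) ?_
    filter_upwards [eventually_galConj_eq hV hV f] with τ hτ
    exact ⟨1, hτ.trans ((autGroup f).one_mem).symm⟩
  have h := InfiniteGalois.fixingSubgroup_fixedField
    ⟨moduliGroup f, Subgroup.isClosed_of_isOpen _ hopen⟩
  have h1 : σ ∈ moduliGroup f := by
    change IntermediateField.fixingSubgroup (fieldOfModuli f) = moduliGroup f at h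
    rw [← h, hf, IntermediateField.fixingSubgroup_bot]
    trivial
  exact h1

end Galois

/-! ### The universal property and the action of the normalizer -/

section Universal

variable {S : Scheme.{u}} [S.IsSeparated] {X Y Z : Over S} {A : Subgroup (Aut X)} {π : X ⟶ Y}

namespace IsQuotientBy

omit [S.IsSeparated] in
theorem hom_ext (h : IsQuotientBy A π) [IsReduced Y.left] [Z.left.IsSeparated] {k k' : Y ⟶ Z}
    (hk : π ≫ k = π ≫ k') : k = k' := by
  have : Surjective π.left := ⟨h.isQuotientMap.surjective⟩
  exact Over.OverMorphism.ext
    (ext_of_isDominant (ι := π.left) (congrArg CommaMorphism.left hk))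

theorem exists_desc (h : IsQuotientBy A π) [IsReduced Y.left] [Z.left.IsSeparated] (g : X ⟶ Z)
    (hg : ∀ a ∈ A, a.hom ≫ g = g) : ∃ k : Y ⟶ Z, π ≫ k = g := by
  have : Surjective π.left := ⟨h.isQuotientMap.surjective⟩
  obtain ⟨k, hk⟩ := h.isGeometricQuotient.exists_desc g.left fun a =>
    congrArg CommaMorphism.left (hg a.1 a.2)
  refine ⟨Over.homMk k ?_, Over.OverMorphism.ext hk⟩
  refine ext_of_isDominant (ι := π.left) ?_
  rw [← Category.assoc, hk, Over.w, Over.w]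

/-- Two quotients are isomorphic. -/
theorem exists_iso (h : IsQuotientBy A π) {π' : X ⟶ Z} (h' : IsQuotientBy A π') [IsReduced Y.left]
    [Y.left.IsSeparated] [IsReduced Z.left] [Z.left.IsSeparated] :
    ∃ F : Z ≅ Y, π' ≫ F.hom = π := by
  obtain ⟨k, hk⟩ := h.exists_desc π' h'.invariant
  obtain ⟨k', hk'⟩ := h'.exists_desc π h.invariant
  refine ⟨⟨k', k, h'.hom_ext ?_, h.hom_ext ?_⟩, hk'⟩
  · rw [reassoc_of% hk', hk, Category.comp_id]
  · rw [reassoc_of% hk, hk', Category.comp_id]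

variable [IsReduced Y.left] [Y.left.IsSeparated]

/-- The composite of n and π is A-invariant because n a n⁻¹ belongs to A and is absorbed by π. -/
theorem exists_desc_normalizer (h : IsQuotientBy A π) {n : Aut X}
    (hn : n ∈ Subgroup.normalizer (A : Set (Aut X))) :
    ∃ k : Y ⟶ Y, π ≫ k = n.hom ≫ π := by
  refine h.exists_desc _ fun a ha => ?_
  have h1 := h.invariant _ ((Subgroup.mem_normalizer_iff.1 hn a).1 ha)
  change (n.inv ≫ a.hom ≫ n.hom) ≫ π = π at h1
  rw [Category.assoc, Iso.inv_comp_eq (α := n), Category.assoc] at h1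
  exact h1

theorem exists_aut (h : IsQuotientBy A π) {n : Aut X}
    (hn : n ∈ Subgroup.normalizer (A : Set (Aut X))) :
    ∃ k : Aut Y, π ≫ k.hom = n.hom ≫ π := by
  obtain ⟨k, hk⟩ := h.exists_desc_normalizer hn
  obtain ⟨k', hk'⟩ := h.exists_desc_normalizer (inv_mem hn)
  change _ = n.inv ≫ _ at hk'
  refine ⟨⟨k, k', h.hom_ext ?_, h.hom_ext ?_⟩, hk⟩
  · rw [reassoc_of% hk, hk', Iso.hom_inv_id_assoc n, Category.comp_id]
  · rw [reassoc_of% hk', hk, Iso.inv_hom_id_assoc n, Category.comp_id]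

/-- The action of the normalizer on the quotient. -/
theorem exists_monoidHom (h : IsQuotientBy A π) :
    ∃ ι : Subgroup.normalizer (A : Set (Aut X)) ⧸
        A.subgroupOf (Subgroup.normalizer (A : Set (Aut X))) →* Aut Y,
      ∀ n, π ≫ (ι (QuotientGroup.mk n)).hom = n.1.hom ≫ π := by
  choose k hk using fun n : Subgroup.normalizer (A : Set (Aut X)) => h.exists_aut n.2
  have hmul : ∀ n m, k (n * m) = k n * k m := fun n m => by
    ext1
    refine h.hom_ext ?_
    change _ = π ≫ (k m).hom ≫ (k n).hom
    rw [hk, reassoc_of% (hk m), hk]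
    exact Category.assoc _ _ _
  let κ := MonoidHom.mk' k hmul
  refine ⟨QuotientGroup.lift _ κ ?_, hk⟩
  intro n hn
  ext1
  refine h.hom_ext ?_
  change π ≫ (k n).hom = π ≫ 𝟙 _
  rw [hk, Category.comp_id]
  exact h.invariant _ hn

end IsQuotientBy

end Universal

/-- An algebra endomorphism over an infinite field that pointwise agrees with one of finitely many
endomorphisms is equal to one of them. -/
theorem exists_eq_of_forall_exists_apply_eq {k R ι : Type*} [Field k] [Infinite k] [CommRing R]
    [Algebra k R] [Finite ι] (φ : ι → R →ₐ[k] R) (θ : R →ₐ[k] R)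
    (h : ∀ r, ∃ i, θ r = φ i r) : ∃ i, θ = φ i := by
  classical
  have := Fintype.ofFinite ι
  let p : ι → Subspace k R := fun i => LinearMap.eqLocus θ.toLinearMap (φ i).toLinearMap
  -- Finitely many subspaces covering a vector space over an infinite field include the whole space.
  have h1 : (⊤ : Subspace k R) ∈ Finset.univ.image p := by
    refine Subspace.top_mem_of_biUnion_eq_univ ?_
    refine Set.eq_univ_of_forall fun r => ?_
    obtain ⟨i, hi⟩ := h r
    simp only [Set.mem_iUnion]
    exact ⟨p i, Finset.mem_image_of_mem _ (Finset.mem_univ i), hi⟩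
  obtain ⟨i, -, hi⟩ := Finset.mem_image.1 h1
  refine ⟨i, AlgHom.ext fun r => ?_⟩
  have h2 : r ∈ p i := hi ▸ Submodule.mem_top
  exact h2

section Faithful

variable {K : Type u} [Field K] {Kbar : Type u} [Field Kbar] [Algebra K Kbar]
  {V : Over (Spec (.of K))} [IsAlgClosure K Kbar] [CharZero K]
  {A : Subgroup (Aut (baseChange Kbar V))} {E : Subgroup (Aut (baseChange Kbar V).left)}

/-- An automorphism that induces the identity on the quotient belongs to the group. -/
theorem IsDescentGroup.mem_of_hom_comp_eq (hE : IsDescentGroup A E) (hV : IsVariety Kbar V)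
    (hVaff : FiniteSetsInAffineOpens V.left) {Y : Over (Spec (.of Kbar))}
    {π : baseChange Kbar V ⟶ Y} (hπ : IsQuotientBy A π) {n : Aut (baseChange Kbar V)}
    (hn : n.hom ≫ π = π) : n ∈ A := by
  have := hE.finite
  have := hV.isIntegral
  have := hV.isSeparated_baseChange
  have : CharZero Kbar := charZero_of_injective_algebraMap (algebraMap K Kbar).injective
  have hq := hπ.isGeometricQuotient
  obtain ⟨U, hxU, hstab, hU⟩ := hE.exists_isStable hVaff
    (Classical.arbitrary (baseChange Kbar V).left)
  have hA : IsStable (leftAction A) U := fun α => hstab (hE.incl α)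
  -- A stable open set is saturated, so it is the preimage of an open subset of the quotient; n
  -- preserves such preimages.
  have hsat : π.left ⁻¹' (π.left '' U) = U := by
    refine subset_antisymm ?_ (Set.subset_preimage_image _ _)
    rintro x ⟨y, hy, hyx⟩
    obtain ⟨α, rfl⟩ := hq.orbit _ _ hyx
    exact hA α hy
  obtain ⟨O, rfl⟩ : ∃ O, π.left ⁻¹ᵁ O = U := by
    refine ⟨⟨π.left '' U, hq.isQuotientMap.isOpen_preimage.1 ?_⟩, TopologicalSpace.Opens.ext hsat⟩
    rw [hsat]
    exact U.2
  have hnU := preimage_le_of_invariant hn O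
  let R := Γ((baseChange Kbar V).left, π.left ⁻¹ᵁ O)
  have : Nonempty (π.left ⁻¹ᵁ O : (baseChange Kbar V).left.Opens) := ⟨⟨_, hxU⟩⟩
  algebraize [(constants (baseChange Kbar V).hom (π.left ⁻¹ᵁ O)).hom]
  let θ : R →ₐ[Kbar] R :=
    { (n.hom.left.appLE (π.left ⁻¹ᵁ O) (π.left ⁻¹ᵁ O) hnU).hom with
      commutes' := appLE_constants_of_comp_eq _ _ _ (Over.w n.hom) _ }
  let φ : A → R →ₐ[Kbar] R := fun α =>
    { sectionAction hA α with
      commutes' := appLE_constants_of_comp_eq _ _ _ (Over.w α.1.hom) _ }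
  -- n fixes all invariants, so it sends each r to a root of the orbit polynomial of r, that is, to
  -- α r with α depending on r; the covering argument makes α uniform.
  obtain ⟨α, hα⟩ := exists_eq_of_forall_exists_apply_eq φ θ fun r => by
    refine ((isAction_leftAction A).sectionAction hA).exists_apply_eq (Set.finite_range _)
      (θ : R →+* R) fun s hs => ?_
    obtain ⟨t, rfl⟩ := hq.mem_range O hA s hs
    rw [Scheme.Hom.app_eq_appLE]
    exact (appLE_appLE_apply n.hom.left π.left _ _ t).trans
      (appLE_congr_hom (congrArg CommaMorphism.left hn) _ _ _)
  have h1 : (π.left ⁻¹ᵁ O).ι ≫ n.hom.left = (π.left ⁻¹ᵁ O).ι ≫ α.1.hom.left :=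
    ι_comp_eq_of_appLE_eq hU hnU (hA α) fun t => DFunLike.congr_fun hα t
  have : IsDominant (π.left ⁻¹ᵁ O).ι :=
    Opens.isDominant_ι ((π.left ⁻¹ᵁ O).2.dense ⟨_, hxU⟩)
  have h2 : n = α.1 := by
    ext1
    exact Over.OverMorphism.ext (ext_of_isDominant (ι := (π.left ⁻¹ᵁ O).ι) h1)
  exact h2 ▸ α.2

end Faithful

/-! ### The two descent groups: for the quotient and for the twist -/

section Galois

variable {K : Type u} [Field K] {Kbar : Type u} [Field Kbar] [Algebra K Kbar]
  {V W : Over (Spec (.of K))} {σ τ : Gal(Kbar/K)}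

theorem galConj_eq_iff {g h : baseChange Kbar V ⟶ baseChange Kbar W} :
    galConj σ g = h ↔ galMap σ V ≫ g.left = h.left ≫ galMap σ W := by
  constructor
  · rintro rfl
    rw [galConj_left, Category.assoc, Category.assoc, galMap_inv_comp, Category.comp_id]
  · intro hg
    apply Over.OverMorphism.ext
    rw [galConj_left, reassoc_of% hg, galMap_comp_inv, Category.comp_id]

theorem galConj_baseChangeMap (σ : Gal(Kbar/K)) (g : V ⟶ W) :
    galConj σ (baseChangeMap Kbar g) = baseChangeMap Kbar g := by
  apply Over.OverMorphism.ext
  apply (isPullback_proj W).hom_ext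
  · rw [galConj_left, Category.assoc, Category.assoc, galMap_proj, baseChangeMap_proj,
      ← Category.assoc, galMap_proj]
  · rw [Over.w, Over.w]

theorem galIso_mul (σ τ : Gal(Kbar/K)) : galIso (σ * τ) V = galIso τ V * galIso σ V := by
  ext1
  exact galMap_mul σ τ V

theorem leftAut_mul {S : Scheme.{u}} {X : Over S} (α β : Aut X) :
    leftAut (α * β) = leftAut α * leftAut β := rfl

/-- The commutation rule between linear automorphisms and Galois maps; it makes the products of G_K
with a Galois-stable group closed under multiplication. -/
theorem leftAut_mul_galIso (σ : Gal(Kbar/K)) (α : Aut (baseChange Kbar V)) :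
    leftAut α * galIso σ V = galIso σ V * leftAut (galConjAut σ α) := by
  ext1
  exact galConj_eq_iff.1 (rfl : galConj σ α.hom = (galConjAut σ α).hom)

theorem isSemilinear_galIso_mul (σ : Gal(Kbar/K)) (α : Aut (baseChange Kbar V)) :
    IsSemilinear σ (galIso σ V * leftAut α) := by
  have h := (isSemilinear_galIso (V := V) σ).mul (isSemilinear_leftAut α)
  rwa [one_mul] at h

theorem leftAut_injective {S : Scheme.{u}} {X : Over S} :
    Function.Injective (leftAut : Aut X → Aut X.left) := fun α β h => by
  ext1
  exact Over.OverMorphism.ext (congrArg Iso.hom h)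

/-- The group generated by the Galois group and a Galois-stable group of automorphisms. -/
noncomputable def galExtension {A : Subgroup (Aut (baseChange Kbar V))}
    (hA : IsDefinedOverSubgroup A) : Subgroup (Aut (baseChange Kbar V).left) where
  carrier := {e | ∃ σ : Gal(Kbar/K), ∃ α ∈ A, galIso σ V * leftAut α = e}
  one_mem' := by
    refine ⟨1, 1, one_mem _, ?_⟩
    ext1
    exact (Category.id_comp _).trans (galMap_one V)
  mul_mem' := by
    rintro _ _ ⟨σ, α, hα, rfl⟩ ⟨τ, β, hβ, rfl⟩
    refine ⟨τ * σ, galConjAut τ α * β, mul_mem (hA τ α hα) hβ, ?_⟩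
    rw [galIso_mul, leftAut_mul, mul_assoc, ← mul_assoc (galIso τ V), ← leftAut_mul_galIso]
    simp only [mul_assoc]
  inv_mem' := by
    rintro _ ⟨σ, α, hα, rfl⟩
    refine ⟨σ⁻¹, galConjAut σ⁻¹ α⁻¹, hA _ _ (inv_mem hα), ?_⟩
    rw [← leftAut_mul_galIso, mul_inv_rev]
    rfl

theorem isDescentGroup_galExtension {A : Subgroup (Aut (baseChange Kbar V))} [Finite A]
    (hA : IsDefinedOverSubgroup A) [Nonempty (baseChange Kbar V).left] :
    IsDescentGroup A (galExtension hA) where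
  finite := inferInstance
  semilinear := by
    rintro _ ⟨σ, α, -, rfl⟩
    exact ⟨σ, isSemilinear_galIso_mul σ α⟩
  exists_mem σ := ⟨_, ⟨σ, 1, one_mem _, rfl⟩, isSemilinear_galIso_mul σ 1⟩
  mem_iff α := by
    constructor
    · rintro ⟨σ, β, hβ, h⟩
      have h1 := isSemilinear_galIso_mul σ β
      rw [h] at h1
      obtain rfl := eq_of_hom_comp_specGal_eq ((isSemilinear_leftAut α).symm.trans h1)
      have h2 : galIso (1 : Gal(Kbar/K)) V = 1 := by
        ext1
        exact galMap_one V
      rw [h2, one_mul] at h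
      exact leftAut_injective h ▸ hβ
    · intro hα
      refine ⟨1, α, hα, ?_⟩
      ext1
      change _ ≫ galMap 1 V = _
      rw [galMap_one, Category.comp_id]
  eventually := .of_forall fun σ => ⟨σ, 1, one_mem _, mul_one _⟩

/-- The semilinear automorphisms that commute with `f`. -/
noncomputable def semilinearAutGroup (f : baseChange Kbar V ⟶ baseChange Kbar V) :
    Subgroup (Aut (baseChange Kbar V).left) where
  carrier := {e | (∃ σ : Gal(Kbar/K), IsSemilinear σ e) ∧ e ∈ autGroup f.left}
  one_mem' := ⟨⟨1, isSemilinear_leftAut 1⟩, one_mem _⟩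
  mul_mem' := by
    rintro _ _ ⟨⟨σ, hσ⟩, h⟩ ⟨⟨τ, hτ⟩, h'⟩
    exact ⟨⟨_, hσ.mul hτ⟩, mul_mem h h'⟩
  inv_mem' := by
    rintro _ ⟨⟨σ, hσ⟩, h⟩
    exact ⟨⟨_, hσ.inv⟩, inv_mem h⟩

/-- The equality f^σ = f^ψ says exactly that ψ⁻¹ followed by the Galois map of σ commutes with f. -/
theorem galIso_mul_mem_semilinearAutGroup {f : baseChange Kbar V ⟶ baseChange Kbar V}
    {ψ : Aut (baseChange Kbar V)} (hψ : ψ ∈ conjugators f σ) :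
    galIso σ V * leftAut ψ⁻¹ ∈ semilinearAutGroup f := by
  refine ⟨⟨σ, isSemilinear_galIso_mul σ _⟩, mem_autGroup_iff.2 ?_⟩
  change (ψ.inv.left ≫ galMap σ V) ≫ f.left = f.left ≫ ψ.inv.left ≫ galMap σ V
  have h1 : ψ.inv ≫ galConj σ f = f ≫ ψ.inv := by
    rw [Iso.inv_comp_eq (α := ψ), ← Category.assoc, mem_conjugators_iff.1 hψ, Category.assoc,
      Iso.hom_inv_id ψ, Category.comp_id]
  have h2 : ψ.inv.left ≫ (galConj σ f).left = f.left ≫ ψ.inv.left :=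
    congrArg CommaMorphism.left h1
  rw [Category.assoc, galConj_eq_iff.1 (rfl : galConj σ f = _), reassoc_of% h2]

variable [IsAlgClosure K Kbar]

/-- Conjugators for every σ make the group surject onto G_K, its linear elements are Aut(f) by
definition, and the open subgroup fixing f lies in it. -/
theorem isDescentGroup_semilinearAutGroup (hV : IsVariety Kbar V)
    (f : baseChange Kbar V ⟶ baseChange Kbar V) [Finite (autGroup f)]
    (hne : ∀ σ : Gal(Kbar/K), (conjugators f σ).Nonempty) :
    IsDescentGroup (autGroup f) (semilinearAutGroup f) where
  finite := inferInstance
  semilinear e he := he.1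
  exists_mem σ := by
    obtain ⟨ψ, hψ⟩ := hne σ
    exact ⟨_, galIso_mul_mem_semilinearAutGroup hψ, isSemilinear_galIso_mul σ _⟩
  mem_iff α := by
    rw [mem_autGroup_iff]
    constructor
    · rintro ⟨-, h⟩
      exact Over.OverMorphism.ext (mem_autGroup_iff.1 h)
    · intro h
      exact ⟨⟨1, isSemilinear_leftAut α⟩, mem_autGroup_iff.2 (congrArg CommaMorphism.left h)⟩
  eventually := by
    filter_upwards [eventually_galConj_eq hV hV f] with σ hσ
    exact ⟨⟨σ, isSemilinear_galIso σ⟩, mem_autGroup_iff.2 (galConj_eq_iff.1 hσ)⟩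

variable [CharZero K]

/-- The quotient of a variety by a Galois-stable finite group is defined over the base field. -/
theorem exists_isQuotientBy_baseChangeMap {A : Subgroup (Aut (baseChange Kbar V))} [Finite A]
    (hV : IsVariety Kbar V) (hVaff : FiniteSetsInAffineOpens V.left)
    (hA : IsDefinedOverSubgroup A) :
    ∃ (Q : Over (Spec (.of K))) (q : V ⟶ Q),
      IsVariety Kbar Q ∧ IsQuotientBy A (baseChangeMap Kbar q) := by
  have := hV.isIntegral
  obtain ⟨Q, π, hQ, hπ, h⟩ := (isDescentGroup_galExtension hA).exists_quotient hV hVaff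
  -- This descent group contains the Galois maps themselves, so π is Galois invariant.
  obtain ⟨q, rfl⟩ := isDefinedOver_of_galConj_eq hV hQ π fun σ =>
    galConj_eq_iff.2 (h _ ⟨σ, 1, one_mem _, mul_one _⟩ σ (isSemilinear_galIso σ))
  exact ⟨Q, q, hQ, hπ⟩

end Galois

/-! ### Galois action on points and orbits of points -/

section Points

variable {K : Type u} [Field K] {Kbar : Type u} [Field Kbar] [Algebra K Kbar]
  {V W : Over (Spec (.of K))}

theorem galConjPoint_comp (σ : Gal(Kbar/K)) (P : Point Kbar V)
    (g : baseChange Kbar V ⟶ baseChange Kbar W) :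
    galConjPoint σ (P ≫ g) = galConjPoint σ P ≫ galConj σ g := by
  apply Over.OverMorphism.ext
  change specGal σ ≫ (P.left ≫ g.left) ≫ galMap σ⁻¹ W =
    (specGal σ ≫ P.left ≫ galMap σ⁻¹ V) ≫ galMap σ V ≫ g.left ≫ galMap σ⁻¹ W
  simp only [Category.assoc]
  rw [← Category.assoc (galMap σ⁻¹ V), galMap_inv_comp, Category.id_comp]

theorem galConjPoint_eq_of_isRationalPoint {P : Point Kbar V} (hP : IsRationalPoint P)
    (σ : Gal(Kbar/K)) : galConjPoint σ P = P := by
  obtain ⟨p, hp⟩ := hP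
  change P.left ≫ proj Kbar V = _ at hp
  apply Over.OverMorphism.ext
  apply (isPullback_proj V).hom_ext
  · change (specGal σ ≫ P.left ≫ galMap σ⁻¹ V) ≫ proj Kbar V = _
    rw [Category.assoc, Category.assoc, galMap_proj, hp, ← Category.assoc, specGal_comp_specMap]
  · rw [Over.w, Over.w]

/-- Over an algebraically closed field, two points with the same image in the quotient lie in the
same orbit. -/
theorem IsQuotientBy.exists_comp_eq {k : Type u} [Field k] [IsAlgClosed k]
    {X Y : Over (Spec (.of k))} {A : Subgroup (Aut X)} {π : X ⟶ Y} (hπ : IsQuotientBy A π)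
    [LocallyOfFiniteType X.hom] {P P' : Over.mk (𝟙 (Spec (.of k))) ⟶ X} (h : P ≫ π = P' ≫ π) :
    ∃ α ∈ A, P ≫ α.hom = P' := by
  obtain ⟨α, hα, hP⟩ := hπ.orbit (P.left (IsLocalRing.closedPoint k))
    (P'.left (IsLocalRing.closedPoint k)) (by
      have h1 : P.left ≫ π.left = P'.left ≫ π.left := congrArg CommaMorphism.left h
      exact congrArg (fun g : Spec (.of k) ⟶ Y.left => g (IsLocalRing.closedPoint k)) h1)
  refine ⟨α, hα, Over.OverMorphism.ext ?_⟩
  -- Over an algebraically closed field a rational point of a scheme locally of finite type is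
  -- determined by its underlying point.
  refine ext_of_apply_closedPoint_eq X.hom (Over.w (P ≫ α.hom)) (Over.w P') ?_
  rw [← hP]
  rfl

end Points

/-! ### The cocycle, the twist and its rational points -/

section Twist

variable {K : Type u} [Field K] {Kbar : Type u} [Field Kbar] [Algebra K Kbar]
  {V Q T : Over (Spec (.of K))} {f : baseChange Kbar V ⟶ baseChange Kbar V} {q : V ⟶ Q}
  {c : Gal(Kbar/K) → Aut (baseChange Kbar Q)} {F : baseChange Kbar T ≅ baseChange Kbar Q}

theorem IsTwist.galConjIso_trans (hF : IsTwist c F) (σ : Gal(Kbar/K)) :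
    galConjIso σ F ≪≫ c σ = F :=
  Iso.ext (hF σ)

theorem galConj_comp_baseChangeMap (τ : Gal(Kbar/K)) {h : baseChange Kbar V ⟶ baseChange Kbar V}
    {k : baseChange Kbar Q ⟶ baseChange Kbar Q}
    (hk : baseChangeMap Kbar q ≫ k = h ≫ baseChangeMap Kbar q) :
    baseChangeMap Kbar q ≫ galConj τ k = galConj τ h ≫ baseChangeMap Kbar q := by
  have h1 := congrArg (galConj τ) hk
  rwa [galConj_comp, galConj_comp, galConj_baseChangeMap] at h1

/-- `c` is induced on the quotient by the automorphisms that conjugate `f` into its Galois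
conjugates. -/
def IsInduced (f : baseChange Kbar V ⟶ baseChange Kbar V) (q : V ⟶ Q)
    (c : Gal(Kbar/K) → Aut (baseChange Kbar Q)) : Prop :=
  ∀ σ, ∀ ψ ∈ conjugators f σ,
    baseChangeMap Kbar q ≫ (c σ).hom = ψ.hom ≫ baseChangeMap Kbar q

variable (hQ : IsVariety Kbar Q)
  (hq : IsQuotientBy (autGroup f) (baseChangeMap Kbar q)) (hc : IsInduced f q c)
  (hne : ∀ σ : Gal(Kbar/K), (conjugators f σ).Nonempty)

include hQ hq hc hne

/-- If ψ and ψ' conjugate f to f^τ and f^σ, then ψ ∘ ψ'^τ conjugates f to f^(τσ), and this passes to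
the quotient. Continuity holds because f^(στ) = f^σ for τ near 1. -/
theorem IsInduced.isCocycle [IsAlgClosure K Kbar] [CharZero K] (hV : IsVariety Kbar V) :
    IsCocycle c where
  map_mul τ σ := by
    have := hQ.isIntegral
    have := hQ.isSeparated_baseChange
    obtain ⟨ψ, hψ⟩ := hne τ
    obtain ⟨ψ', hψ'⟩ := hne σ
    ext1
    refine hq.hom_ext ?_
    rw [hc _ _ (mul_galConjAut_mem_conjugators hψ hψ')]
    change (galConj τ ψ'.hom ≫ ψ.hom) ≫ _ = _ ≫ galConj τ (c σ).hom ≫ (c τ).hom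
    rw [Category.assoc, ← hc _ _ hψ, ← Category.assoc,
      ← galConj_comp_baseChangeMap τ (hc _ _ hψ'), Category.assoc]
  isLocallyConstant := by
    have := hQ.isIntegral
    have := hQ.isSeparated_baseChange
    have := isGalois_of_isAlgClosure K Kbar
    refine (finite_range_of_eventually c fun σ => ?_).1
    filter_upwards [eventually_galConj_eq hV hV f] with τ hτ
    obtain ⟨ψ, hψ⟩ := hne σ
    ext1
    refine hq.hom_ext ?_
    rw [hc _ _ hψ]
    refine hc _ _ ?_
    change galConj (σ * τ) f = _
    rw [galConj_mul, hτ]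
    exact hψ

/-- T is the quotient by the semilinear automorphisms commuting with f. Its base change and that of
Q are both quotients by Aut(f), hence isomorphic, and their Galois structures differ by the
conjugators. -/
theorem IsInduced.exists_isTwist [IsAlgClosure K Kbar] [CharZero K] [Finite (autGroup f)]
    (hV : IsVariety Kbar V) (hVaff : FiniteSetsInAffineOpens V.left) :
    ∃ (T : Over (Spec (.of K))) (F : baseChange Kbar T ≅ baseChange Kbar Q),
      IsVariety Kbar T ∧ IsTwist c F := by
  obtain ⟨T, π, hT, hπ, hsemi⟩ :=
    (isDescentGroup_semilinearAutGroup hV f hne).exists_quotient hV hVaff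
  have := hQ.isIntegral
  have := hQ.isSeparated_baseChange
  have := hT.isIntegral
  have := hT.isSeparated_baseChange
  obtain ⟨F, hF⟩ := hq.exists_iso hπ
  refine ⟨T, F, hT, fun σ => hπ.hom_ext ?_⟩
  obtain ⟨ψ, hψ⟩ := hne σ
  -- The element ψ⁻¹ followed by the Galois map of σ induces on T exactly the Galois map of σ,
  -- whence π^σ = π ∘ ψ.
  have h1 : galConj σ π = ψ.hom ≫ π := by
    have h2 := hsemi _ (galIso_mul_mem_semilinearAutGroup hψ) σ (isSemilinear_galIso_mul σ _)
    change (ψ.inv.left ≫ galMap σ V) ≫ π.left = π.left ≫ galMap σ T at h2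
    have h3 : ψ.hom.left ≫ ψ.inv.left = 𝟙 _ := congrArg CommaMorphism.left ψ.hom_inv_id
    rw [galConj_eq_iff, Over.comp_left, Category.assoc, ← h2, ← Category.assoc,
      ← Category.assoc ψ.hom.left, h3, Category.id_comp]
  have h2 := congrArg (galConj σ) hF
  rw [galConj_comp, galConj_baseChangeMap, h1, Category.assoc] at h2
  have : IsIso ψ.hom := Iso.isIso_hom ψ
  rw [hF, ← cancel_epi ψ.hom, reassoc_of% h2, hc _ _ hψ]

/-- Write f̄ for `fbar`. Since f^σ = f^ψ, passing to the quotient gives f̄^σ = f̄ conjugated by c_σ.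
Then (f̄^F)^σ is f̄ conjugated by c_σ ∘ F^σ = F, so f̄^F is Galois invariant. -/
theorem IsInduced.isDefinedOver_conj [IsAlgClosure K Kbar] [CharZero K]
    {fbar : baseChange Kbar Q ⟶ baseChange Kbar Q}
    (hfbar : baseChangeMap Kbar q ≫ fbar = f ≫ baseChangeMap Kbar q) (hT : IsVariety Kbar T)
    (hF : IsTwist c F) : IsDefinedOver (conj fbar F) := by
  have := hQ.isIntegral
  have := hQ.isSeparated_baseChange
  refine isDefinedOver_of_galConj_eq hT hT _ fun σ => ?_
  obtain ⟨ψ, hψ⟩ := hne σ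
  have h1 : conj fbar (c σ) = galConj σ fbar := by
    refine (conj_eq_iff _ _ _).2 (hq.hom_ext ?_)
    rw [reassoc_of% (hc _ _ hψ), hfbar, ← Category.assoc, mem_conjugators_iff.1 hψ,
      ← Category.assoc, galConj_comp_baseChangeMap σ hfbar, Category.assoc, Category.assoc,
      hc _ _ hψ]
  rw [galConj_conj, ← h1]
  exact (conj_conj fbar (c σ) _).trans (congrArg (conj fbar) (hF.galConjIso_trans σ))

-- Conjugating the rational point F⁻¹(q(P)) by σ, and using that the conjugate of F⁻¹ is F⁻¹ ∘ c_σ,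
-- gives q(P) = c_σ(q(P^σ)) = q(ψ(P^σ)).
omit hQ hq hne in
theorem IsInduced.galConjPoint_comp_eq (hF : IsTwist c F) {P : Point Kbar V}
    (hP : IsRationalPoint ((P ≫ baseChangeMap Kbar q) ≫ F.inv)) {σ : Gal(Kbar/K)}
    {ψ : Aut (baseChange Kbar V)} (hψ : ψ ∈ conjugators f σ) :
    P ≫ baseChangeMap Kbar q = (galConjPoint σ P ≫ ψ.hom) ≫ baseChangeMap Kbar q := by
  have h1 := galConjPoint_eq_of_isRationalPoint hP σ
  rw [galConjPoint_comp, galConjPoint_comp, galConj_baseChangeMap] at h1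
  have h2 : galConj σ F.inv = (c σ).hom ≫ F.inv := by
    have h3 : (c σ).inv ≫ galConj σ F.inv = F.inv :=
      congrArg Iso.inv (hF.galConjIso_trans σ)
    exact (Iso.inv_comp_eq (α := c σ)).1 h3
  rw [h2, ← Category.assoc, cancel_mono, Category.assoc, hc _ _ hψ] at h1
  rw [← h1, Category.assoc]

-- P and ψ(P^σ) have the same image in the quotient, so α(P) = ψ(P^σ) for some α in Aut(f). Hence
-- ψ⁻¹(P) = (ψ⁻¹ α⁻¹ ψ)(P^σ), and ψ normalizes Aut(f).
omit hQ hne in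
theorem IsInduced.setOf_comp_inv_eq [IsAlgClosure K Kbar] (hV : IsVariety Kbar V)
    (hdef : IsDefinedOverSubgroup (autGroup f)) (hF : IsTwist c F) {P : Point Kbar V}
    (hP : IsRationalPoint ((P ≫ baseChangeMap Kbar q) ≫ F.inv)) {σ : Gal(Kbar/K)}
    (hσ : (conjugators f σ).Nonempty) :
    {R : Point Kbar V | ∃ ψ ∈ conjugators f σ, R = P ≫ ψ.inv} =
      {R : Point Kbar V | ∃ α ∈ autGroup f, R = galConjPoint σ P ≫ α.hom} := by
  have : IsAlgClosed Kbar := IsAlgClosure.isAlgClosed K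
  have := hV.locallyOfFiniteType_baseChange
  have key : ∀ ψ ∈ conjugators f σ, ∃ α ∈ autGroup f, P ≫ α.hom = galConjPoint σ P ≫ ψ.hom :=
    fun ψ hψ => hq.exists_comp_eq (hc.galConjPoint_comp_eq hF hP hψ)
  ext R
  constructor
  · rintro ⟨ψ, hψ, rfl⟩
    obtain ⟨α, hα, h⟩ := key ψ hψ
    have hN := Subgroup.mem_normalizer_iff''.1 (conjugators_subset_autNormalizer hdef hψ)
    refine ⟨ψ⁻¹ * α⁻¹ * ψ, (hN _).1 (inv_mem hα), ?_⟩
    change _ = _ ≫ ψ.hom ≫ α.inv ≫ ψ.inv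
    rw [← reassoc_of% h, Iso.hom_inv_id_assoc α]
  · rintro ⟨β, hβ, rfl⟩
    obtain ⟨ψ, hψ⟩ := hσ
    obtain ⟨α, hα, h⟩ := key ψ hψ
    have hN := Subgroup.mem_normalizer_iff.1 (conjugators_subset_autNormalizer hdef hψ)
    -- Chosen so that its inverse β ψ⁻¹ α sends P to β ψ⁻¹ ψ(P^σ) = β(P^σ); it stays in the same
    -- coset because ψ normalizes Aut(f).
    refine ⟨α⁻¹ * ψ * β⁻¹, ?_, ?_⟩
    · rw [mem_conjugators_iff_of_mem hψ, mul_assoc, mul_assoc, ← mul_assoc ψ]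
      exact mul_mem (inv_mem hα) ((hN _).1 (inv_mem hβ))
    · change _ = P ≫ (α⁻¹ * ψ * β⁻¹)⁻¹.hom
      have h1 : (α⁻¹ * ψ * β⁻¹)⁻¹ = β * (ψ⁻¹ * α) := by group
      rw [h1]
      change _ = P ≫ (α.hom ≫ ψ.inv) ≫ β.hom
      rw [Category.assoc, reassoc_of% h, Iso.hom_inv_id_assoc ψ]

end Twist

end FieldOfModuli

open FieldOfModuli in
theorem proposition14 {K Kbar : Type u} [Field K] [CharZero K] [Field Kbar] [Algebra K Kbar]
    [IsAlgClosure K Kbar]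
    (V : Over (Spec (.of K))) (hV : IsVariety Kbar V) (hVaff : FiniteSetsInAffineOpens V.left)
    (f : baseChange Kbar V ⟶ baseChange Kbar V) (hf : fieldOfModuli f = ⊥)
    (hfin : Finite (autGroup f)) (hdef : IsDefinedOverSubgroup (autGroup f)) :
    -- the quotient variety exists and is defined over `K`
    (∃ (Q : Over (Spec (.of K))) (q : V ⟶ Q),
      IsVariety Kbar Q ∧ IsQuotientBy (autGroup f) (baseChangeMap Kbar q)) ∧
    ∀ (Q : Over (Spec (.of K))) (q : V ⟶ Q), IsVariety Kbar Q →
      IsQuotientBy (autGroup f) (baseChangeMap Kbar q) →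
      -- `f` descends to the quotient
      (∃! fbar : baseChange Kbar Q ⟶ baseChange Kbar Q,
        baseChangeMap Kbar q ≫ fbar = f ≫ baseChangeMap Kbar q) ∧
      ∀ fbar : baseChange Kbar Q ⟶ baseChange Kbar Q,
        baseChangeMap Kbar q ≫ fbar = f ≫ baseChangeMap Kbar q →
        -- the map `φ` to `Aut(f) \ N(Aut(f))`, characterized by `f^σ = f^{φ_σ}`
        ∃ φ : Gal(Kbar/K) → NormalizerQuotient f,
          (∀ σ, conjugators f σ =
            {ψ | ∃ n : autNormalizer f, n.1 = ψ ∧ QuotientGroup.mk n = φ σ}) ∧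
          -- the natural injection of `Aut(f) \ N(Aut(f))` into `Aut(Q)`
          ∃ ι : NormalizerQuotient f →* Aut (baseChange Kbar Q),
            Function.Injective ι ∧
            (∀ n : autNormalizer f,
              baseChangeMap Kbar q ≫ (ι (QuotientGroup.mk n)).hom =
                n.1.hom ≫ baseChangeMap Kbar q) ∧
            IsCocycle (fun σ => ι (φ σ)) ∧
            -- the twist exists
            (∃ (T : Over (Spec (.of K))) (F : baseChange Kbar T ≅ baseChange Kbar Q),
              IsVariety Kbar T ∧ IsTwist (fun σ => ι (φ σ)) F) ∧
            ∀ (T : Over (Spec (.of K))) (F : baseChange Kbar T ≅ baseChange Kbar Q),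
              IsVariety Kbar T → IsTwist (fun σ => ι (φ σ)) F →
              IsDefinedOver (conj fbar F) ∧
              ∀ P : Point Kbar V,
                IsRationalPoint ((P ≫ baseChangeMap Kbar q) ≫ F.inv) →
                ∀ σ : Gal(Kbar/K),
                  {R : Point Kbar V | ∃ ψ ∈ conjugators f σ, R = P ≫ ψ.inv} =
                    {R : Point Kbar V | ∃ α ∈ autGroup f, R = galConjPoint σ P ≫ α.hom} := by
  have := hV.isIntegral
  have hne := conjugators_nonempty hV hf
  refine ⟨exists_isQuotientBy_baseChangeMap hV hVaff hdef, fun Q q hQ hq => ?_⟩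
  have := hQ.isIntegral
  have := hQ.isSeparated_baseChange
  refine ⟨?_, fun fbar hfbar => ?_⟩
  · obtain ⟨fbar, hfbar⟩ := hq.exists_desc (f ≫ baseChangeMap Kbar q) fun α hα => by
      rw [← Category.assoc, mem_autGroup_iff.1 hα, Category.assoc, hq.invariant α hα]
    exact ⟨fbar, hfbar, fun k hk => hq.hom_ext (hk.trans hfbar.symm)⟩
  obtain ⟨φ, hφ⟩ := exists_conjugators_eq hdef hne
  obtain ⟨ι, hι⟩ := hq.exists_monoidHom
  have hc : IsInduced f q fun σ => ι (φ σ) := fun σ ψ hψ => by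
    rw [hφ] at hψ
    obtain ⟨n, rfl, hn⟩ := hψ
    change _ ≫ (ι (φ σ)).hom = _
    rw [← hn, hι n]
  refine ⟨φ, hφ, ι, ?_, hι, hc.isCocycle hQ hq hne hV, hc.exists_isTwist hQ hq hne hV hVaff,
    fun T F hT hF => ⟨hc.isDefinedOver_conj hQ hq hne hfbar hT hF, fun P hP σ =>
      hc.setOf_comp_inv_eq hq hV hdef hF hP (hne σ)⟩⟩
  rw [injective_iff_map_eq_one]
  intro x hx
  obtain ⟨n, rfl⟩ := QuotientGroup.mk_surjective x
  refine (QuotientGroup.eq_one_iff n).2 ?_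
  -- A class in the kernel is represented by an automorphism inducing the identity on the quotient,
  -- and such an automorphism lies in Aut(f).
  refine (isDescentGroup_galExtension hdef).mem_of_hom_comp_eq hV hVaff hq ?_
  refine (hι n).symm.trans ?_
  rw [hx]
  exact Category.comp_id _
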